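/- **Setting.** $\mathrm{SO}(3)$ carries its normalized Haar measure; $\hat v$ (also $v^\wedge$) is the skew-symmetric matrix of the map $y\mapsto v\times y$ and $(\cdot)^\vee$ is the inverse of the hat map. For $S=\mathrm{diag}(s_1,s_2,s_3)$ let $c(S)=\int_{\mathrm{SO}(3)}e^{\mathrm{tr}(SQ^T)}dQ$. For $\mu\in\mathbb R^n$, $\Sigma=\Sigma^T\in\mathbb R^{n\times n}$, $P\in\mathbb R^{n\times3}$, $U,V\in\mathrm{SO}(3)$, $S=\mathrm{diag}(s_1,s_2,s_3)$ with $s_1\ge s_2\ge|s_3|$, such that $\Sigma_c=\Sigma-P(\mathrm{tr}(S)I-S)P^T\succ0$, the matrix Fisher–Gaussian distribution $\mathcal{MG}(\mu,\Sigma,P,U,S,V)$ on $\mathrm{SO}(3)\times\mathbb R^n$ is the law with density $$\frac{1}{c(S)\sqrt{(2\pi)^n\det\Sigma_c}}\exp\Big(-\tfrac12(x-\mu_c)^T\Sigma_c^{-1}(x-\mu_c)\Big)e^{\mathrm{tr}(USV^TR^T)},$$ where $\mu_c=\mu+P\nu_R$, $\nu_R=(QS-SQ^T)^\vee$, $Q=U^TRV$.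 Let $(R_k,x_k)\sim\mathcal{MG}(\mu_k,\Sigma_k,P_k,U_k,S_k,V_k)$ with $n=3$, and put $Q_k=U_k^TR_kV_k$, $\nu_{R_k}=(Q_kS_k-S_kQ_k^T)^\vee$, $\Sigma_{c_k}=\Sigma_k-P_k(\mathrm{tr}(S_k)I-S_k)P_k^T$. Let $\Omega_k\in\mathbb R^3$ and $H_u,H_v\in\mathbb R^{3\times3}$ be deterministic, $G_u=H_uH_u^T$, $G_v=H_vH_v^T$. For $h>0$ let $\Delta W_u,\Delta W_v\sim\mathcal N(0,hI)$ be independent of each other and jointly independent of $(R_k,x_k)$, and let $$R_{k+1}=R_k\exp\{h(\hat\Omega_k+\hat x_k)+(H_u\Delta W_u)^\wedge\},\qquad x_{k+1}=x_k+H_v\Delta W_v .$$ Let $(U_{k+1},S_{k+1},V_{k+1})$, which depends on $h$, be any maximum likelihood estimate of the attitude part from $\mathrm E[R_{k+1}]$, i.e. a maximizer of $\mathrm{tr}(USV^T\,\mathrm E[R_{k+1}]^T)-\log c(S)$ over $U,V\in\mathrm{SO}(3)$ and $S=\mathrm{diag}(s_1,s_2,s_3)$ with $s_1\ge s_2\ge|s_3|$.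 Put $Q_{k+1}=U_{k+1}^TR_{k+1}V_{k+1}$ and $\nu_{R_{k+1}}=(Q_{k+1}S_{k+1}-S_{k+1}Q_{k+1}^T)^\vee$. Define $$\tilde U=U_{k+1}^TU_k,\quad \tilde V=V_{k+1}^Te^{-h(\hat\Omega_k+\hat\mu_k)}V_k,\quad \tilde S=\tilde U^TS_{k+1}\tilde V,$$ $$\tilde{\tilde V}=V_{k+1}^Te^{-h(\hat\Omega_k+\hat\mu_k)}G_u^TV_k,\quad \tilde{\tilde S}=\tilde U^TS_k\tilde{\tilde V},$$ $$\tilde\nu_R=(Q_k\tilde S^T-\tilde SQ_k^T)^\vee,\quad \tilde{\tilde\nu}_R=(Q_k\tilde{\tilde S}^T-\tilde{\tilde S}Q_k^T)^\vee,\quad \Gamma_Q=\big(\mathrm{tr}(Q_k\tilde S^T)I-Q_k\tilde S^T\big)Q_k .$$ **Theorem.** For every $h>0$ the moments below exist (are integrable), and $$\mathrm E[x_{k+1}]=\mu_k,\qquad \mathrm E[\nu_{R_{k+1}}]=0,\qquad \mathrm E[x_{k+1}x_{k+1}^T]=\mathrm E[x_kx_k^T]+hG_v .$$ Moreover, as $h\to0^+$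 (with the parameters at step $k$, $\Omega_k$, $H_u$, $H_v$ fixed), $$\begin{aligned}\mathrm E[x_{k+1}\nu_{R_{k+1}}^T]={}&h\Sigma_{c_k}V_k\mathrm E[\Gamma_Q^T]\tilde U^T\\&+\mu_k\Big(\mathrm E[\tilde\nu_R^T]+\tfrac h2\mathrm E[\tilde{\tilde\nu}_R^T]-\tfrac h2\mathrm{tr}(G_u)\mathrm E[\tilde\nu_R^T]+h\mathrm E[\nu_{R_k}^TP_k^TV_k\Gamma_Q^T]\Big)\tilde U^T\\&+P_k\Big(\mathrm E[\nu_{R_k}\tilde\nu_R^T]+\tfrac h2\mathrm E[\nu_{R_k}\tilde{\tilde\nu}_R^T]-\tfrac h2\mathrm{tr}(G_u)\mathrm E[\nu_{R_k}\tilde\nu_R^T]+h\mathrm E[\nu_{R_k}\nu_{R_k}^TP_k^TV_k\Gamma_Q^T]\Big)\tilde U^T+O(h^2),\end{aligned}$$ $$\begin{aligned}\mathrm E[\nu_{R_{k+1}}\nu_{R_{k+1}}^T]=\tilde U\Big(&\mathrm E[\tilde\nu_R\tilde\nu_R^T]-h\,\mathrm{tr}(G_u)\mathrm E[\tilde\nu_R\tilde\nu_R^T]+\tfrac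 h2\mathrm E[\tilde\nu_R\tilde{\tilde\nu}_R^T]+\tfrac h2\mathrm E[\tilde{\tilde\nu}_R\tilde\nu_R^T]\\&+h\mathrm E[\tilde\nu_R\nu_{R_k}^TP_k^TV_k\Gamma_Q^T]+h\mathrm E[\tilde\nu_R\nu_{R_k}^TP_k^TV_k\Gamma_Q^T]^T+h\mathrm E[\Gamma_QV_k^TG_uV_k\Gamma_Q^T]\Big)\tilde U^T+O(h^2).\end{aligned}$$ Finally, for every $T\in\mathbb R^{3\times3}$ the map $Q\mapsto(\mathrm{tr}(QT^T)I-QT^T)Q$ agrees on $\mathrm{SO}(3)$ with a linear map; in particular $\Gamma_Q$ is linear in $Q_k$, so the expectations on the right-hand sides involve only moments of $Q_k$ up to the third order. -/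

import Mathlib

open Matrix MeasureTheory ProbabilityTheory Filter Topology

/-- Real `3 × 3` matrices. -/
abbrev Mat3 : Type := Matrix (Fin 3) (Fin 3) ℝ

/-! ### The rotation group and its normalized Haar measure -/

/-- The rotation group `SO(3)`. -/
abbrev SO3 : Type := Matrix.specialOrthogonalGroup (Fin 3) ℝ

theorem SO3.mem_iff (A : Mat3) :
    A ∈ Matrix.specialOrthogonalGroup (Fin 3) ℝ ↔ A * Aᵀ = 1 ∧ A.det = 1 := by
  rw [Matrix.mem_specialOrthogonalGroup_iff, Matrix.mem_orthogonalGroup_iff]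

instance SO3.instMeasurableSpace : MeasurableSpace SO3 := borel SO3

instance SO3.instBorelSpace : BorelSpace SO3 := ⟨rfl⟩

theorem SO3.coe_inv (A : SO3) : ((A⁻¹ : SO3) : Mat3) = (A : Mat3)ᵀ := by
  rfl

instance SO3.instIsTopologicalGroup : IsTopologicalGroup SO3 where
  continuous_mul := by
    refine Continuous.subtype_mk (f := fun p : SO3 × SO3 => (p.1 : Mat3) * (p.2 : Mat3)) ?_ _
    exact (continuous_subtype_val.comp continuous_fst).matrix_mul
      (continuous_subtype_val.comp continuous_snd)
  continuous_inv := by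
    rw [continuous_induced_rng]
    exact continuous_subtype_val.matrix_transpose

theorem SO3.isCompact_coe :
    IsCompact (Matrix.specialOrthogonalGroup (Fin 3) ℝ : Set Mat3) := by
  have hbox : IsCompact (Set.pi Set.univ fun _ : Fin 3 =>
      Set.pi Set.univ fun _ : Fin 3 => Set.Icc (-1 : ℝ) 1) :=
    isCompact_univ_pi fun _ => isCompact_univ_pi fun _ => isCompact_Icc
  refine hbox.of_isClosed_subset ?_ ?_
  · have h : (Matrix.specialOrthogonalGroup (Fin 3) ℝ : Set Mat3)
        = {A : Mat3 | A * Aᵀ = 1} ∩ {A : Mat3 | A.det = 1} := by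
      ext A
      exact SO3.mem_iff A
    rw [h]
    exact (isClosed_eq (continuous_id.matrix_mul continuous_id.matrix_transpose)
      continuous_const).inter (isClosed_eq continuous_id.matrix_det continuous_const)
  · intro A hA i _ j _
    have h1 := congrFun (congrFun ((SO3.mem_iff A).1 hA).1 i) i
    simp only [Matrix.mul_apply, Matrix.transpose_apply, Matrix.one_apply_eq] at h1
    have h2 : A i j * A i j ≤ 1 := by
      rw [← h1]
      exact Finset.single_le_sum (f := fun k => A i k * A i k)
        (fun k _ => mul_self_nonneg _) (Finset.mem_univ j)
    exact Set.mem_Icc.2 (abs_le.1 (abs_le_one_iff_mul_self_le_one.2 h2))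

instance SO3.instCompactSpace : CompactSpace SO3 :=
  isCompact_iff_compactSpace.1 SO3.isCompact_coe

/-- The bi-invariant Haar measure on `SO(3)` of total mass one. -/
noncomputable def haarSO3 : Measure SO3 := Measure.haarMeasure ⊤

/-! ### Hat and vee maps -/

/-- The hat map `ℝ³ → 𝔰𝔬(3)`. -/
def hat (v : Fin 3 → ℝ) : Mat3 :=
  !![0, -v 2, v 1; v 2, 0, -v 0; -v 1, v 0, 0]

/-- The vee map, the inverse of the hat map on skew-symmetric matrices. -/
def vee (A : Mat3) : Fin 3 → ℝ := ![A 2 1, A 0 2, A 1 0]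

theorem vee_hat (v : Fin 3 → ℝ) : vee (hat v) = v := by
  ext i
  fin_cases i <;> simp [vee, hat]

theorem hat_vee (A : Mat3) (hA : Aᵀ = -A) : hat (vee A) = A := by
  have h (i j : Fin 3) : A j i = -A i j := congrFun (congrFun hA i) j
  ext i j
  fin_cases i <;> fin_cases j <;> simp [vee, hat] <;>
    linarith [h 0 0, h 1 1, h 2 2, h 0 1, h 0 2, h 1 2]

/-! ### Matrix Fisher and matrix Fisher–Gaussian distributions -/

/-- The normalizing constant `c(S)`, `S = diag(s)`, of the matrix Fisher distribution. -/
noncomputable def fisherConst (s : Fin 3 → ℝ) : ℝ :=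
  ∫ Q : SO3, Real.exp (Matrix.diagonal s * (Q : Mat3)ᵀ).trace ∂haarSO3

/-- The order condition `s₁ ≥ s₂ ≥ |s₃|` on proper singular values. -/
def IsProperOrder (s : Fin 3 → ℝ) : Prop := s 1 ≤ s 0 ∧ |s 2| ≤ s 1

/-- `F = U diag(s) Vᵀ`. -/
def fisherParam (U : SO3) (s : Fin 3 → ℝ) (V : SO3) : Mat3 :=
  (U : Mat3) * Matrix.diagonal s * (V : Mat3)ᵀ

/-- `ν_R = (Q S - S Qᵀ)^∨` with `Q = Uᵀ R V` and `S = diag(s)`. -/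
def nuVec (U : SO3) (s : Fin 3 → ℝ) (V : SO3) (R : Mat3) : Fin 3 → ℝ :=
  vee (((U : Mat3)ᵀ * R * (V : Mat3)) * Matrix.diagonal s
    - Matrix.diagonal s * ((U : Mat3)ᵀ * R * (V : Mat3))ᵀ)

/-- `Σ_c = Σ - P (tr(S) I - S) Pᵀ`, `S = diag(s)`. -/
def condCov {n : ℕ} (Sig : Matrix (Fin n) (Fin n) ℝ) (P : Matrix (Fin n) (Fin 3) ℝ)
    (s : Fin 3 → ℝ) : Matrix (Fin n) (Fin n) ℝ :=
  Sig - P * ((Matrix.diagonal s).trace • (1 : Mat3) - Matrix.diagonal s) * Pᵀ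

/-- Admissible parameters `(μ, Σ, P, U, S, V)` of a matrix Fisher–Gaussian distribution on
`SO(3) × ℝⁿ`, with `S = diag(s)`. -/
structure MFGParam (n : ℕ) where
  μ : Fin n → ℝ
  Sig : Matrix (Fin n) (Fin n) ℝ
  P : Matrix (Fin n) (Fin 3) ℝ
  U : SO3
  s : Fin 3 → ℝ
  V : SO3
  Sig_symm : Sig.IsSymm
  s_order : IsProperOrder s
  condCov_posDef : (condCov Sig P s).PosDef

/-- The density of the matrix Fisher–Gaussian distribution with respect to the product of the
normalized Haar measure of `SO(3)` and Lebesgue measure on `ℝⁿ`. -/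
noncomputable def MFGParam.density {n : ℕ} (θ : MFGParam n) (p : SO3 × (Fin n → ℝ)) : ℝ :=
  let Sc := condCov θ.Sig θ.P θ.s
  let y := p.2 - (θ.μ + θ.P *ᵥ nuVec θ.U θ.s θ.V p.1)
  1 / (fisherConst θ.s * Real.sqrt ((2 * Real.pi) ^ n * Sc.det))
    * Real.exp (-(1 / 2) * (y ⬝ᵥ (Sc⁻¹ *ᵥ y)))
    * Real.exp (fisherParam θ.U θ.s θ.V * (p.1 : Mat3)ᵀ).trace

/-- The matrix Fisher–Gaussian distribution `MG(μ, Σ, P, U, S, V)`. -/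
noncomputable def MFGParam.law {n : ℕ} (θ : MFGParam n) : Measure (SO3 × (Fin n → ℝ)) :=
  (haarSO3.prod volume).withDensity fun p => ENNReal.ofReal (θ.density p)

/-- The log-likelihood of the matrix Fisher distribution with parameter `U diag(s) Vᵀ`, for
mean attitude matrix `A` (the mean of `R` under the empirical or true distribution). -/
noncomputable def fisherLogLik (A : Mat3) (U : SO3) (s : Fin 3 → ℝ) (V : SO3) : ℝ :=
  (fisherParam U s V * Aᵀ).trace - Real.log (fisherConst s)

/-- `(U, S, V)`, `S = diag(s)`, is a marginal maximum likelihood estimate of the attitude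
part for mean attitude matrix `A`. -/
def IsMarginalMLE (A : Mat3) (U : SO3) (s : Fin 3 → ℝ) (V : SO3) : Prop :=
  IsProperOrder s ∧
    ∀ (U' : SO3) (s' : Fin 3 → ℝ) (V' : SO3), IsProperOrder s' →
      fisherLogLik A U' s' V' ≤ fisherLogLik A U s V

/-! ### The discretized stochastic differential equation -/

/-- The law `N(0, h I)` of the increment of a three-dimensional Wiener process over a time
step `h`. -/
noncomputable def wienerIncrement (h : ℝ) : Measure (Fin 3 → ℝ) :=
  Measure.pi fun _ => gaussianReal 0 h.toNNReal

/-- One step `R exp(h (Ω̂ + x̂) + (H_u w)^)` of the attitude equation. -/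
noncomputable def attitudeStep (h : ℝ) (Om : Fin 3 → ℝ) (Hu : Mat3) (R : SO3)
    (x w : Fin 3 → ℝ) : Mat3 :=
  (R : Mat3) * NormedSpace.exp (h • (hat Om + hat x) + hat (Hu *ᵥ w))

/-- One step `x + H_v w` of the bias equation. -/
def biasStep (Hv : Mat3) (x w : Fin 3 → ℝ) : Fin 3 → ℝ := x + Hv *ᵥ w

/-! ### Expectations and the auxiliary quantities of the moment formulas -/

/-- The entrywise expectation of a random vector. -/
noncomputable def meanVec {Ω : Type*} [MeasurableSpace Ω] (prob : Measure Ω) {m : ℕ}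
    (f : Ω → Fin m → ℝ) : Fin m → ℝ :=
  fun i => ∫ ω, f ω i ∂prob

/-- The entrywise expectation of a random matrix. -/
noncomputable def meanMat {Ω : Type*} [MeasurableSpace Ω] (prob : Measure Ω) {m n : ℕ}
    (f : Ω → Matrix (Fin m) (Fin n) ℝ) : Matrix (Fin m) (Fin n) ℝ :=
  Matrix.of fun i j => ∫ ω, f ω i j ∂prob

/-- `(Q Tᵀ - T Qᵀ)^∨`. -/
def tiltedNu (T Q : Mat3) : Fin 3 → ℝ := vee (Q * Tᵀ - T * Qᵀ)

/-- `(tr(Q Tᵀ) I - Q Tᵀ) Q`. -/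
def gammaMat (T Q : Mat3) : Mat3 := ((Q * Tᵀ).trace • (1 : Mat3) - Q * Tᵀ) * Q

/-!
# Moments of the matrix Fisher–Gaussian distribution after one time step

**Structure of the law.** Given the attitude `R`, which has a matrix Fisher distribution, the linear
part `x` is Gaussian with mean `μ + P ν_R` and covariance `Σ_c`; a linear change of variables in the
density shows this (`MFGParam.law_eq_map`). In the expectation of a polynomial of degree two in the
residual `x - μ - P ν_R`, with coefficients depending on `R`, only the terms of even order survive,
and the quadratic ones contribute `Σ_c` (`MFGParam.integral_residual_polynomial`).

**Exact moments.** The variable `ν_R = nuVec U s V R` extends to a linear function of the matrix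
`R`, so its expectation is its value at the mean attitude. For fitted parameters this value vanishes:
it is the first order condition for the log-likelihood under rotations of `U`
(`nuVec_eq_zero_of_isMarginalMLE`). The parameters of a matrix Fisher distribution maximize the
likelihood of its own mean (`isMarginalMLE_fisherMean`), so `ν_R` is centered as well, whence
`E x = μ`. The noise driving the bias is independent of everything else and only contributes `h G_v`.

**Expansion in `h`.** Given the state, the new attitude is `R exp(h α̂ + h ŷ + (H_u ΔW)^)` with
`α = Ω + μ` and `y = x - μ`. The exponential of a skew-symmetric matrix is a rotation, so its Taylor
remainder of order `n` is bounded by a multiple of the `n`-th power of the exponent, without an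
exponential factor (`norm_exp_sub_sum_le`). Write `ΔW = √h g` with `g` a standard Gaussian vector.
The terms of odd order in `√h` are odd in `g` and average out
(`abs_integral_sub_le_of_even_part`), which leaves expansions in powers of `h` with an error
`O(h²)` of polynomial growth in the state. At the cost of another `O(h²)` they are recentred at
`E = exp(h α̂)` (`exists_integral_increment_model`, `exists_integral_increment_mul_model`), and the
residual is then averaged out (`MFGParam.exists_mixed_moment_expansion`,
`MFGParam.exists_second_moment_expansion`).

**Comparison with the formulas.** By equivariance of the cross product, `Γ_Q z` is the variable `ν̃`
evaluated at `Q ẑ` instead of `Q` (`gammaMat_mulVec`); in particular `Γ_Q` is linear in `Q` on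
`SO(3)`. Multiplication by `Ũ` turns `ν̃`, its variant with `G_u`, and `Γ_Q` into the functional
`ν_{R₁}` of the fitted parameters, evaluated at `R E`, `R G_u E` and `R ẑ E`
(`mulVec_tiltedNu_frame`, `mulVec_gammaMat_frame`). Thus the right-hand sides are expectations of
explicit functions of the attitude (`mixed_formula_eq`, `second_formula_eq`), and they agree with
the expansions except that the Itô correction `G_u` is formed with the singular values of the
previous step instead of the fitted ones.

**Stability of the fit.** This difference carries a factor `h`, so it suffices that the fitted
singular values are `O(h)`-close to the previous ones (`exists_norm_mle_sub_le`). The mean attitude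
moves by `O(h)` (`MFGParam.exists_mean_attitudeStep`). The cumulant generating function of the Haar
measure is strictly convex in a quantitative way (`exists_cumulant_lower_bound`), because the
variances of linear functionals of a rotation are bounded below. Hence the fitted parameter
`U diag(s) Vᵀ` is a Lipschitz function of the mean near the mean of the previous step, whichever
maximizer is chosen (`exists_mle_stability`). Finally, proper singular values are `1`-Lipschitz in
the matrix, by the trace inequality of von Neumann on `SO(3)` (`trace_mul_diagonal_le`). Nothing is
needed about the factors `U` and `V`, which need not converge.
-/


/-! ### The hat map and the auxiliary vectors -/

theorem hat_add (v w : Fin 3 → ℝ) : hat (v + w) = hat v + hat w := by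
  ext i j; fin_cases i <;> fin_cases j <;> simp [hat] <;> ring

theorem hat_smul (c : ℝ) (v : Fin 3 → ℝ) : hat (c • v) = c • hat v := by
  ext i j; fin_cases i <;> fin_cases j <;> simp [hat]

theorem hat_neg (v : Fin 3 → ℝ) : hat (-v) = -hat v := by
  simpa using hat_smul (-1) v

theorem hat_transpose (v : Fin 3 → ℝ) : (hat v)ᵀ = -hat v := by
  ext i j; fin_cases i <;> fin_cases j <;> simp [hat]

theorem exp_hat_transpose (v : Fin 3 → ℝ) :
    (NormedSpace.exp (hat v))ᵀ = NormedSpace.exp (-hat v) := by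
  rw [← Matrix.exp_transpose, hat_transpose]

theorem exp_hat_mul_transpose (v : Fin 3 → ℝ) :
    NormedSpace.exp (hat v) * (NormedSpace.exp (hat v))ᵀ = 1 := by
  rw [exp_hat_transpose, Matrix.exp_neg]
  exact Matrix.mul_nonsing_inv _ ((Matrix.isUnit_iff_isUnit_det _).1 (Matrix.isUnit_exp _))

theorem exp_hat_mem (v : Fin 3 → ℝ) :
    NormedSpace.exp (hat v) ∈ Matrix.specialOrthogonalGroup (Fin 3) ℝ := by
  refine (SO3.mem_iff _).2 ⟨exp_hat_mul_transpose v, ?_⟩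
  have h1 : (NormedSpace.exp (hat v)).det * (NormedSpace.exp (hat v)).det = 1 := by
    simpa using congrArg Matrix.det (exp_hat_mul_transpose v)
  have h2 : NormedSpace.exp (hat v) = NormedSpace.exp (hat ((1 / 2 : ℝ) • v)) ^ 2 := by
    rw [← Matrix.exp_nsmul, ← Nat.cast_smul_eq_nsmul ℝ, hat_smul, smul_smul]
    norm_num
  -- the exponential is a square, so its determinant is `1` and not `-1`
  have h3 : 0 ≤ (NormedSpace.exp (hat v)).det := by
    rw [h2, Matrix.det_pow]; positivity
  nlinarith

theorem SO3.mul_transpose (Q : SO3) : (Q : Mat3) * (Q : Mat3)ᵀ = 1 := ((SO3.mem_iff _).1 Q.2).1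

theorem SO3.transpose_mul (Q : SO3) : (Q : Mat3)ᵀ * (Q : Mat3) = 1 :=
  mul_eq_one_comm.1 (SO3.mul_transpose Q)

theorem SO3.det_eq_one (Q : SO3) : (Q : Mat3).det = 1 := ((SO3.mem_iff _).1 Q.2).2

/-- A rotation equals its own cofactor matrix. -/
theorem SO3.adjugate_eq (Q : SO3) : (Q : Mat3).adjugate = (Q : Mat3)ᵀ := by
  have h := Matrix.adjugate_mul (Q : Mat3)
  rw [SO3.det_eq_one, one_smul] at h
  calc (Q : Mat3).adjugate = (Q : Mat3).adjugate * ((Q : Mat3) * (Q : Mat3)ᵀ) := by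
        rw [SO3.mul_transpose, Matrix.mul_one]
    _ = _ := by rw [← Matrix.mul_assoc, h, Matrix.one_mul]

theorem abs_entry_le_one {A : Mat3} (hA : A * Aᵀ = 1) (i j : Fin 3) : |A i j| ≤ 1 := by
  have h1 := congrFun (congrFun hA i) i
  simp only [Matrix.mul_apply, Matrix.transpose_apply, Matrix.one_apply_eq] at h1
  have h2 : A i j * A i j ≤ 1 := by
    rw [← h1]
    exact Finset.single_le_sum (f := fun k => A i k * A i k)
      (fun k _ => mul_self_nonneg _) (Finset.mem_univ j)
  exact abs_le_one_iff_mul_self_le_one.2 h2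

/-- The general transformation rule of the cross product under a linear map. -/
theorem mul_hat_mul_transpose (A : Mat3) (v : Fin 3 → ℝ) :
    A * hat v * Aᵀ = hat (A.adjugateᵀ *ᵥ v) := by
  rw [Matrix.adjugate_fin_three]
  ext i j
  fin_cases i <;> fin_cases j <;>
    simp [hat, Matrix.mul_apply, Fin.sum_univ_three, Matrix.mulVec, dotProduct] <;> ring

/-- Rotations carry the cross product to the cross product. -/
theorem SO3.mul_hat (Q : SO3) (v : Fin 3 → ℝ) :
    (Q : Mat3) * hat v = hat ((Q : Mat3) *ᵥ v) * (Q : Mat3) := by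
  have h := mul_hat_mul_transpose (Q : Mat3) v
  rw [SO3.adjugate_eq, Matrix.transpose_transpose] at h
  rw [← h, Matrix.mul_assoc, SO3.transpose_mul, Matrix.mul_one]

/-- The axial vector of a skew-symmetric matrix transforms like a vector under rotations. -/
theorem vee_skew_conj (Q : SO3) (A : Mat3) :
    vee ((Q : Mat3)ᵀ * (A - Aᵀ) * (Q : Mat3)) = (Q : Mat3)ᵀ *ᵥ vee (A - Aᵀ) := by
  have hs : (A - Aᵀ)ᵀ = -(A - Aᵀ) := by simp
  have h := mul_hat_mul_transpose (Q : Mat3)ᵀ (vee (A - Aᵀ))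
  rw [hat_vee _ hs, ← Matrix.adjugate_transpose, Matrix.transpose_transpose, SO3.adjugate_eq,
    Matrix.transpose_transpose] at h
  rw [h, vee_hat]

/-- The identity `x̂ M + Mᵀ x̂ = ((tr(M) I - M) x)^`. -/
theorem vee_hat_mul_add (M : Mat3) (x : Fin 3 → ℝ) :
    vee (hat x * M + Mᵀ * hat x) = (M.trace • (1 : Mat3) - M) *ᵥ x := by
  ext i
  fin_cases i <;>
    simp [vee, hat, Matrix.mul_apply, Fin.sum_univ_three, Matrix.mulVec, dotProduct,
      Matrix.trace, Matrix.sub_apply, Matrix.vecMul] <;> ring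

/-- `Γ z` is the variable `ν̃` evaluated at `Q ẑ`, as `Q ẑ = (Q z)^ Q` for a rotation. -/
theorem gammaMat_mulVec (T : Mat3) (Q : SO3) (z : Fin 3 → ℝ) :
    gammaMat T Q *ᵥ z = tiltedNu T ((Q : Mat3) * hat z) := by
  rw [gammaMat, ← Matrix.mulVec_mulVec, ← vee_hat_mul_add, tiltedNu, SO3.mul_hat,
    Matrix.transpose_mul (hat _), hat_transpose, Matrix.transpose_mul, Matrix.transpose_transpose]
  congr 1
  simp only [Matrix.mul_assoc, Matrix.mul_neg, sub_neg_eq_add]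

theorem vee_add (A B : Mat3) : vee (A + B) = vee A + vee B := by
  ext i; fin_cases i <;> simp [vee]

theorem vee_smul (c : ℝ) (A : Mat3) : vee (c • A) = c • vee A := by
  ext i; fin_cases i <;> simp [vee]

theorem tiltedNu_add (T A B : Mat3) : tiltedNu T (A + B) = tiltedNu T A + tiltedNu T B := by
  rw [tiltedNu, tiltedNu, tiltedNu, ← vee_add]
  congr 1
  simp only [Matrix.transpose_add, Matrix.add_mul, Matrix.mul_add]
  abel

theorem tiltedNu_smul (T : Mat3) (c : ℝ) (A : Mat3) :
    tiltedNu T (c • A) = c • tiltedNu T A := by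
  rw [tiltedNu, tiltedNu, ← vee_smul]
  congr 1
  simp only [Matrix.transpose_smul, Matrix.smul_mul, Matrix.mul_smul, smul_sub]

/-- On `SO(3)` the columns of `gammaMat T Q` are the linear images `tiltedNu T (Q ê_j)`. -/
theorem exists_linearMap_gammaMat (T : Mat3) :
    ∃ L : Mat3 →ₗ[ℝ] Mat3, ∀ q : SO3, gammaMat T q = L q := by
  refine ⟨{ toFun := fun Q => Matrix.of fun i j => tiltedNu T (Q * hat (Pi.single j 1)) i
            map_add' := ?_
            map_smul' := ?_ }, fun q => ?_⟩
  · intro A B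
    ext i j
    simp [Matrix.add_mul, tiltedNu_add]
  · intro c A
    ext i j
    simp [tiltedNu_smul]
  · ext i j
    have h := congrFun (gammaMat_mulVec T q (Pi.single j 1)) i
    simpa using h

/-- `nuVec` is `tiltedNu` of `U diag(s) Vᵀ`, expressed in the frame of `U`. -/
theorem nuVec_eq_tiltedNu (U : SO3) (s : Fin 3 → ℝ) (V : SO3) (A : Mat3) :
    nuVec U s V A = (U : Mat3)ᵀ *ᵥ tiltedNu (fisherParam U s V) A := by
  have h := vee_skew_conj U (A * (fisherParam U s V)ᵀ)
  have e : (A * (fisherParam U s V)ᵀ)ᵀ = fisherParam U s V * Aᵀ := by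
    rw [Matrix.transpose_mul, Matrix.transpose_transpose]
  rw [e] at h
  rw [tiltedNu, ← h, nuVec]
  congr 1
  have hu := SO3.transpose_mul U
  simp only [fisherParam, Matrix.transpose_mul, Matrix.transpose_transpose,
    Matrix.diagonal_transpose, Matrix.mul_sub, Matrix.sub_mul]
  congr 1
  · simp only [Matrix.mul_assoc, hu, Matrix.mul_one]
  · simp only [← Matrix.mul_assoc, hu, Matrix.one_mul]

/-- Rotating both arguments of `tiltedNu`. -/
theorem tiltedNu_conj (U W : SO3) (T A : Mat3) :
    tiltedNu ((U : Mat3)ᵀ * T * (W : Mat3)) ((U : Mat3)ᵀ * A * (W : Mat3))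
      = (U : Mat3)ᵀ *ᵥ tiltedNu T A := by
  have h := vee_skew_conj U (A * Tᵀ)
  rw [Matrix.transpose_mul, Matrix.transpose_transpose] at h
  rw [tiltedNu, tiltedNu, ← h]
  congr 1
  have hw := SO3.mul_transpose W
  simp only [Matrix.transpose_mul, Matrix.transpose_transpose, Matrix.mul_sub, Matrix.sub_mul]
  congr 1
  · calc _ = (U : Mat3)ᵀ * A * ((W : Mat3) * (W : Mat3)ᵀ) * Tᵀ * U := by
          simp only [Matrix.mul_assoc]
      _ = _ := by rw [hw, Matrix.mul_one]; simp only [Matrix.mul_assoc]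
  · calc _ = (U : Mat3)ᵀ * T * ((W : Mat3) * (W : Mat3)ᵀ) * Aᵀ * U := by
          simp only [Matrix.mul_assoc]
      _ = _ := by rw [hw, Matrix.mul_one]; simp only [Matrix.mul_assoc]

theorem nuVec_add (U : SO3) (s : Fin 3 → ℝ) (V : SO3) (A B : Mat3) :
    nuVec U s V (A + B) = nuVec U s V A + nuVec U s V B := by
  simp only [nuVec_eq_tiltedNu, tiltedNu_add, Matrix.mulVec_add]

theorem nuVec_smul (U : SO3) (s : Fin 3 → ℝ) (V : SO3) (c : ℝ) (A : Mat3) :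
    nuVec U s V (c • A) = c • nuVec U s V A := by
  simp only [nuVec_eq_tiltedNu, tiltedNu_smul, Matrix.mulVec_smul]

/-- The linear functional `A ↦ (nuVec U s V A) j`. -/
def nuCoord (U : SO3) (s : Fin 3 → ℝ) (V : SO3) (j : Fin 3) : Mat3 →ₗ[ℝ] ℝ where
  toFun A := nuVec U s V A j
  map_add' A B := by simp [nuVec_add]
  map_smul' c A := by simp [nuVec_smul]

/-! ### Trace inequality for proper singular values -/

/-- A diagonal inequality for rotations. The factors `1 ± R₀₀ ± R₁₁ ± R₂₂` in the proof are four
times the squared components of a unit quaternion representing `R`; hence the product of any two of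
them is a square, and they cannot have different signs. -/
theorem SO3.diag_le_one (R : SO3) : R.1 0 0 + R.1 1 1 - R.1 2 2 ≤ 1 := by
  have h := SO3.adjugate_eq R
  have h1 := SO3.mul_transpose R
  have h2 := SO3.transpose_mul R
  rw [Matrix.adjugate_fin_three] at h
  change (R.1 : Mat3) * (R.1)ᵀ = 1 at h1
  change (R.1 : Mat3)ᵀ * (R.1) = 1 at h2
  set A : Mat3 := R.1 with hA
  have d00 := congrFun (congrFun h1 0) 0
  have d11 := congrFun (congrFun h1 1) 1
  have d22 := congrFun (congrFun h1 2) 2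
  have c00 := congrFun (congrFun h2 0) 0
  have c11 := congrFun (congrFun h2 1) 1
  have c22 := congrFun (congrFun h2 2) 2
  have e00 := congrFun (congrFun h 0) 0
  have e11 := congrFun (congrFun h 1) 1
  have e22 := congrFun (congrFun h 2) 2
  simp [Matrix.mul_apply, Fin.sum_univ_three] at d00 d11 d22 c00 c11 c22 e00 e11 e22
  have p1 : (1 + A 2 2 - A 0 0 - A 1 1) * (1 + A 0 0 + A 1 1 + A 2 2) = (A 0 1 - A 1 0) ^ 2 := by
    linarith
  have p2 : (1 + A 2 2 - A 0 0 - A 1 1) * (1 + A 0 0 - A 1 1 - A 2 2) = (A 0 2 + A 2 0) ^ 2 := by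
    linarith
  have p3 : (1 + A 2 2 - A 0 0 - A 1 1) * (1 + A 1 1 - A 0 0 - A 2 2) = (A 1 2 + A 2 1) ^ 2 := by
    linarith
  by_contra! hlt
  have ha : 1 + A 2 2 - A 0 0 - A 1 1 < 0 := by linarith
  have q (b r : ℝ) (hb : (1 + A 2 2 - A 0 0 - A 1 1) * b = r ^ 2) : b ≤ 0 := by
    by_contra! hb'
    nlinarith [mul_neg_of_neg_of_pos ha hb', sq_nonneg r]
  -- the four factors sum to `4`, so they are not all nonpositive
  linarith [q _ _ p1, q _ _ p2, q _ _ p3]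

/-- The trace inequality of von Neumann for the group `SO(3)`: the cone of proper singular values
is generated by `(1,0,0)`, `(1,1,1)` and `(1,1,-1)`, and both sides are bilinear. -/
theorem trace_mul_diagonal_le (Q Q' : SO3) {s t : Fin 3 → ℝ} (hs : IsProperOrder s)
    (ht : IsProperOrder t) :
    ((Q : Mat3) * Matrix.diagonal s * (Q' : Mat3) * Matrix.diagonal t).trace ≤ s ⬝ᵥ t := by
  have hJ : (Matrix.diagonal ![1, 1, -1] : Mat3) * (Matrix.diagonal ![1, 1, -1] : Mat3)ᵀ = 1 := by
    ext i j
    fin_cases i <;> fin_cases j <;> simp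
  have horth (A B : SO3) : ((A : Mat3) * Matrix.diagonal ![1, 1, -1] * (B : Mat3)) *
      ((A : Mat3) * Matrix.diagonal ![1, 1, -1] * (B : Mat3))ᵀ = 1 := by
    rw [Matrix.transpose_mul, Matrix.transpose_mul]
    calc _ = (A : Mat3) * (Matrix.diagonal ![1, 1, -1] * ((B : Mat3) * (B : Mat3)ᵀ) *
          (Matrix.diagonal ![1, 1, -1] : Mat3)ᵀ) * (A : Mat3)ᵀ := by
          simp only [Matrix.mul_assoc]
      _ = 1 := by rw [SO3.mul_transpose, Matrix.mul_one, hJ, Matrix.mul_one, SO3.mul_transpose]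
  have hbd (A : Mat3) (hA : A * Aᵀ = 1) (i : Fin 3) : A i i ≤ 1 :=
    (abs_le.1 (abs_entry_le_one hA i i)).2
  -- the inequality for the nine pairs of generators
  have k1 : (Q : Mat3) 0 0 * (Q' : Mat3) 0 0 ≤ 1 := by
    refine (le_abs_self _).trans ?_
    rw [abs_mul]
    exact mul_le_one₀ (abs_entry_le_one (SO3.mul_transpose Q) 0 0) (abs_nonneg _)
      (abs_entry_le_one (SO3.mul_transpose Q') 0 0)
  have k2 := hbd _ (SO3.mul_transpose (Q' * Q)) 0
  have k3 := hbd _ (SO3.mul_transpose (Q * Q'))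
  have k4 := hbd _ (horth Q' Q) 0
  have k5 := hbd _ (horth Q Q')
  have k6 := SO3.diag_le_one (Q * Q')
  have k7 := SO3.diag_le_one (Q' * Q)
  have k9 : ((Q : Mat3) * Matrix.diagonal ![1, 1, -1] * (Q' : Mat3) *
      Matrix.diagonal ![1, 1, -1]).trace ≤ 3 := by
    have e := horth Q Q'
    have h0 := hbd _ e 0
    have h1 := hbd _ e 1
    have h2 := (abs_le.1 (abs_entry_le_one e 2 2)).1
    rw [Matrix.trace_fin_three]
    simp only [Matrix.mul_diagonal]
    simp at h0 h1 h2 ⊢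
    linarith
  have k30 := k3 0
  have k31 := k3 1
  have k32 := k3 2
  have k50 := k5 0
  change ((Q' : Mat3) * (Q : Mat3)) 0 0 ≤ 1 at k2
  change ((Q : Mat3) * (Q' : Mat3)) 0 0 ≤ 1 at k30
  change ((Q : Mat3) * (Q' : Mat3)) 1 1 ≤ 1 at k31
  change ((Q : Mat3) * (Q' : Mat3)) 2 2 ≤ 1 at k32
  change ((Q : Mat3) * (Q' : Mat3)) 0 0 + ((Q : Mat3) * (Q' : Mat3)) 1 1
    - ((Q : Mat3) * (Q' : Mat3)) 2 2 ≤ 1 at k6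
  change ((Q' : Mat3) * (Q : Mat3)) 0 0 + ((Q' : Mat3) * (Q : Mat3)) 1 1
    - ((Q' : Mat3) * (Q : Mat3)) 2 2 ≤ 1 at k7
  clear k3 k5
  obtain ⟨hs1, hs2⟩ := hs
  obtain ⟨ht1, ht2⟩ := ht
  obtain ⟨hs2, hs3⟩ := abs_le.1 hs2
  obtain ⟨ht2, ht3⟩ := abs_le.1 ht2
  -- the coordinates of `s` and `t` with respect to the generators
  have a1 : 0 ≤ s 0 - s 1 := by linarith
  have a2 : 0 ≤ (s 1 + s 2) / 2 := by linarith
  have a3 : 0 ≤ (s 1 - s 2) / 2 := by linarith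
  have b1 : 0 ≤ t 0 - t 1 := by linarith
  have b2 : 0 ≤ (t 1 + t 2) / 2 := by linarith
  have b3 : 0 ≤ (t 1 - t 2) / 2 := by linarith
  generalize (Q : Mat3) = A at *
  generalize (Q' : Mat3) = B at *
  simp [Matrix.mul_apply, Matrix.trace_fin_three, Fin.sum_univ_three]
    at k1 k2 k30 k31 k32 k4 k50 k6 k7 k9
  simp only [Matrix.mul_apply, Matrix.trace_fin_three, Fin.sum_univ_three, Matrix.diagonal_apply,
    dotProduct, Fin.reduceEq, if_true, if_false]
  have m1 := mul_nonneg (mul_nonneg a1 b1) (sub_nonneg.2 k1)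
  have m2 := mul_nonneg (mul_nonneg a1 b2) (sub_nonneg.2 k2)
  have m3 := mul_nonneg (mul_nonneg a1 b3) (sub_nonneg.2 k4)
  have m4 := mul_nonneg (mul_nonneg a2 b1) (sub_nonneg.2 k30)
  have m5 := mul_nonneg (mul_nonneg a2 b2) (sub_nonneg.2 (add_le_add (add_le_add k30 k31) k32))
  have m6 := mul_nonneg (mul_nonneg a2 b3) (sub_nonneg.2 k6)
  have m7 := mul_nonneg (mul_nonneg a3 b1) (sub_nonneg.2 k50)
  have m8 := mul_nonneg (mul_nonneg a3 b2) (sub_nonneg.2 k7)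
  have m9 := mul_nonneg (mul_nonneg a3 b3) (sub_nonneg.2 k9)
  have := add_nonneg (add_nonneg (add_nonneg m1 m2) (add_nonneg m3 m4))
    (add_nonneg (add_nonneg (add_nonneg m5 m6) (add_nonneg m7 m8)) m9)
  clear m1 m2 m3 m4 m5 m6 m7 m8 m9 k1 k2 k30 k31 k32 k4 k50 k6 k7 k9 a1 a2 a3 b1 b2 b3
  nlinarith only [this]

/-! ### The Frobenius inner product -/

/-- The Frobenius inner product. -/
def frob (A B : Mat3) : ℝ := (A * Bᵀ).trace

theorem frob_eq_sum (A B : Mat3) : frob A B = ∑ i, ∑ j, A i j * B i j := by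
  simp [frob, Matrix.trace, Matrix.mul_apply]

theorem linearMap_eq_sum (ℓ : Mat3 →ₗ[ℝ] ℝ) (A : Mat3) :
    ℓ A = ∑ i, ∑ j, ℓ (Matrix.single i j 1) * A i j := by
  conv_lhs => rw [Matrix.matrix_eq_sum_single A]
  simp only [map_sum]
  refine Finset.sum_congr rfl fun i _ => Finset.sum_congr rfl fun j _ => ?_
  rw [show Matrix.single i j (A i j) = A i j • Matrix.single i j (1 : ℝ) by
    rw [Matrix.smul_single, smul_eq_mul, mul_one], map_smul, smul_eq_mul, mul_comm]

theorem frob_comm (A B : Mat3) : frob A B = frob B A := by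
  simp [frob_eq_sum, mul_comm]

theorem frob_add_left (A B C : Mat3) : frob (A + B) C = frob A C + frob B C := by
  simp [frob, Matrix.add_mul]

theorem frob_sub_left (A B C : Mat3) : frob (A - B) C = frob A C - frob B C := by
  simp [frob, Matrix.sub_mul]

theorem frob_sub_right (A B C : Mat3) : frob A (B - C) = frob A B - frob A C := by
  simp [frob, Matrix.mul_sub]

theorem frob_smul_left (c : ℝ) (A B : Mat3) : frob (c • A) B = c * frob A B := by
  simp [frob]

theorem frob_self_nonneg (A : Mat3) : 0 ≤ frob A A := by
  rw [frob_eq_sum]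
  exact Finset.sum_nonneg fun i _ => Finset.sum_nonneg fun j _ => mul_self_nonneg _

theorem frob_sq_le (A B : Mat3) : frob A B ^ 2 ≤ frob A A * frob B B := by
  simp only [frob_eq_sum, ← Finset.sum_product', ← sq]
  exact Finset.sum_mul_sq_le_sq_mul_sq _ _ _

/-- The Frobenius norm. -/
noncomputable def frobNorm (A : Mat3) : ℝ := Real.sqrt (frob A A)

theorem frobNorm_nonneg (A : Mat3) : 0 ≤ frobNorm A := Real.sqrt_nonneg _

theorem frobNorm_sq (A : Mat3) : frobNorm A ^ 2 = frob A A := Real.sq_sqrt (frob_self_nonneg A)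

theorem abs_frob_le (A B : Mat3) : |frob A B| ≤ frobNorm A * frobNorm B := by
  apply abs_le_of_sq_le_sq _ (mul_nonneg (frobNorm_nonneg A) (frobNorm_nonneg B))
  rw [mul_pow, frobNorm_sq, frobNorm_sq]
  exact frob_sq_le A B

theorem frobNorm_smul {c : ℝ} (hc : 0 ≤ c) (A : Mat3) : frobNorm (c • A) = c * frobNorm A := by
  rw [frobNorm, frobNorm, frob_smul_left, frob_comm, frob_smul_left, ← mul_assoc,
    Real.sqrt_mul (mul_self_nonneg c), Real.sqrt_mul_self hc]

theorem frob_fisherParam_self (U : SO3) (s : Fin 3 → ℝ) (V : SO3) :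
    frob (fisherParam U s V) (fisherParam U s V) = s ⬝ᵥ s := by
  rw [frob, fisherParam, Matrix.transpose_mul, Matrix.transpose_mul, Matrix.transpose_transpose]
  calc _ = ((U : Mat3) * (Matrix.diagonal s * ((V : Mat3)ᵀ * (V : Mat3)) *
          (Matrix.diagonal s : Mat3)ᵀ * (U : Mat3)ᵀ)).trace := by simp only [Matrix.mul_assoc]
    _ = _ := by
      rw [SO3.transpose_mul, Matrix.mul_one, Matrix.trace_mul_comm, Matrix.mul_assoc,
        SO3.transpose_mul, Matrix.mul_one, Matrix.diagonal_transpose, Matrix.diagonal_mul_diagonal,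
        Matrix.trace_diagonal]
      rfl

/-- Proper singular values are `1`-Lipschitz functions of the matrix: after expanding both squares,
this is the trace inequality. -/
theorem dotProduct_sub_le_frob_sub (U U' V V' : SO3) {s t : Fin 3 → ℝ} (hs : IsProperOrder s)
    (ht : IsProperOrder t) :
    (s - t) ⬝ᵥ (s - t) ≤ frob (fisherParam U s V - fisherParam U' t V')
      (fisherParam U s V - fisherParam U' t V') := by
  have h := trace_mul_diagonal_le (U'⁻¹ * U) (V⁻¹ * V') hs ht
  have e : (((U'⁻¹ * U : SO3) : Mat3) * Matrix.diagonal s * ((V⁻¹ * V' : SO3) : Mat3) *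
      Matrix.diagonal t).trace = frob (fisherParam U s V) (fisherParam U' t V') := by
    rw [frob, fisherParam, fisherParam, Matrix.transpose_mul, Matrix.transpose_mul,
      Matrix.transpose_transpose, Matrix.diagonal_transpose]
    change (((U' : Mat3)ᵀ * (U : Mat3)) * Matrix.diagonal s * ((V : Mat3)ᵀ * (V' : Mat3)) *
      Matrix.diagonal t).trace = _
    calc _ = ((U' : Mat3)ᵀ * ((U : Mat3) * Matrix.diagonal s * ((V : Mat3)ᵀ * (V' : Mat3)) *
          Matrix.diagonal t)).trace := by simp only [Matrix.mul_assoc]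
      _ = _ := by rw [Matrix.trace_mul_comm]; simp only [Matrix.mul_assoc]
  rw [e] at h
  rw [frob_sub_left, frob_sub_right, frob_sub_right, frob_fisherParam_self, frob_fisherParam_self,
    frob_comm (fisherParam U' t V') (fisherParam U s V), sub_dotProduct, dotProduct_sub,
    dotProduct_sub, dotProduct_comm t s]
  linarith

/-! ### Haar measure on `SO(3)` -/

instance Mat3.instSecondCountableTopology : SecondCountableTopology Mat3 :=
  inferInstanceAs (SecondCountableTopology (Fin 3 → Fin 3 → ℝ))

instance SO3.instSecondCountableTopology : SecondCountableTopology SO3 :=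
  TopologicalSpace.Subtype.secondCountableTopology
    (Matrix.specialOrthogonalGroup (Fin 3) ℝ : Set Mat3)

instance haarSO3.instIsHaarMeasure : haarSO3.IsHaarMeasure := by
  unfold haarSO3; infer_instance

instance haarSO3.instIsProbabilityMeasure : IsProbabilityMeasure haarSO3 :=
  ⟨by simpa [haarSO3] using
    Measure.haarMeasure_self (K₀ := (⊤ : TopologicalSpace.PositiveCompacts SO3))⟩

/-- A compact group is unimodular. -/
instance haarSO3.instIsMulRightInvariant : haarSO3.IsMulRightInvariant where
  map_mul_right_eq_self g := by
    have h := Measure.haarMeasure_unique (Measure.map (· * g) haarSO3)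
      (⊤ : TopologicalSpace.PositiveCompacts SO3)
    rw [h, Measure.map_apply (measurable_mul_const g) (by simp)]
    simp [haarSO3.instIsProbabilityMeasure.measure_univ]
    rfl

theorem integrable_of_continuous_SO3 (m : Measure SO3) [IsFiniteMeasure m] {f : SO3 → ℝ}
    (hf : Continuous f) : Integrable f m :=
  hf.integrable_of_hasCompactSupport (HasCompactSupport.of_compactSpace f)

theorem continuous_SO3_coe : Continuous fun R : SO3 => (R : Mat3) := continuous_subtype_val

@[fun_prop]
theorem continuous_SO3_entry (i j : Fin 3) : Continuous fun R : SO3 => (R : Mat3) i j :=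
  continuous_SO3_coe.matrix_elem i j

/-- The rotation by the angle `π` about the `i`-th coordinate axis. -/
def halfTurn (i : Fin 3) : SO3 :=
  ⟨Matrix.diagonal fun k => if k = i then 1 else -1, by
    rw [SO3.mem_iff]
    refine ⟨?_, ?_⟩
    · rw [Matrix.diagonal_transpose, Matrix.diagonal_mul_diagonal, ← Matrix.diagonal_one]
      congr 1
      ext k
      split_ifs <;> simp
    · rw [Matrix.det_diagonal, Fin.prod_univ_three]
      fin_cases i <;> simp⟩

/-- The cyclic permutation of the coordinate axes. -/
def cyclicPerm : SO3 :=
  ⟨!![0, 1, 0; 0, 0, 1; 1, 0, 0], by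
    rw [SO3.mem_iff]
    refine ⟨?_, ?_⟩
    · ext i j
      fin_cases i <;> fin_cases j <;> simp [Matrix.mul_apply, Fin.sum_univ_three]
    · simp [Matrix.det_fin_three]⟩

theorem halfTurn_mul_apply (k i j : Fin 3) (R : SO3) :
    ((halfTurn k * R : SO3) : Mat3) i j = (if i = k then 1 else -1) * (R : Mat3) i j := by
  change ((Matrix.diagonal _ : Mat3) * (R : Mat3)) i j = _
  rw [Matrix.diagonal_mul]

theorem mul_halfTurn_apply (k i j : Fin 3) (R : SO3) :
    ((R * halfTurn k : SO3) : Mat3) i j = (R : Mat3) i j * (if j = k then 1 else -1) := by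
  change ((R : Mat3) * (Matrix.diagonal _ : Mat3)) i j = _
  rw [Matrix.mul_diagonal]

theorem cyclicPerm_mul_apply (i j : Fin 3) (R : SO3) :
    ((cyclicPerm * R : SO3) : Mat3) i j = (R : Mat3) (i + 1) j := by
  change ((!![0, 1, 0; 0, 0, 1; 1, 0, 0] : Mat3) * (R : Mat3)) i j = _
  fin_cases i <;> simp [Matrix.mul_apply, Fin.sum_univ_three]

/-- A half turn about another axis changes the sign of the row. -/
theorem integral_haarSO3_entry (i j : Fin 3) : ∫ R : SO3, (R : Mat3) i j ∂haarSO3 = 0 := by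
  have h := integral_mul_left_eq_self (μ := haarSO3) (fun R : SO3 => (R : Mat3) i j)
    (halfTurn (i + 1))
  have hi : i ≠ i + 1 := by fin_cases i <;> decide
  simp only [halfTurn_mul_apply, if_neg hi, neg_one_mul, integral_neg] at h
  linarith

/-- Distinct entries are uncorrelated: a half turn changes the sign of exactly one of them. -/
theorem integral_haarSO3_entry_mul_of_ne {i j k l : Fin 3} (h : (i, j) ≠ (k, l)) :
    ∫ R : SO3, (R : Mat3) i j * (R : Mat3) k l ∂haarSO3 = 0 := by
  by_cases hik : i = k
  · have hjl : l ≠ j := fun e => h (by rw [hik, e])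
    have h := integral_mul_right_eq_self (μ := haarSO3)
      (fun R : SO3 => (R : Mat3) i j * (R : Mat3) k l) (halfTurn j)
    simp only [mul_halfTurn_apply, if_neg hjl, if_true, mul_one, mul_neg, integral_neg] at h
    linarith
  · have h := integral_mul_left_eq_self (μ := haarSO3)
      (fun R : SO3 => (R : Mat3) i j * (R : Mat3) k l) (halfTurn i)
    simp only [halfTurn_mul_apply, if_neg (Ne.symm hik), if_true, one_mul, neg_one_mul, mul_neg,
      integral_neg] at h
    linarith

/-- The entries of a column have the same second moment, and their squares sum to `1`. -/
theorem integral_haarSO3_entry_sq (i j : Fin 3) :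
    ∫ R : SO3, (R : Mat3) i j * (R : Mat3) i j ∂haarSO3 = 1 / 3 := by
  have hc (i : Fin 3) : ∫ R : SO3, (R : Mat3) (i + 1) j * (R : Mat3) (i + 1) j ∂haarSO3
      = ∫ R : SO3, (R : Mat3) i j * (R : Mat3) i j ∂haarSO3 := by
    have h := integral_mul_left_eq_self (μ := haarSO3)
      (fun R : SO3 => (R : Mat3) i j * (R : Mat3) i j) cyclicPerm
    simpa only [cyclicPerm_mul_apply] using h
  have hs : ∑ i : Fin 3, ∫ R : SO3, (R : Mat3) i j * (R : Mat3) i j ∂haarSO3 = 1 := by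
    rw [← integral_finsetSum _ fun i _ => integrable_of_continuous_SO3 _ (by fun_prop)]
    have (R : SO3) : ∑ i : Fin 3, (R : Mat3) i j * (R : Mat3) i j = 1 := by
      have := congrFun (congrFun (SO3.transpose_mul R) j) j
      simpa [Matrix.mul_apply] using this
    simp [this]
  have h0 := hc 0
  have h1 := hc 1
  simp only [Fin.sum_univ_three, zero_add, Fin.reduceAdd] at hs h0 h1
  fin_cases i <;> simp only [Fin.zero_eta, Fin.mk_one, Fin.reduceFinMk] <;> linarith

/-- The second moment of an affine function of a Haar distributed rotation. -/
theorem integral_haarSO3_frob_sub_sq (G : Mat3) (a : ℝ) :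
    ∫ R : SO3, (frob G R - a) ^ 2 ∂haarSO3 = frob G G / 3 + a ^ 2 := by
  have e (R : SO3) : (frob G R - a) ^ 2 = (∑ p : Fin 3 × Fin 3, ∑ q : Fin 3 × Fin 3,
      G p.1 p.2 * G q.1 q.2 * ((R : Mat3) p.1 p.2 * (R : Mat3) q.1 q.2))
      - 2 * a * (∑ p : Fin 3 × Fin 3, G p.1 p.2 * (R : Mat3) p.1 p.2) + a ^ 2 := by
    rw [frob_eq_sum, ← Finset.sum_product']
    change (∑ p : Fin 3 × Fin 3, G p.1 p.2 * (R : Mat3) p.1 p.2 - a) ^ 2 = _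
    rw [sub_sq, sq (∑ p : Fin 3 × Fin 3, _), Finset.sum_mul_sum]
    congr 1
    congr 1
    · exact Finset.sum_congr rfl fun p _ => Finset.sum_congr rfl fun q _ => by ring
    · ring
  have i1 (p q : Fin 3 × Fin 3) : Integrable (fun R : SO3 =>
      G p.1 p.2 * G q.1 q.2 * ((R : Mat3) p.1 p.2 * (R : Mat3) q.1 q.2)) haarSO3 :=
    integrable_of_continuous_SO3 _ (by fun_prop)
  have i2 (p : Fin 3 × Fin 3) : Integrable (fun R : SO3 =>
      G p.1 p.2 * (R : Mat3) p.1 p.2) haarSO3 :=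
    integrable_of_continuous_SO3 _ (by fun_prop)
  have i3 (p : Fin 3 × Fin 3) := integrable_finsetSum Finset.univ fun q _ => i1 p q
  have i4 := integrable_finsetSum Finset.univ fun p _ => i3 p
  have i5 := (integrable_finsetSum Finset.univ fun p _ => i2 p).const_mul (2 * a)
  have i6 : Integrable (fun R : SO3 => (∑ p : Fin 3 × Fin 3, ∑ q : Fin 3 × Fin 3,
      G p.1 p.2 * G q.1 q.2 * ((R : Mat3) p.1 p.2 * (R : Mat3) q.1 q.2))
      - 2 * a * (∑ p : Fin 3 × Fin 3, G p.1 p.2 * (R : Mat3) p.1 p.2)) haarSO3 := i4.sub i5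
  refine (integral_congr_ae (ae_of_all _ e)).trans ?_
  rw [integral_add i6 (integrable_const _), integral_sub i4 i5, integral_const_mul,
    integral_finsetSum _ fun p _ => i3 p, integral_finsetSum _ fun p _ => i2 p]
  have s1 (p : Fin 3 × Fin 3) : ∫ R : SO3, ∑ q : Fin 3 × Fin 3,
      G p.1 p.2 * G q.1 q.2 * ((R : Mat3) p.1 p.2 * (R : Mat3) q.1 q.2) ∂haarSO3
      = G p.1 p.2 * G p.1 p.2 * (1 / 3) := by
    rw [integral_finsetSum _ fun q _ => i1 p q, Finset.sum_eq_single p]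
    · rw [integral_const_mul, integral_haarSO3_entry_sq]
    · intro q _ hq
      rw [integral_const_mul, integral_haarSO3_entry_mul_of_ne (Ne.symm hq), mul_zero]
    · simp
  have s2 (p : Fin 3 × Fin 3) : ∫ R : SO3, G p.1 p.2 * (R : Mat3) p.1 p.2 ∂haarSO3 = 0 := by
    rw [integral_const_mul, integral_haarSO3_entry, mul_zero]
  simp_rw [s1, s2]
  rw [← Finset.sum_mul, frob_eq_sum, ← Finset.sum_product']
  simp [div_eq_mul_inv]

/-! ### The matrix Fisher distribution -/

theorem continuous_frob_coe (F : Mat3) : Continuous fun R : SO3 => frob F R := by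
  simp only [frob_eq_sum]; fun_prop

/-- The moment generating function of the Haar measure, that is, the normalizing constant of the
matrix Fisher distribution as a function of its matrix parameter. -/
noncomputable def haarMgf (F : Mat3) : ℝ := ∫ R : SO3, Real.exp (frob F R) ∂haarSO3

theorem integrable_exp_frob (F : Mat3) : Integrable (fun R : SO3 => Real.exp (frob F R)) haarSO3 :=
  integrable_of_continuous_SO3 _ (continuous_frob_coe F).rexp

theorem haarMgf_pos (F : Mat3) : 0 < haarMgf F := integral_exp_pos (integrable_exp_frob F)

/-- By invariance, the normalizing constant depends on the singular values only. -/
theorem haarMgf_fisherParam (U : SO3) (s : Fin 3 → ℝ) (V : SO3) :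
    haarMgf (fisherParam U s V) = fisherConst s := by
  rw [haarMgf, fisherConst,
    ← integral_mul_left_eq_self (fun Q : SO3 => Real.exp (diagonal s * (Q : Mat3)ᵀ).trace) U⁻¹,
    ← integral_mul_right_eq_self
      (fun Q : SO3 => Real.exp (diagonal s * ((U⁻¹ * Q : SO3) : Mat3)ᵀ).trace) V]
  congr 1
  ext R
  have h : ((U⁻¹ * (R * V) : SO3) : Mat3) = (U : Mat3)ᵀ * ((R : Mat3) * (V : Mat3)) := rfl
  rw [h, frob, fisherParam, Matrix.transpose_mul, Matrix.transpose_mul,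
    Matrix.transpose_transpose, ← Matrix.mul_assoc (diagonal s),
    Matrix.trace_mul_comm _ (U : Mat3)]
  simp only [Matrix.mul_assoc]

/-- The matrix Fisher distribution with parameter `F`. -/
noncomputable def fisherMeasure (F : Mat3) : Measure SO3 :=
  haarSO3.withDensity fun R => ENNReal.ofReal (Real.exp (frob F R) / haarMgf F)

theorem continuous_fisherDensity (F : Mat3) :
    Continuous fun R : SO3 => Real.exp (frob F R) / haarMgf F :=
  (continuous_frob_coe F).rexp.div_const _

theorem fisherDensity_nonneg (F : Mat3) (R : SO3) : 0 ≤ Real.exp (frob F R) / haarMgf F :=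
  div_nonneg (Real.exp_pos _).le (haarMgf_pos F).le

theorem integral_fisherMeasure (F : Mat3) (f : SO3 → ℝ) :
    ∫ R, f R ∂fisherMeasure F = ∫ R, Real.exp (frob F R) / haarMgf F * f R ∂haarSO3 := by
  rw [fisherMeasure, integral_withDensity_eq_integral_toReal_smul
    (continuous_fisherDensity F).measurable.ennreal_ofReal (by simp)]
  simp only [ENNReal.toReal_ofReal (fisherDensity_nonneg F _), smul_eq_mul]

instance fisherMeasure.instIsProbabilityMeasure (F : Mat3) :
    IsProbabilityMeasure (fisherMeasure F) := ⟨by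
  rw [fisherMeasure, withDensity_apply _ MeasurableSet.univ, Measure.restrict_univ,
    ← ofReal_integral_eq_lintegral_ofReal
      (integrable_of_continuous_SO3 _ (continuous_fisherDensity F))
      (ae_of_all _ (fisherDensity_nonneg F)), integral_div]
  change ENNReal.ofReal (haarMgf F / haarMgf F) = 1
  rw [div_self (haarMgf_pos F).ne', ENNReal.ofReal_one]⟩

/-- The mean of the matrix Fisher distribution. -/
noncomputable def fisherMean (F : Mat3) : Mat3 :=
  Matrix.of fun i j => ∫ R : SO3, (R : Mat3) i j ∂fisherMeasure F

theorem integral_frob_fisherMeasure (F G : Mat3) :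
    ∫ R : SO3, frob G R ∂fisherMeasure F = frob G (fisherMean F) := by
  simp only [frob_eq_sum, fisherMean, Matrix.of_apply]
  rw [integral_finsetSum _ fun i _ => integrable_of_continuous_SO3 _ (by fun_prop)]
  refine Finset.sum_congr rfl fun i _ => ?_
  rw [integral_finsetSum _ fun i _ => integrable_of_continuous_SO3 _ (by fun_prop)]
  exact Finset.sum_congr rfl fun j _ => integral_const_mul _ _

theorem integral_exp_frob_fisherMeasure (F G : Mat3) :
    ∫ R : SO3, Real.exp (frob G R) ∂fisherMeasure F = haarMgf (F + G) / haarMgf F := by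
  rw [integral_fisherMeasure, haarMgf.eq_1 (F + G), ← integral_div]
  congr 1
  ext R
  rw [frob_add_left, Real.exp_add]
  ring

/-! ### Convexity of the cumulant generating function -/

theorem frobNorm_coe_sub_le (A : Mat3) (hA : ∀ i j, |A i j| ≤ 1) (R : SO3) :
    frobNorm ((R : Mat3) - A) ≤ 6 := by
  have h (i j : Fin 3) : ((R : Mat3) - A) i j * ((R : Mat3) - A) i j ≤ 4 := by
    have h1 := abs_le.1 (abs_entry_le_one (SO3.mul_transpose R) i j)
    have h2 := abs_le.1 (hA i j)
    rw [Matrix.sub_apply]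
    nlinarith
  rw [frobNorm, frob_eq_sum, Real.sqrt_le_left (by norm_num)]
  simp only [Fin.sum_univ_three]
  linarith [h 0 0, h 0 1, h 0 2, h 1 0, h 1 1, h 1 2, h 2 0, h 2 1, h 2 2]

theorem abs_fisherMean_le (F : Mat3) (i j : Fin 3) : |fisherMean F i j| ≤ 1 := by
  have h := norm_integral_le_of_norm_le_const (μ := fisherMeasure F)
    (f := fun R : SO3 => (R : Mat3) i j) (C := 1)
    (ae_of_all _ fun R => abs_entry_le_one (SO3.mul_transpose R) i j)
  simpa [fisherMean] using h

/-- The variance of a linear functional under the matrix Fisher distribution is bounded below,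
because the density is. -/
theorem exists_variance_lower_bound (F : Mat3) : ∃ δ > 0, δ ≤ 1 ∧ ∀ G : Mat3,
    δ * frob G G ≤ ∫ R : SO3, frob G ((R : Mat3) - fisherMean F) ^ 2 ∂fisherMeasure F := by
  obtain ⟨R₀, hR₀⟩ := (continuous_fisherDensity F).exists_forall_le_of_hasCompactSupport
    (HasCompactSupport.of_compactSpace _)
  set d := Real.exp (frob F R₀) / haarMgf F with hd
  have hdpos : 0 < d := div_pos (Real.exp_pos _) (haarMgf_pos F)
  refine ⟨min (d / 3) 1, by positivity, min_le_right _ _, fun G => ?_⟩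
  rw [integral_fisherMeasure]
  have hc : Continuous fun R : SO3 => frob G ((R : Mat3) - fisherMean F) ^ 2 := by
    simp only [frob_sub_right]
    exact ((continuous_frob_coe G).sub continuous_const).pow 2
  calc min (d / 3) 1 * frob G G ≤ d / 3 * frob G G := by
        gcongr
        · exact frob_self_nonneg G
        · exact min_le_left _ _
    _ ≤ d * (frob G G / 3 + frob G (fisherMean F) ^ 2) := by
        nlinarith [mul_nonneg hdpos.le (sq_nonneg (frob G (fisherMean F)))]
    _ = ∫ R : SO3, d * frob G ((R : Mat3) - fisherMean F) ^ 2 ∂haarSO3 := by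
        simp only [frob_sub_right]
        rw [integral_const_mul, integral_haarSO3_frob_sub_sq]
    _ ≤ _ := by
        refine integral_mono (integrable_of_continuous_SO3 _ (hc.const_mul d))
          (integrable_of_continuous_SO3 _ ((continuous_fisherDensity F).mul hc)) fun R => ?_
        exact mul_le_mul_of_nonneg_right (hR₀ R) (sq_nonneg _)

theorem integral_exp_centered (F G : Mat3) :
    ∫ R : SO3, Real.exp (frob G ((R : Mat3) - fisherMean F)) ∂fisherMeasure F
      = Real.exp (-frob G (fisherMean F)) * (haarMgf (F + G) / haarMgf F) := by
  rw [← integral_exp_frob_fisherMeasure, ← integral_const_mul]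
  congr 1
  ext R
  rw [frob_sub_right, sub_eq_add_neg, Real.exp_add, mul_comm]

/-- Quantitative strict convexity of the cumulant generating function `log ∘ haarMgf`: its excess
over the tangent at `F` grows quadratically near `F`, hence at least linearly far from `F`. -/
theorem exists_cumulant_lower_bound (F : Mat3) : ∃ κ > 0, ∀ G : Mat3,
    frob G (fisherMean F) + κ * min (frobNorm G) (frobNorm G ^ 2)
      ≤ Real.log (haarMgf (F + G)) - Real.log (haarMgf F) := by
  obtain ⟨δ, hδ, hδ1, hvar⟩ := exists_variance_lower_bound F
  have hcont (G : Mat3) : Continuous fun R : SO3 => frob G ((R : Mat3) - fisherMean F) := by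
    simp only [frob_sub_right]
    exact (continuous_frob_coe G).sub continuous_const
  have habs (G : Mat3) (R : SO3) : |frob G ((R : Mat3) - fisherMean F)| ≤ 6 * frobNorm G := by
    refine (abs_frob_le _ _).trans ?_
    rw [mul_comm 6]
    exact mul_le_mul_of_nonneg_left (frobNorm_coe_sub_le _ (abs_fisherMean_le F) R)
      (frobNorm_nonneg G)
  have hmean (G : Mat3) : ∫ R : SO3, frob G ((R : Mat3) - fisherMean F) ∂fisherMeasure F = 0 := by
    simp only [frob_sub_right]
    rw [integral_sub (integrable_of_continuous_SO3 _ (continuous_frob_coe G)) (integrable_const _),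
      integral_frob_fisherMeasure]
    simp
  -- the excess is the logarithm of `E exp X` for a centered variable `X`
  have hlog (G : Mat3) : Real.log (haarMgf (F + G)) - Real.log (haarMgf F)
      = frob G (fisherMean F) + Real.log
        (∫ R : SO3, Real.exp (frob G ((R : Mat3) - fisherMean F)) ∂fisherMeasure F) := by
    rw [integral_exp_centered, Real.log_mul (Real.exp_pos _).ne'
      (div_pos (haarMgf_pos _) (haarMgf_pos _)).ne', Real.log_exp,
      Real.log_div (haarMgf_pos _).ne' (haarMgf_pos _).ne']
    ring
  -- near `F`, `exp x ≥ (1 + x / 2) ^ 2` for `x ≥ -2`; this applies if `‖G‖ ≤ 1 / 3`, as `|x| ≤ 6 ‖G‖`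
  have hsmall (G : Mat3) (hG : frobNorm G ≤ 1 / 3) : δ / 8 * frobNorm G ^ 2 ≤ Real.log
      (∫ R : SO3, Real.exp (frob G ((R : Mat3) - fisherMean F)) ∂fisherMeasure F) := by
    have hpt (R : SO3) : 1 + frob G ((R : Mat3) - fisherMean F)
        + 1 / 4 * frob G ((R : Mat3) - fisherMean F) ^ 2
        ≤ Real.exp (frob G ((R : Mat3) - fisherMean F)) := by
      set x := frob G ((R : Mat3) - fisherMean F)
      have hx : -2 ≤ x := by linarith [(abs_le.1 (habs G R)).1]
      have h1 := Real.add_one_le_exp (x / 2)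
      have h2 : Real.exp x = Real.exp (x / 2) ^ 2 := by
        rw [← Real.exp_nat_mul]; congr 1; push_cast; ring
      rw [h2]
      nlinarith
    have h1 : 1 + δ / 4 * frobNorm G ^ 2 ≤
        ∫ R : SO3, Real.exp (frob G ((R : Mat3) - fisherMean F)) ∂fisherMeasure F := by
      have i1 := integrable_of_continuous_SO3 (fisherMeasure F) (hcont G)
      have i2 := (integrable_of_continuous_SO3 (fisherMeasure F) ((hcont G).pow 2)).const_mul (1 / 4)
      have i3 : Integrable (fun R : SO3 => 1 + frob G ((R : Mat3) - fisherMean F))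
        (fisherMeasure F) := (integrable_const 1).add i1
      have h := integral_mono (i3.add i2) (integrable_of_continuous_SO3 (fisherMeasure F)
        (hcont G).rexp) hpt
      refine le_trans ?_ h
      simp only [Pi.add_apply]
      rw [integral_add i3 i2, integral_add (integrable_const 1) i1, hmean, integral_const_mul]
      have := hvar G
      rw [frobNorm_sq]
      simp only [integral_const, probReal_univ, smul_eq_mul, mul_one, Pi.pow_apply]
      linarith
    have h2 : δ / 4 * frobNorm G ^ 2 ≤ 1 := by
      nlinarith [frobNorm_nonneg G]
    have h3 : 0 ≤ δ / 4 * frobNorm G ^ 2 := by positivity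
    have h4 := Real.le_log_one_add_of_nonneg h3
    refine le_trans ?_ (h4.trans (Real.log_le_log (by linarith) h1))
    rw [le_div_iff₀ (by linarith)]
    nlinarith
  refine ⟨δ / 24, by positivity, fun G => ?_⟩
  rw [hlog]
  gcongr
  rcases le_total (frobNorm G) (1 / 3) with hG | hG
  · refine le_trans ?_ (hsmall G hG)
    have : min (frobNorm G) (frobNorm G ^ 2) ≤ frobNorm G ^ 2 := min_le_right _ _
    nlinarith [sq_nonneg (frobNorm G)]
    -- far from `F`, Jensen's inequality reduces to the sphere of radius `1 / 3`
  · set r := 3 * frobNorm G with hr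
    have hr1 : 1 ≤ r := by linarith
    have hr0 : 0 < r := by linarith
    have hH : frobNorm (r⁻¹ • G) = 1 / 3 := by
      rw [frobNorm_smul (by positivity), hr]
      have : frobNorm G ≠ 0 := by linarith
      field_simp
    have hs := hsmall (r⁻¹ • G) hH.le
    rw [hH] at hs
    have hpos : 0 < ∫ R : SO3, Real.exp (frob (r⁻¹ • G) ((R : Mat3) - fisherMean F))
        ∂fisherMeasure F :=
      integral_exp_pos (integrable_of_continuous_SO3 _ (hcont _).rexp)
    have hJ : (∫ R : SO3, Real.exp (frob (r⁻¹ • G) ((R : Mat3) - fisherMean F))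
        ∂fisherMeasure F) ^ r ≤
        ∫ R : SO3, Real.exp (frob G ((R : Mat3) - fisherMean F)) ∂fisherMeasure F := by
      have h := (convexOn_rpow hr1).map_integral_le
        (μ := fisherMeasure F)
        (f := fun R : SO3 => Real.exp (frob (r⁻¹ • G) ((R : Mat3) - fisherMean F)))
        (Real.continuous_rpow_const hr0.le).continuousOn isClosed_Ici
        (ae_of_all _ fun R => (Real.exp_pos _).le)
        (integrable_of_continuous_SO3 _ (hcont _).rexp)
        (integrable_of_continuous_SO3 _
          ((Real.continuous_rpow_const hr0.le).comp (hcont _).rexp))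
      refine h.trans (le_of_eq ?_)
      congr 1
      ext R
      rw [← Real.exp_mul, frob_smul_left]
      congr 1
      field_simp
    have hl := Real.log_le_log (Real.rpow_pos_of_pos hpos r) hJ
    rw [Real.log_rpow hpos] at hl
    refine le_trans ?_ hl
    have : min (frobNorm G) (frobNorm G ^ 2) ≤ frobNorm G := min_le_left _ _
    nlinarith

/-! ### Maximum likelihood estimates -/

theorem fisherLogLik_eq (A : Mat3) (U : SO3) (s : Fin 3 → ℝ) (V : SO3) :
    fisherLogLik A U s V = frob (fisherParam U s V) A - Real.log (haarMgf (fisherParam U s V)) := by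
  rw [haarMgf_fisherParam]; rfl

/-- The parameters of a matrix Fisher distribution are recovered from its mean. -/
theorem isMarginalMLE_fisherMean (U : SO3) {s : Fin 3 → ℝ} (V : SO3) (hs : IsProperOrder s) :
    IsMarginalMLE (fisherMean (fisherParam U s V)) U s V := by
  refine ⟨hs, fun U' s' V' _ => ?_⟩
  obtain ⟨κ, hκ, h⟩ := exists_cumulant_lower_bound (fisherParam U s V)
  have := h (fisherParam U' s' V' - fisherParam U s V)
  rw [add_sub_cancel, frob_sub_left] at this
  have h0 : 0 ≤ κ * min (frobNorm (fisherParam U' s' V' - fisherParam U s V))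
      (frobNorm (fisherParam U' s' V' - fisherParam U s V) ^ 2) :=
    mul_nonneg hκ.le (le_min (frobNorm_nonneg _) (sq_nonneg _))
  rw [fisherLogLik_eq, fisherLogLik_eq]
  linarith

/-- Every maximum likelihood estimate for a mean `A` near the mean of a matrix Fisher distribution is
Lipschitz close to its parameter. The likelihood of the estimate is at least that of the parameter,
and the lower bound for the cumulant generating function limits how far it can be. -/
theorem exists_mle_stability (U : SO3) {s : Fin 3 → ℝ} (V : SO3) (hs : IsProperOrder s) :
    ∃ κ > 0, ∀ (A : Mat3) (U' : SO3) (s' : Fin 3 → ℝ) (V' : SO3), IsMarginalMLE A U' s' V' →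
      frobNorm (A - fisherMean (fisherParam U s V)) < κ →
      frobNorm (fisherParam U' s' V' - fisherParam U s V)
        ≤ κ⁻¹ * frobNorm (A - fisherMean (fisherParam U s V)) := by
  obtain ⟨κ, hκ, h⟩ := exists_cumulant_lower_bound (fisherParam U s V)
  refine ⟨κ, hκ, fun A U' s' V' hA hlt => ?_⟩
  have h1 := h (fisherParam U' s' V' - fisherParam U s V)
  have h2 := hA.2 U s V hs
  have h3 := (abs_le.1 (abs_frob_le (fisherParam U' s' V' - fisherParam U s V)
    (A - fisherMean (fisherParam U s V)))).2
  rw [add_sub_cancel] at h1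
  rw [fisherLogLik_eq, fisherLogLik_eq] at h2
  rw [frob_sub_right, frob_sub_left _ _ A] at h3
  set g := frobNorm (fisherParam U' s' V' - fisherParam U s V)
  set e := frobNorm (A - fisherMean (fisherParam U s V))
  have hg : 0 ≤ g := frobNorm_nonneg _
  have h4 : κ * min g (g ^ 2) ≤ g * e := by linarith
  rw [inv_mul_eq_div, le_div_iff₀ hκ]
  rcases hg.eq_or_lt with h0 | h0
  · rw [← h0, zero_mul]; exact frobNorm_nonneg _
  · rcases le_total g 1 with hg1 | hg1
    · rw [min_eq_right (by nlinarith)] at h4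
      nlinarith
    · rw [min_eq_left (by nlinarith)] at h4
      nlinarith

/-- The first-order condition for a maximum likelihood estimate, obtained by rotating `U`. -/
theorem nuVec_eq_zero_of_isMarginalMLE {A : Mat3} {U : SO3} {s : Fin 3 → ℝ} {V : SO3}
    (h : IsMarginalMLE A U s V) : nuVec U s V A = 0 := by
  set M : Mat3 := diagonal s * ((U : Mat3)ᵀ * A * (V : Mat3))ᵀ with hM
  -- the derivative along `t ↦ U exp(t v̂)` vanishes
  have key (v : Fin 3 → ℝ) : (hat v * M).trace = 0 := by
    have hd : HasDerivAt (fun t : ℝ => NormedSpace.exp (t • hat v)) (hat v) 0 := by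
      open scoped Matrix.Norms.Operator in
      have h := hasDerivAt_exp_smul_const (𝕂 := ℝ) (hat v) (0 : ℝ)
      rw [zero_smul, NormedSpace.exp_zero, one_mul] at h
      exact h
    let L : Mat3 →ₗ[ℝ] ℝ :=
      { toFun := fun X => (X * M).trace
        map_add' := fun X Y => by rw [Matrix.add_mul, Matrix.trace_add]
        map_smul' := fun c X => by rw [Matrix.smul_mul, Matrix.trace_smul]; rfl }
    have hL : HasDerivAt (fun t : ℝ => (NormedSpace.exp (t • hat v) * M).trace)
        ((hat v * M).trace) 0 := by
      open scoped Matrix.Norms.Operator in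
      exact (LinearMap.toContinuousLinearMap L).hasFDerivAt.comp_hasDerivAt (0 : ℝ) hd
    have hmax : IsLocalMax (fun t : ℝ => (NormedSpace.exp (t • hat v) * M).trace) 0 := by
      refine Filter.Eventually.of_forall fun t => ?_
      have ht := h.2 (U * ⟨_, exp_hat_mem (t • v)⟩) s V h.1
      have e (B : Mat3) (B' : SO3) (hB : (B' : Mat3) = U * B) :
          (fisherParam B' s V * Aᵀ).trace = (B * M).trace := by
        rw [fisherParam, hB, hM, Matrix.transpose_mul, Matrix.transpose_mul,
          Matrix.transpose_transpose]
        calc _ = ((U : Mat3) * (B * (diagonal s * ((V : Mat3)ᵀ * Aᵀ)))).trace := by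
              simp only [Matrix.mul_assoc]
          _ = _ := by rw [Matrix.trace_mul_comm]; simp only [Matrix.mul_assoc]
      rw [fisherLogLik, fisherLogLik, sub_le_sub_iff_right, e _ _ rfl,
        e 1 U (Matrix.mul_one _).symm] at ht
      simpa [hat_smul] using ht
    exact hmax.hasDerivAt_eq_zero hL
  have e : nuVec U s V A = vee (Mᵀ - M) := by
    rw [nuVec, hM, Matrix.transpose_mul (diagonal s), Matrix.transpose_transpose,
      Matrix.diagonal_transpose]
  rw [e]
  have k0 := key ![1, 0, 0]
  have k1 := key ![0, 1, 0]
  have k2 := key ![0, 0, 1]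
  simp [hat, Matrix.trace_fin_three, Matrix.vecMul, dotProduct, Fin.sum_univ_three] at k0 k1 k2
  ext i
  fin_cases i <;> simp [vee] <;> linarith

/-! ### Gaussian vectors -/

/-- The standard Gaussian measure on `ℝⁿ`. -/
noncomputable def stdGauss (n : ℕ) : Measure (Fin n → ℝ) := Measure.pi fun _ => gaussianReal 0 1

instance stdGauss.instIsProbabilityMeasure (n : ℕ) : IsProbabilityMeasure (stdGauss n) := by
  unfold stdGauss; infer_instance

theorem wienerIncrement_eq_map {h : ℝ} (hh : 0 ≤ h) :
    wienerIncrement h = (stdGauss 3).map fun g => Real.sqrt h • g := by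
  have h1 : (gaussianReal 0 1).map (fun y => Real.sqrt h * y) = gaussianReal 0 h.toNNReal := by
    rw [gaussianReal_map_const_mul]
    congr 1
    · simp
    · ext
      simp [Real.sq_sqrt hh, Real.coe_toNNReal _ hh]
  have : ∀ i : Fin 3, SigmaFinite ((gaussianReal 0 1).map (fun y => Real.sqrt h * y)) := fun _ => by
    rw [h1]; infer_instance
  have h2 := Measure.pi_map_pi (μ := fun _ : Fin 3 => gaussianReal 0 1)
    (f := fun _ y => Real.sqrt h * y) (fun _ => by fun_prop)
  rw [h1] at h2
  exact h2.symm

theorem stdGauss_map_neg (n : ℕ) : (stdGauss n).map (fun g => -g) = stdGauss n := by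
  have h1 : (gaussianReal 0 1).map (fun y => -y) = gaussianReal 0 1 := by
    rw [gaussianReal_map_neg, neg_zero]
  have : ∀ i : Fin n, SigmaFinite ((gaussianReal 0 1).map (fun y => -y)) := fun _ => by
    rw [h1]; infer_instance
  have h2 := Measure.pi_map_pi (μ := fun _ : Fin n => gaussianReal 0 1)
    (f := fun _ y => -y) (fun _ => by fun_prop)
  simp only [h1] at h2
  exact h2

theorem integral_stdGauss_neg {n : ℕ} (f : (Fin n → ℝ) → ℝ) :
    ∫ g, f (-g) ∂stdGauss n = ∫ g, f g ∂stdGauss n := by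
  conv_rhs => rw [← stdGauss_map_neg]
  exact (integral_map_equiv (MeasurableEquiv.neg (Fin n → ℝ)) f).symm

theorem integrable_norm_pow_stdGauss (n k : ℕ) :
    Integrable (fun g => (1 + ‖g‖) ^ k) (stdGauss n) := by
  have h0 : MemLp (id : EuclideanSpace ℝ (Fin n) → _) (k : ENNReal)
      (stdGaussian (EuclideanSpace ℝ (Fin n))) :=
    IsGaussian.memLp_id _ _ (by simp)
  rw [← map_pi_eq_stdGaussian] at h0
  have h1 := h0.comp_of_map (Measurable.aemeasurable (by fun_prop))
  have h2 : MemLp (fun g : Fin n → ℝ => 1 + ‖WithLp.toLp 2 g‖) k (stdGauss n) :=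
    (memLp_const (1 : ℝ)).add (MemLp.norm h1)
  have h3 := h2.integrable_norm_pow'
  refine h3.mono' (by fun_prop) (ae_of_all _ fun g => ?_)
  have h3 : ‖g‖ ≤ ‖WithLp.toLp 2 g‖ := by
    refine (pi_norm_le_iff_of_nonneg (norm_nonneg _)).2 fun i => ?_
    exact PiLp.norm_apply_le (WithLp.toLp 2 g) i
  have h4 : ‖1 + ‖WithLp.toLp 2 g‖‖ = 1 + ‖WithLp.toLp 2 g‖ :=
    Real.norm_of_nonneg (by positivity)
  rw [h4, Real.norm_of_nonneg (by positivity)]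
  gcongr

/-- A function of polynomial growth is integrable against the standard Gaussian measure. -/
theorem integrable_stdGauss_of_growth {n : ℕ} {f : (Fin n → ℝ) → ℝ} (hf : Continuous f) (C : ℝ)
    (k : ℕ) (hb : ∀ g, |f g| ≤ C * (1 + ‖g‖) ^ k) : Integrable f (stdGauss n) :=
  ((integrable_norm_pow_stdGauss n k).const_mul C).mono' hf.aestronglyMeasurable
    (ae_of_all _ hb)

theorem integral_stdGauss_apply {n : ℕ} (i : Fin n) : ∫ g, g i ∂stdGauss n = 0 := by
  have h := integral_stdGauss_neg (n := n) (fun g => g i)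
  simp only [Pi.neg_apply, integral_neg] at h
  linarith

theorem integral_stdGauss_mul {n : ℕ} (i j : Fin n) :
    ∫ g, g i * g j ∂stdGauss n = if i = j then 1 else 0 := by
  have hmp (i : Fin n) : MeasurePreserving (fun g : Fin n → ℝ => g i) (stdGauss n)
    (gaussianReal 0 1) := measurePreserving_eval (fun _ : Fin n => gaussianReal 0 1) i
  split_ifs with hij
  · subst hij
    have h := variance_id_gaussianReal (μ := 0) (v := 1)
    rw [variance_of_integral_eq_zero (by fun_prop) (by simp)] at h
    have h1 := integral_map (μ := stdGauss n) (φ := fun g : Fin n → ℝ => g i)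
      (measurable_pi_apply i).aemeasurable (f := fun y : ℝ => y * y) (by fun_prop)
    rw [(hmp i).map_eq] at h1
    rw [← h1]
    simpa [sq] using h
  · have hind := (iIndepFun_pi (μ := fun _ : Fin n => gaussianReal 0 1)
      (X := fun _ y => y) (fun _ => by fun_prop)).indepFun hij
    have h := hind.integral_fun_mul_eq_mul_integral
      (measurable_pi_apply i).aestronglyMeasurable (measurable_pi_apply j).aestronglyMeasurable
    refine h.trans ?_
    change (∫ g, g i ∂stdGauss n) * _ = 0
    rw [integral_stdGauss_apply, zero_mul]

theorem stdGauss_eq_withDensity (n : ℕ) : stdGauss n = (volume : Measure (Fin n → ℝ)).withDensity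
    fun g => ENNReal.ofReal (∏ i, gaussianPDFReal 0 1 (g i)) := by
  refine Measure.pi_eq fun s hs => ?_
  rw [withDensity_apply _ (MeasurableSet.univ_pi hs), volume_pi, Measure.restrict_pi_pi,
    ← ofReal_integral_eq_lintegral_ofReal]
  · rw [integral_fintype_prod_eq_prod, ENNReal.ofReal_prod_of_nonneg]
    · refine Finset.prod_congr rfl fun i _ => ?_
      rw [gaussianReal_apply_eq_integral _ one_ne_zero]
    · intro i _
      exact integral_nonneg fun x => gaussianPDFReal_nonneg _ _ _
  · exact Integrable.fintype_prod fun i => (integrable_gaussianPDFReal 0 1).restrict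
  · exact ae_of_all _ fun g => Finset.prod_nonneg fun i _ => gaussianPDFReal_nonneg _ _ _

theorem prod_gaussianPDFReal {n : ℕ} (g : Fin n → ℝ) :
    ∏ i, gaussianPDFReal 0 1 (g i)
      = (Real.sqrt ((2 * Real.pi) ^ n))⁻¹ * Real.exp (-(1 / 2) * (g ⬝ᵥ g)) := by
  simp only [gaussianPDFReal, NNReal.coe_one, mul_one, sub_zero]
  rw [Finset.prod_mul_distrib, ← Real.exp_sum, Finset.prod_const, Finset.card_univ,
    Fintype.card_fin, inv_pow]
  congr 2
  · rw [Real.sqrt_eq_rpow, Real.sqrt_eq_rpow, ← Real.rpow_natCast, ← Real.rpow_natCast,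
      ← Real.rpow_mul (by positivity), ← Real.rpow_mul (by positivity), mul_comm (1 / 2 : ℝ)]
  · rw [dotProduct, Finset.mul_sum]
    exact Finset.sum_congr rfl fun i _ => by ring

/-- A linear change of variables in a Lebesgue integral. -/
theorem lintegral_comp_affine {n : ℕ} (L : Matrix (Fin n) (Fin n) ℝ) (hL : L.det ≠ 0)
    (m : Fin n → ℝ) (f : (Fin n → ℝ) → ENNReal) (hf : Measurable f) :
    ∫⁻ x, f x = ENNReal.ofReal |L.det| * ∫⁻ z, f (m + L *ᵥ z) := by
  have h1 := lintegral_add_left_eq_self (μ := (volume : Measure (Fin n → ℝ))) f m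
  have h2 := Real.map_matrix_volume_pi_eq_smul_volume_pi hL
  have h3 : ∫⁻ z, f (m + L *ᵥ z) = ∫⁻ y, f (m + y) ∂(Measure.map (Matrix.toLin' L) volume) := by
    rw [lintegral_map (by fun_prop) (LinearMap.continuous_of_finiteDimensional _).measurable]
    simp
  rw [h3, h2, lintegral_smul_measure, h1, smul_eq_mul, ← mul_assoc, ← ENNReal.ofReal_mul
    (abs_nonneg _), ← abs_mul, mul_inv_cancel₀ hL]
  simp

/-- A positive definite matrix has a square factorization, here from its square root. -/
theorem exists_mul_transpose_eq {n : ℕ} {S : Matrix (Fin n) (Fin n) ℝ} (hS : S.PosDef) :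
    ∃ L : Matrix (Fin n) (Fin n) ℝ, L * Lᵀ = S ∧ L.det ≠ 0 := by
  obtain ⟨B, hB⟩ : ∃ B : Matrix (Fin n) (Fin n) ℝ, S = star B * B := by
    open scoped MatrixOrder Matrix.Norms.L2Operator in
    exact CStarAlgebra.nonneg_iff_eq_star_mul_self.1 hS.posSemidef.nonneg
  refine ⟨Bᵀ, by rw [hB, Matrix.transpose_transpose]; rfl, fun h => ?_⟩
  have h1 := hS.det_pos
  rw [hB, Matrix.det_mul] at h1
  rw [Matrix.det_transpose] at h
  simp [h] at h1

/-! ### Structure of the matrix Fisher–Gaussian distribution -/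

theorem dotProduct_inv_mulVec {n : ℕ} {L : Matrix (Fin n) (Fin n) ℝ} (hL : L.det ≠ 0)
    (z : Fin n → ℝ) : (L *ᵥ z) ⬝ᵥ ((L * Lᵀ)⁻¹ *ᵥ (L *ᵥ z)) = z ⬝ᵥ z := by
  have hu : IsUnit L.det := isUnit_iff_ne_zero.2 hL
  rw [Matrix.mul_inv_rev, Matrix.mulVec_mulVec, Matrix.mul_assoc, Matrix.nonsing_inv_mul _ hu,
    Matrix.mul_one, ← Matrix.transpose_nonsing_inv, Matrix.dotProduct_mulVec,
    Matrix.vecMul_transpose, Matrix.mulVec_mulVec, Matrix.nonsing_inv_mul _ hu, Matrix.one_mulVec]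

theorem continuous_nuVec (U : SO3) (s : Fin 3 → ℝ) (V : SO3) :
    Continuous fun A : Mat3 => nuVec U s V A := by
  refine continuous_pi fun j => ?_
  exact LinearMap.continuous_of_finiteDimensional (nuCoord U s V j)

/-- The conditional mean of the linear part given the attitude. -/
def MFGParam.condMean {n : ℕ} (θ : MFGParam n) (Q : SO3) : Fin n → ℝ :=
  θ.μ + θ.P *ᵥ nuVec θ.U θ.s θ.V Q

theorem MFGParam.continuous_condMean {n : ℕ} (θ : MFGParam n) : Continuous θ.condMean :=
  continuous_const.add (continuous_const.matrix_mulVec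
    ((continuous_nuVec _ _ _).comp continuous_SO3_coe))

/-- The parameter of the matrix Fisher marginal. -/
def MFGParam.fisher {n : ℕ} (θ : MFGParam n) : Mat3 := fisherParam θ.U θ.s θ.V

/-- The parametrization `(Q, z) ↦ (Q, μ + P ν_Q + L z)`, to be used with `L Lᵀ = Σ_c`. -/
def MFGParam.chart {n : ℕ} (θ : MFGParam n) (L : Matrix (Fin n) (Fin n) ℝ)
    (p : SO3 × (Fin n → ℝ)) : SO3 × (Fin n → ℝ) := (p.1, θ.condMean p.1 + L *ᵥ p.2)

theorem MFGParam.continuous_chart {n : ℕ} (θ : MFGParam n) (L : Matrix (Fin n) (Fin n) ℝ) :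
    Continuous (θ.chart L) :=
  continuous_fst.prodMk ((θ.continuous_condMean.comp continuous_fst).add
    (continuous_const.matrix_mulVec continuous_snd))

theorem MFGParam.continuous_density {n : ℕ} (θ : MFGParam n) : Continuous θ.density := by
  have hy : Continuous fun p : SO3 × (Fin n → ℝ) => p.2 - θ.condMean p.1 :=
    continuous_snd.sub (θ.continuous_condMean.comp continuous_fst)
  refine (continuous_const.mul (continuous_const.mul (hy.dotProduct
    (continuous_const.matrix_mulVec hy))).rexp).mul ?_
  exact ((continuous_frob_coe θ.fisher).comp continuous_fst).rexp

/-- In the parametrization by `chart`, the density factorizes. -/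
theorem MFGParam.density_chart {n : ℕ} (θ : MFGParam n) {L : Matrix (Fin n) (Fin n) ℝ}
    (hLL : L * Lᵀ = condCov θ.Sig θ.P θ.s) (hL : L.det ≠ 0) (Q : SO3) (z : Fin n → ℝ) :
    |L.det| * θ.density (θ.chart L (Q, z))
      = Real.exp (frob θ.fisher Q) / haarMgf θ.fisher * ∏ i, gaussianPDFReal 0 1 (z i) := by
  have hdet : (condCov θ.Sig θ.P θ.s).det = |L.det| ^ 2 := by
    rw [← hLL, Matrix.det_mul, Matrix.det_transpose, sq_abs, sq]
  have hy : (θ.chart L (Q, z)).2 - (θ.μ + θ.P *ᵥ nuVec θ.U θ.s θ.V (θ.chart L (Q, z)).1)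
      = L *ᵥ z := by
    simp [chart, condMean]
  simp only [density]
  rw [hy, ← hLL, dotProduct_inv_mulVec hL, hLL, prod_gaussianPDFReal, hdet,
    Real.sqrt_mul (by positivity), Real.sqrt_sq (abs_nonneg _), MFGParam.fisher,
    haarMgf_fisherParam]
  have hd : |L.det| ≠ 0 := abs_ne_zero.2 hL
  have hc : fisherConst θ.s ≠ 0 := by
    rw [← haarMgf_fisherParam θ.U θ.s θ.V]; exact (haarMgf_pos _).ne'
  have hp : Real.sqrt ((2 * Real.pi) ^ n) ≠ 0 := by positivity
  change _ = Real.exp ((fisherParam θ.U θ.s θ.V * (Q : Mat3)ᵀ).trace) / _ * _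
  have : (θ.chart L (Q, z)).1 = Q := rfl
  rw [this]
  field_simp

/-- A matrix Fisher–Gaussian vector consists of a matrix Fisher distributed attitude and, given
the attitude, a Gaussian vector. -/
theorem MFGParam.law_eq_map {n : ℕ} (θ : MFGParam n) {L : Matrix (Fin n) (Fin n) ℝ}
    (hLL : L * Lᵀ = condCov θ.Sig θ.P θ.s) (hL : L.det ≠ 0) :
    θ.law = ((fisherMeasure θ.fisher).prod (stdGauss n)).map (θ.chart L) := by
  refine Measure.ext_of_lintegral _ fun f hf => ?_
  have hdens : Measurable fun p => ENNReal.ofReal (θ.density p) :=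
    θ.continuous_density.measurable.ennreal_ofReal
  have hG : Measurable fun z : Fin n → ℝ => ENNReal.ofReal (∏ i, gaussianPDFReal 0 1 (z i)) :=
    (Finset.measurable_prod _ fun i _ =>
      (measurable_gaussianPDFReal 0 1).comp (measurable_pi_apply i)).ennreal_ofReal
  have hF := (continuous_fisherDensity θ.fisher).measurable.ennreal_ofReal
  have hprod : Measurable fun p : SO3 × (Fin n → ℝ) =>
      ENNReal.ofReal (Real.exp (frob θ.fisher p.1) / haarMgf θ.fisher) *
        ENNReal.ofReal (∏ i, gaussianPDFReal 0 1 (p.2 i)) :=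
    (hF.comp measurable_fst).mul (hG.comp measurable_snd)
  have hfc : Measurable fun p => f (θ.chart L p) := hf.comp (θ.continuous_chart L).measurable
  rw [law, lintegral_withDensity_eq_lintegral_mul _ hdens hf,
    lintegral_map hf (θ.continuous_chart L).measurable, fisherMeasure, stdGauss_eq_withDensity,
    prod_withDensity hF hG, lintegral_withDensity_eq_lintegral_mul _ hprod hfc,
    lintegral_prod _ (hdens.mul hf).aemeasurable, lintegral_prod _ (hprod.mul hfc).aemeasurable]
  refine lintegral_congr fun Q => ?_
  simp only [Pi.mul_apply]
  have hmeas : Measurable fun x : Fin n → ℝ => ENNReal.ofReal (θ.density (Q, x)) * f (Q, x) :=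
    (hdens.mul hf).comp measurable_prodMk_left
  rw [lintegral_comp_affine L hL (θ.condMean Q) _ hmeas, ← lintegral_const_mul' _ _ (by simp)]
  refine lintegral_congr fun z => ?_
  rw [← mul_assoc, ← ENNReal.ofReal_mul (abs_nonneg _),
    ← ENNReal.ofReal_mul (fisherDensity_nonneg _ _), ← θ.density_chart hLL hL]
  rfl

/-! ### Moments of the matrix Fisher–Gaussian distribution -/

theorem integral_stdGauss_mulVec {n : ℕ} (L : Matrix (Fin n) (Fin n) ℝ) (i : Fin n) :
    ∫ z, (L *ᵥ z) i ∂stdGauss n = 0 := by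
  have h := integral_stdGauss_neg (n := n) (fun g => (L *ᵥ g) i)
  simp only [Matrix.mulVec_neg, Pi.neg_apply, integral_neg] at h
  linarith

theorem abs_apply_mul_apply_le {n : ℕ} (g : Fin n → ℝ) (i j : Fin n) :
    |g i * g j| ≤ (1 + ‖g‖) ^ 2 := by
  have h1 : |g i| ≤ 1 + ‖g‖ := (norm_le_pi_norm g i).trans (by linarith)
  have h2 : |g j| ≤ 1 + ‖g‖ := (norm_le_pi_norm g j).trans (by linarith)
  rw [abs_mul, sq]
  exact mul_le_mul h1 h2 (abs_nonneg _) (by positivity)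

theorem integrable_stdGauss_apply_mul {n : ℕ} (i j : Fin n) :
    Integrable (fun g => g i * g j) (stdGauss n) :=
  integrable_stdGauss_of_growth (by fun_prop) 1 2 fun g => by
    rw [one_mul]; exact abs_apply_mul_apply_le g i j

/-- The expectation of a quadratic form in a standard Gaussian vector. -/
theorem integral_stdGauss_quadratic {n : ℕ} (a : Fin n → Fin n → ℝ) :
    ∫ g, ∑ i, ∑ j, a i j * (g i * g j) ∂stdGauss n = ∑ i, a i i := by
  rw [integral_finsetSum _ fun i _ => integrable_finsetSum _ fun j _ =>
    (integrable_stdGauss_apply_mul i j).const_mul _]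
  refine Finset.sum_congr rfl fun i _ => ?_
  rw [integral_finsetSum _ fun j _ => (integrable_stdGauss_apply_mul i j).const_mul _]
  simp only [integral_const_mul, integral_stdGauss_mul]
  simp

theorem integral_stdGauss_mulVec_mul {n : ℕ} (L : Matrix (Fin n) (Fin n) ℝ) (i j : Fin n) :
    ∫ z, (L *ᵥ z) i * (L *ᵥ z) j ∂stdGauss n = (L * Lᵀ) i j := by
  have e (z : Fin n → ℝ) : (L *ᵥ z) i * (L *ᵥ z) j
      = ∑ k, ∑ l, L i k * L j l * (z k * z l) := by
    simp only [Matrix.mulVec, dotProduct]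
    rw [Finset.sum_mul_sum]
    exact Finset.sum_congr rfl fun k _ => Finset.sum_congr rfl fun l _ => by ring
  simp_rw [e]
  rw [integral_stdGauss_quadratic (fun k l => L i k * L j l), Matrix.mul_apply]
  rfl

theorem exists_norm_mulVec_le {m n : ℕ} (L : Matrix (Fin m) (Fin n) ℝ) :
    ∃ K, 0 ≤ K ∧ ∀ z : Fin n → ℝ, ‖L *ᵥ z‖ ≤ K * ‖z‖ :=
  ⟨‖(Matrix.mulVecLin L).toContinuousLinearMap‖, norm_nonneg _,
    fun z => (Matrix.mulVecLin L).toContinuousLinearMap.le_opNorm z⟩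

section Law

variable {n : ℕ} (θ : MFGParam n)

theorem MFGParam.exists_chart : ∃ L : Matrix (Fin n) (Fin n) ℝ,
    L * Lᵀ = condCov θ.Sig θ.P θ.s ∧
    θ.law = ((fisherMeasure θ.fisher).prod (stdGauss n)).map (θ.chart L) := by
  obtain ⟨L, hLL, hL⟩ := exists_mul_transpose_eq θ.condCov_posDef
  exact ⟨L, hLL, θ.law_eq_map hLL hL⟩

instance MFGParam.instIsProbabilityMeasure_law : IsProbabilityMeasure θ.law := by
  obtain ⟨L, _, h⟩ := θ.exists_chart
  rw [h]
  exact Measure.isProbabilityMeasure_map (θ.continuous_chart L).measurable.aemeasurable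

theorem MFGParam.integrable_law_norm_pow (k : ℕ) :
    Integrable (fun p : SO3 × (Fin n → ℝ) => (1 + ‖p.2‖) ^ k) θ.law := by
  obtain ⟨L, _, h⟩ := θ.exists_chart
  obtain ⟨K, hK, hL⟩ := exists_norm_mulVec_le L
  obtain ⟨Q₀, hQ₀⟩ := θ.continuous_condMean.norm.exists_forall_ge_of_hasCompactSupport
    (HasCompactSupport.of_compactSpace _)
  rw [h, integrable_map_measure (by fun_prop) (θ.continuous_chart L).measurable.aemeasurable]
  have h1 := (((integrable_norm_pow_stdGauss n k).const_mul
    ((1 + ‖θ.condMean Q₀‖ + K) ^ k)).comp_snd (fisherMeasure θ.fisher))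
  refine h1.mono' ?_ (ae_of_all _ fun p => ?_)
  · exact (Continuous.comp (by fun_prop : Continuous fun p : SO3 × (Fin n → ℝ) =>
      (1 + ‖p.2‖) ^ k) (θ.continuous_chart L)).aestronglyMeasurable
  · rw [Function.comp_apply, Real.norm_of_nonneg (by positivity), ← mul_pow]
    refine pow_le_pow_left₀ (by positivity) ?_ k
    have h2 : ‖(θ.chart L p).2‖ ≤ ‖θ.condMean Q₀‖ + K * ‖p.2‖ :=
      (norm_add_le _ _).trans (add_le_add (hQ₀ p.1) (hL p.2))
    nlinarith [norm_nonneg p.2, norm_nonneg (θ.condMean Q₀),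
      mul_nonneg (norm_nonneg p.2) (norm_nonneg (θ.condMean Q₀))]

/-- A function of polynomial growth is integrable against a matrix Fisher–Gaussian law. -/
theorem MFGParam.integrable_law_of_growth {f : SO3 × (Fin n → ℝ) → ℝ} (hf : Continuous f)
    (C : ℝ) (k : ℕ) (hb : ∀ p, |f p| ≤ C * (1 + ‖p.2‖) ^ k) : Integrable f θ.law :=
  ((θ.integrable_law_norm_pow k).const_mul C).mono' hf.aestronglyMeasurable (ae_of_all _ hb)

/-- The residual is independent of the attitude. -/
theorem MFGParam.integral_law_mul (L : Matrix (Fin n) (Fin n) ℝ)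
    (h : θ.law = ((fisherMeasure θ.fisher).prod (stdGauss n)).map (θ.chart L))
    {φ : SO3 → ℝ} (hφ : Continuous φ) {ψ : (Fin n → ℝ) → ℝ} (hψ : Continuous ψ) :
    ∫ p, φ p.1 * ψ (p.2 - θ.condMean p.1) ∂θ.law
      = (∫ Q, φ Q ∂fisherMeasure θ.fisher) * ∫ z, ψ (L *ᵥ z) ∂stdGauss n := by
  have hc : Continuous fun p : SO3 × (Fin n → ℝ) => φ p.1 * ψ (p.2 - θ.condMean p.1) :=
    (hφ.comp continuous_fst).mul
      (hψ.comp (continuous_snd.sub (θ.continuous_condMean.comp continuous_fst)))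
  rw [h, integral_map (θ.continuous_chart L).measurable.aemeasurable hc.aestronglyMeasurable,
    ← integral_prod_mul]
  congr 1
  ext p
  simp [MFGParam.chart]

theorem MFGParam.integral_law_fst {φ : SO3 → ℝ} (hφ : Continuous φ) :
    ∫ p, φ p.1 ∂θ.law = ∫ Q, φ Q ∂fisherMeasure θ.fisher := by
  obtain ⟨L, _, h⟩ := θ.exists_chart
  simpa using θ.integral_law_mul L h hφ (ψ := fun _ => 1) continuous_const

theorem MFGParam.integral_law_mul_residual {φ : SO3 → ℝ} (hφ : Continuous φ) (i : Fin n) :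
    ∫ p, φ p.1 * (p.2 - θ.condMean p.1) i ∂θ.law = 0 := by
  obtain ⟨L, _, h⟩ := θ.exists_chart
  rw [θ.integral_law_mul L h hφ (ψ := fun y => y i) (by fun_prop), integral_stdGauss_mulVec,
    mul_zero]

theorem MFGParam.integral_law_mul_residual_mul {φ : SO3 → ℝ} (hφ : Continuous φ) (i j : Fin n) :
    ∫ p, φ p.1 * ((p.2 - θ.condMean p.1) i * (p.2 - θ.condMean p.1) j) ∂θ.law
      = condCov θ.Sig θ.P θ.s i j * ∫ Q, φ Q ∂fisherMeasure θ.fisher := by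
  obtain ⟨L, hLL, h⟩ := θ.exists_chart
  rw [θ.integral_law_mul L h hφ (ψ := fun y => y i * y j) (by fun_prop),
    integral_stdGauss_mulVec_mul, hLL, mul_comm]

theorem integral_fisherMeasure_linearMap (F : Mat3) (ℓ : Mat3 →ₗ[ℝ] ℝ) :
    ∫ Q : SO3, ℓ Q ∂fisherMeasure F = ℓ (fisherMean F) := by
  have e (A : Mat3) : ℓ A = frob (Matrix.of fun i j => ℓ (Matrix.single i j 1)) A := by
    rw [linearMap_eq_sum ℓ A, frob_eq_sum]
    rfl
  rw [e (fisherMean F), ← integral_frob_fisherMeasure]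
  exact integral_congr_ae (ae_of_all _ fun Q => e Q)

/-- The variable `ν_R` of a matrix Fisher distribution is centered, since the parameters are
themselves a maximum likelihood estimate. -/
theorem integral_fisherMeasure_nuVec (U : SO3) {s : Fin 3 → ℝ} (V : SO3) (hs : IsProperOrder s)
    (i : Fin 3) : ∫ Q : SO3, nuVec U s V Q i ∂fisherMeasure (fisherParam U s V) = 0 := by
  have h := integral_fisherMeasure_linearMap (fisherParam U s V) (nuCoord U s V i)
  refine h.trans ?_
  exact congrFun (nuVec_eq_zero_of_isMarginalMLE (isMarginalMLE_fisherMean U V hs)) i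

end Law

/-! ### Taylor expansion of the exponential -/

section Taylor

variable {𝔸 : Type*} [NormedRing 𝔸] [NormedAlgebra ℝ 𝔸] [CompleteSpace 𝔸]

/-- The remainder of the exponential series is bounded by the corresponding power as long as the
exponential stays bounded along the ray; no factor `exp ‖B‖` is lost. -/
theorem norm_exp_sub_sum_le {B : 𝔸} {C : ℝ}
    (hC : ∀ t ∈ Set.Icc (0 : ℝ) 1, ‖NormedSpace.exp (t • B)‖ ≤ C) (n : ℕ) :
    ∀ t ∈ Set.Icc (0 : ℝ) 1, ‖NormedSpace.exp (t • B)
      - ∑ k ∈ Finset.range n, (t ^ k / (k.factorial : ℝ)) • B ^ k‖ ≤ C * ‖B‖ ^ n := by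
  have hC0 : 0 ≤ C := (norm_nonneg _).trans (hC 0 (by simp))
  induction n with
  | zero => simpa using hC
  | succ n ih =>
    intro t ht
    set r : ℝ → 𝔸 := fun t => NormedSpace.exp (t • B)
      - ∑ k ∈ Finset.range (n + 1), (t ^ k / (k.factorial : ℝ)) • B ^ k with hr
    have hd (t : ℝ) : HasDerivAt r (B * (NormedSpace.exp (t • B)
        - ∑ k ∈ Finset.range n, (t ^ k / (k.factorial : ℝ)) • B ^ k)) t := by
      rw [mul_sub, Finset.mul_sum]
      refine (hasDerivAt_exp_smul_const' (𝕂 := ℝ) B t).sub ?_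
      have h1 : HasDerivAt (fun t : ℝ => ∑ k ∈ Finset.range (n + 1),
          (t ^ k / (k.factorial : ℝ)) • B ^ k)
          (∑ k ∈ Finset.range (n + 1), ((k : ℝ) * t ^ (k - 1) / (k.factorial : ℝ)) • B ^ k) t :=
        HasDerivAt.fun_sum fun k _ => ((hasDerivAt_pow k t).div_const _).smul_const _
      refine h1.congr_deriv ?_
      rw [Finset.sum_range_succ']
      simp only [Nat.cast_zero, zero_mul, zero_div, zero_smul, add_zero, Nat.add_sub_cancel]
      refine Finset.sum_congr rfl fun k _ => ?_
      rw [mul_smul_comm, ← pow_succ', Nat.factorial_succ]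
      congr 1
      push_cast
      field_simp
    have h0 : r 0 = 0 := by
      simp only [hr, zero_smul, NormedSpace.exp_zero, Finset.sum_range_succ']
      simp
    have hb (s : ℝ) (hs : s ∈ Set.Icc (0 : ℝ) 1) : ‖B * (NormedSpace.exp (s • B)
        - ∑ k ∈ Finset.range n, (s ^ k / (k.factorial : ℝ)) • B ^ k)‖ ≤ C * ‖B‖ ^ (n + 1) := by
      refine (norm_mul_le _ _).trans ?_
      calc _ ≤ ‖B‖ * (C * ‖B‖ ^ n) := by gcongr; exact ih s hs
        _ = _ := by ring
    have h2 := (convex_Icc (0 : ℝ) 1).norm_image_sub_le_of_norm_hasDerivWithin_le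
      (fun s _ => (hd s).hasDerivWithinAt) hb (Set.left_mem_Icc.2 zero_le_one) ht
    rw [h0, sub_zero, sub_zero] at h2
    refine h2.trans (mul_le_of_le_one_right (by positivity) ?_)
    rw [Real.norm_eq_abs, abs_of_nonneg ht.1]
    exact ht.2

/-- The expansion of `exp (ε² b + ε c)` up to the fourth order in `ε`. The scaling is that of a drift
`b` and a Brownian increment `c` over a time step of length `ε²`. -/
theorem norm_exp_expansion_le {b c : 𝔸} {C N ε : ℝ} (hC1 : 1 ≤ C)
    (hC : ∀ t ∈ Set.Icc (0 : ℝ) 1, ‖NormedSpace.exp (t • (ε ^ 2 • b + ε • c))‖ ≤ C)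
    (hN : 1 ≤ N) (hb : ‖b‖ ≤ N) (hc : ‖c‖ ≤ N) (hε : 0 ≤ ε) (hε1 : ε ≤ 1) :
    ‖NormedSpace.exp (ε ^ 2 • b + ε • c) - (1 + ε • c + ε ^ 2 • (b + (1 / 2 : ℝ) • (c * c))
      + ε ^ 3 • ((1 / 2 : ℝ) • (b * c + c * b) + (1 / 6 : ℝ) • (c * c * c)))‖
      ≤ ε ^ 4 * (18 * C * N ^ 4) := by
  have h1 := norm_exp_sub_sum_le hC 4 1 (by simp)
  set B := ε ^ 2 • b + ε • c with hB
  have hBn : ‖B‖ ≤ 2 * ε * N := by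
    calc ‖B‖ ≤ ε ^ 2 * ‖b‖ + ε * ‖c‖ := by
          refine (norm_add_le _ _).trans (le_of_eq ?_)
          rw [norm_smul, norm_smul, Real.norm_of_nonneg hε, Real.norm_of_nonneg (by positivity)]
      _ ≤ ε * N + ε * N := by
          gcongr
          nlinarith
      _ = _ := by ring
  have h2 : ‖NormedSpace.exp B - ∑ k ∈ Finset.range 4, ((1 : ℝ) ^ k / (k.factorial : ℝ)) • B ^ k‖
      ≤ ε ^ 4 * (16 * C * N ^ 4) := by
    rw [one_smul] at h1
    refine h1.trans ?_
    calc C * ‖B‖ ^ 4 ≤ C * (2 * ε * N) ^ 4 := by gcongr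
      _ = _ := by ring
  -- the part of the cubic Taylor polynomial that is of order four or higher in `ε`
  set ρ : 𝔸 := (1 / 2 : ℝ) • (b * b)
    + (1 / 6 : ℝ) • (b * c * c + c * b * c + c * c * b + ε • (b * b * c + b * c * b + c * b * b)
      + ε ^ 2 • (b * b * b)) with hρ
  have h3 : ∑ k ∈ Finset.range 4, ((1 : ℝ) ^ k / (k.factorial : ℝ)) • B ^ k
      = 1 + ε • c + ε ^ 2 • (b + (1 / 2 : ℝ) • (c * c))
        + ε ^ 3 • ((1 / 2 : ℝ) • (b * c + c * b) + (1 / 6 : ℝ) • (c * c * c)) + ε ^ 4 • ρ := by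
    have e3 : B ^ 3 = B * B * B := by rw [pow_succ, sq]
    simp only [Finset.sum_range_succ, Finset.sum_range_zero, zero_add, one_pow, pow_zero, pow_one,
      Nat.factorial, hρ, e3, sq B]
    rw [hB]
    simp only [add_mul, mul_add, smul_mul_assoc, mul_smul_comm, smul_add, smul_smul, ← mul_assoc]
    push_cast
    module
  have h4 : ‖ρ‖ ≤ 2 * N ^ 4 := by
    have hbb : ‖b * b‖ ≤ N * N := norm_mul_le_of_le hb hb
    have hcc : ‖c * c‖ ≤ N * N := norm_mul_le_of_le hc hc
    have hbc : ‖b * c‖ ≤ N * N := norm_mul_le_of_le hb hc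
    have hcb : ‖c * b‖ ≤ N * N := norm_mul_le_of_le hc hb
    have t1 : ‖b * c * c + c * b * c + c * c * b‖ ≤ N * N * N + N * N * N + N * N * N :=
      norm_add_le_of_le (norm_add_le_of_le (norm_mul_le_of_le hbc hc)
        (norm_mul_le_of_le hcb hc)) (norm_mul_le_of_le hcc hb)
    have t2 : ‖b * b * c + b * c * b + c * b * b‖ ≤ N * N * N + N * N * N + N * N * N :=
      norm_add_le_of_le (norm_add_le_of_le (norm_mul_le_of_le hbb hc)
        (norm_mul_le_of_le hbc hb)) (norm_mul_le_of_le hcb hb)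
    have t2' : ‖ε • (b * b * c + b * c * b + c * b * b)‖ ≤ N * N * N + N * N * N + N * N * N := by
      rw [norm_smul, Real.norm_of_nonneg hε]
      exact (mul_le_of_le_one_left (norm_nonneg _) hε1).trans t2
    have t3 : ‖ε ^ 2 • (b * b * b)‖ ≤ N * N * N := by
      rw [norm_smul, Real.norm_of_nonneg (by positivity)]
      exact (mul_le_of_le_one_left (norm_nonneg _) (pow_le_one₀ hε hε1)).trans
        (norm_mul_le_of_le hbb hb)
    have t4 := norm_add_le_of_le (norm_add_le_of_le t1 t2') t3
    have t5 : ‖ρ‖ ≤ 1 / 2 * (N * N) + 1 / 6 * (N * N * N + N * N * N + N * N * N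
        + (N * N * N + N * N * N + N * N * N) + N * N * N) := by
      refine norm_add_le_of_le ?_ ?_
      · rw [norm_smul, Real.norm_of_nonneg (by norm_num)]
        gcongr
      · rw [norm_smul, Real.norm_of_nonneg (by norm_num)]
        gcongr
    have hN2 : N * N ≤ N ^ 4 := by
      calc N * N = N ^ 2 := by ring
        _ ≤ N ^ 4 := pow_le_pow_right₀ hN (by norm_num)
    have hN3 : N * N * N ≤ N ^ 4 := by
      calc N * N * N = N ^ 3 := by ring
        _ ≤ N ^ 4 := pow_le_pow_right₀ hN (by norm_num)
    have hN4 : 0 ≤ N ^ 4 := by positivity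
    linarith
  rw [h3] at h2
  have h5 : ‖ε ^ 4 • ρ‖ ≤ ε ^ 4 * (2 * N ^ 4) := by
    rw [norm_smul, Real.norm_of_nonneg (by positivity)]
    gcongr
  calc _ = ‖NormedSpace.exp B - (1 + ε • c + ε ^ 2 • (b + (1 / 2 : ℝ) • (c * c))
        + ε ^ 3 • ((1 / 2 : ℝ) • (b * c + c * b) + (1 / 6 : ℝ) • (c * c * c)) + ε ^ 4 • ρ)
        + ε ^ 4 • ρ‖ := by congr 1; abel
    _ ≤ ε ^ 4 * (16 * C * N ^ 4) + ε ^ 4 * (2 * N ^ 4) := norm_add_le_of_le h2 h5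
    _ ≤ _ := by
      have : 0 ≤ ε ^ 4 * N ^ 4 := by positivity
      nlinarith

end Taylor

/-! ### Even parts of expansions -/

/-- The even part of a scalar expansion. -/
theorem abs_even_part_le {a₀ a₁ a₂ a₃ ε T p m : ℝ}
    (hp : |p - (a₀ + ε * a₁ + ε ^ 2 * a₂ + ε ^ 3 * a₃)| ≤ ε ^ 4 * T)
    (hm : |m - (a₀ - ε * a₁ + ε ^ 2 * a₂ - ε ^ 3 * a₃)| ≤ ε ^ 4 * T) :
    |(p + m) / 2 - (a₀ + ε ^ 2 * a₂)| ≤ ε ^ 4 * T := by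
  rw [abs_le] at *
  constructor <;> linarith

theorem abs_mul_sub_mul_le {p p' q q' T e : ℝ} (h1 : |p - q| ≤ e) (h2 : |p' - q'| ≤ e)
    (hq : |q| ≤ T) (hp' : |p'| ≤ T) : |p * p' - q * q'| ≤ 2 * T * e := by
  have he : 0 ≤ e := (abs_nonneg _).trans h1
  have hT : 0 ≤ T := (abs_nonneg _).trans hq
  calc |p * p' - q * q'| = |(p - q) * p' + q * (p' - q')| := by congr 1; ring
    _ ≤ |p - q| * |p'| + |q| * |p' - q'| := by
      rw [← abs_mul, ← abs_mul]; exact abs_add_le _ _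
    _ ≤ e * T + T * e := by gcongr
    _ = _ := by ring

/-- The even part of the product of two scalar expansions. -/
theorem abs_even_part_mul_le {a₀ a₁ a₂ a₃ b₀ b₁ b₂ b₃ ε T p m p' m' : ℝ} (hε : 0 ≤ ε) (hε1 : ε ≤ 1)
    (hp : |p - (a₀ + ε * a₁ + ε ^ 2 * a₂ + ε ^ 3 * a₃)| ≤ ε ^ 4 * T)
    (hm : |m - (a₀ - ε * a₁ + ε ^ 2 * a₂ - ε ^ 3 * a₃)| ≤ ε ^ 4 * T)
    (hp' : |p' - (b₀ + ε * b₁ + ε ^ 2 * b₂ + ε ^ 3 * b₃)| ≤ ε ^ 4 * T)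
    (hm' : |m' - (b₀ - ε * b₁ + ε ^ 2 * b₂ - ε ^ 3 * b₃)| ≤ ε ^ 4 * T)
    (ha₀ : |a₀| ≤ T) (ha₁ : |a₁| ≤ T) (ha₂ : |a₂| ≤ T) (ha₃ : |a₃| ≤ T)
    (hb₀ : |b₀| ≤ T) (hb₁ : |b₁| ≤ T) (hb₂ : |b₂| ≤ T) (hb₃ : |b₃| ≤ T) :
    |(p * p' + m * m') / 2 - (a₀ * b₀ + ε ^ 2 * (a₀ * b₂ + a₂ * b₀ + a₁ * b₁))|
      ≤ ε ^ 4 * (14 * T ^ 2) := by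
  have hT : 0 ≤ T := (abs_nonneg _).trans ha₀
  have hε2 : ε ^ 2 ≤ 1 := pow_le_one₀ hε hε1
  have hε3 : ε ^ 3 ≤ 1 := pow_le_one₀ hε hε1
  have hε4 : ε ^ 4 ≤ 1 := pow_le_one₀ hε hε1
  have small (x δ : ℝ) (hδ : 0 ≤ δ) (hδ1 : δ ≤ 1) (hx : |x| ≤ T) : |δ * x| ≤ T := by
    rw [abs_mul, abs_of_nonneg hδ]
    exact (mul_le_of_le_one_left (abs_nonneg _) hδ1).trans hx
  have sum4 (x y z w : ℝ) (hx : |x| ≤ T) (hy : |y| ≤ T) (hz : |z| ≤ T) (hw : |w| ≤ T) :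
      |x + y + z + w| ≤ 4 * T ∧ |x - y + z - w| ≤ 4 * T := by
    rw [abs_le] at hx hy hz hw
    constructor <;> rw [abs_le] <;> constructor <;> linarith
  obtain ⟨A1, A2⟩ := sum4 a₀ (ε * a₁) (ε ^ 2 * a₂) (ε ^ 3 * a₃) ha₀ (small _ _ hε hε1 ha₁)
    (small _ _ (by positivity) hε2 ha₂) (small _ _ (by positivity) hε3 ha₃)
  obtain ⟨B1, B2⟩ := sum4 b₀ (ε * b₁) (ε ^ 2 * b₂) (ε ^ 3 * b₃) hb₀ (small _ _ hε hε1 hb₁)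
    (small _ _ (by positivity) hε2 hb₂) (small _ _ (by positivity) hε3 hb₃)
  have five (x y : ℝ) (h : |x - y| ≤ ε ^ 4 * T) (hy : |y| ≤ 4 * T) : |x| ≤ 5 * T := by
    have : ε ^ 4 * T ≤ T := mul_le_of_le_one_left hT hε4
    rw [abs_le] at h hy ⊢
    constructor <;> linarith
  have h1 := abs_mul_sub_mul_le hp hp' (A1.trans (by linarith : 4 * T ≤ 5 * T)) (five _ _ hp' B1)
  have h2 := abs_mul_sub_mul_le hm hm' (A2.trans (by linarith : 4 * T ≤ 5 * T)) (five _ _ hm' B2)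
  have mulT (x y : ℝ) (hx : |x| ≤ T) (hy : |y| ≤ T) : |x * y| ≤ T ^ 2 := by
    rw [abs_mul, sq]
    exact mul_le_mul hx hy (abs_nonneg _) hT
  have h3 : |ε ^ 4 * (a₂ * b₂ + a₁ * b₃ + a₃ * b₁ + ε ^ 2 * (a₃ * b₃))| ≤ ε ^ 4 * (4 * T ^ 2) := by
    rw [abs_mul, abs_of_nonneg (by positivity : (0 : ℝ) ≤ ε ^ 4)]
    gcongr
    have k1 := mulT _ _ ha₂ hb₂
    have k2 := mulT _ _ ha₁ hb₃
    have k3 := mulT _ _ ha₃ hb₁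
    have k4 : |ε ^ 2 * (a₃ * b₃)| ≤ T ^ 2 := by
      rw [abs_mul, abs_of_nonneg (by positivity : (0 : ℝ) ≤ ε ^ 2)]
      exact (mul_le_of_le_one_left (abs_nonneg _) hε2).trans (mulT _ _ ha₃ hb₃)
    rw [abs_le] at k1 k2 k3 k4 ⊢
    constructor <;> linarith
  rw [abs_le] at h1 h2 h3 ⊢
  constructor <;> nlinarith

/-- The scalar coefficients of the expansion of `ℓ (exp (ε² b ± ε c))` and their bounds. The
coefficient `a₃` of order three does not enter the even parts, so only its size matters. -/
theorem scalar_expansion {𝔸 : Type*} [NormedRing 𝔸] [NormedAlgebra ℝ 𝔸] [CompleteSpace 𝔸]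
    [NormOneClass 𝔸] {b c : 𝔸} {M N ε C : ℝ} (hM1 : 1 ≤ M)
    (hp : ∀ t ∈ Set.Icc (0 : ℝ) 1, ‖NormedSpace.exp (t • (ε ^ 2 • b + ε • c))‖ ≤ M)
    (hm : ∀ t ∈ Set.Icc (0 : ℝ) 1, ‖NormedSpace.exp (t • (ε ^ 2 • b + ε • -c))‖ ≤ M)
    (hN : 1 ≤ N) (hb : ‖b‖ ≤ N) (hc : ‖c‖ ≤ N) (hε : 0 ≤ ε) (hε1 : ε ≤ 1)
    (ℓ : 𝔸 →ₗ[ℝ] ℝ) (hC : 0 ≤ C) (hℓ : ∀ X, |ℓ X| ≤ C * ‖X‖) :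
    ∃ a₃ : ℝ, |ℓ (NormedSpace.exp (ε ^ 2 • b + ε • c)) - (ℓ 1 + ε * ℓ c
        + ε ^ 2 * (ℓ b + 1 / 2 * ℓ (c * c)) + ε ^ 3 * a₃)| ≤ ε ^ 4 * (C * (18 * M * N ^ 4)) ∧
      |ℓ (NormedSpace.exp (ε ^ 2 • b + ε • -c)) - (ℓ 1 - ε * ℓ c
        + ε ^ 2 * (ℓ b + 1 / 2 * ℓ (c * c)) - ε ^ 3 * a₃)| ≤ ε ^ 4 * (C * (18 * M * N ^ 4)) ∧
      |ℓ 1| ≤ C * (18 * M * N ^ 4) ∧ |ℓ c| ≤ C * (18 * M * N ^ 4) ∧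
      |ℓ b + 1 / 2 * ℓ (c * c)| ≤ C * (18 * M * N ^ 4) ∧ |a₃| ≤ C * (18 * M * N ^ 4) := by
  have hN0 : 0 ≤ N := by linarith
  have hN4 : 1 ≤ N ^ 4 := one_le_pow₀ hN
  have hNN4 : N ≤ N ^ 4 := le_self_pow₀ hN (by norm_num)
  have hN24 : N * N ≤ N ^ 4 := by
    calc N * N = N ^ 2 := by ring
      _ ≤ N ^ 4 := pow_le_pow_right₀ hN (by norm_num)
  have hN34 : N * N * N ≤ N ^ 4 := by
    calc N * N * N = N ^ 3 := by ring
      _ ≤ N ^ 4 := pow_le_pow_right₀ hN (by norm_num)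
  have hMN : N ^ 4 ≤ M * N ^ 4 := le_mul_of_one_le_left (by positivity) hM1
  have hbound (X : 𝔸) (hX : ‖X‖ ≤ 18 * N ^ 4) : |ℓ X| ≤ C * (18 * M * N ^ 4) := by
    refine (hℓ X).trans ?_
    gcongr
    linarith
  have hbc : ‖b * c‖ ≤ N * N := norm_mul_le_of_le hb hc
  have hcb : ‖c * b‖ ≤ N * N := norm_mul_le_of_le hc hb
  have hcc : ‖c * c‖ ≤ N * N := norm_mul_le_of_le hc hc
  have hccc : ‖c * c * c‖ ≤ N * N * N := norm_mul_le_of_le hcc hc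
  have half (r : ℝ) (hr : 0 ≤ r) (hr1 : r ≤ 1) (X : 𝔸) : ‖r • X‖ ≤ ‖X‖ := by
    rw [norm_smul, Real.norm_of_nonneg hr]
    exact mul_le_of_le_one_left (norm_nonneg _) hr1
  have e1 := norm_exp_expansion_le hM1 hp hN hb hc hε hε1
  have e2 := norm_exp_expansion_le hM1 hm hN hb (by rwa [norm_neg]) hε hε1
  refine ⟨ℓ ((1 / 2 : ℝ) • (b * c + c * b) + (1 / 6 : ℝ) • (c * c * c)), ?_, ?_, ?_, ?_, ?_, ?_⟩
  · calc _ = |ℓ (NormedSpace.exp (ε ^ 2 • b + ε • c) - (1 + ε • c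
          + ε ^ 2 • (b + (1 / 2 : ℝ) • (c * c)) + ε ^ 3 • ((1 / 2 : ℝ) • (b * c + c * b)
          + (1 / 6 : ℝ) • (c * c * c))))| := by
          simp only [map_sub, map_add, map_smul, smul_eq_mul]
      _ ≤ C * (ε ^ 4 * (18 * M * N ^ 4)) := (hℓ _).trans (by gcongr)
      _ = _ := by ring
  · calc _ = |ℓ (NormedSpace.exp (ε ^ 2 • b + ε • -c) - (1 + ε • -c
          + ε ^ 2 • (b + (1 / 2 : ℝ) • (-c * -c)) + ε ^ 3 • ((1 / 2 : ℝ) • (b * -c + -c * b)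
          + (1 / 6 : ℝ) • (-c * -c * -c))))| := by
          simp only [map_sub, map_add, map_smul, smul_eq_mul, map_neg, neg_mul, mul_neg, neg_neg,
            smul_neg]
          congr 1
          ring
      _ ≤ C * (ε ^ 4 * (18 * M * N ^ 4)) := (hℓ _).trans (by gcongr)
      _ = _ := by ring
  · exact hbound _ (by rw [norm_one]; linarith)
  · exact hbound _ (by linarith)
  · have := hbound (b + (1 / 2 : ℝ) • (c * c)) (by
      refine (norm_add_le _ _).trans ?_
      linarith [half (1 / 2) (by norm_num) (by norm_num) (c * c)])
    simpa only [map_add, map_smul, smul_eq_mul] using this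
  · refine hbound _ ((norm_add_le _ _).trans ?_)
    linarith [half (1 / 2) (by norm_num) (by norm_num) (b * c + c * b),
      half (1 / 6) (by norm_num) (by norm_num) (c * c * c), norm_add_le (b * c) (c * b)]

/-! ### Averages over the Gaussian increment -/

theorem continuous_hat : Continuous hat := by
  refine continuous_matrix fun i j => ?_
  fin_cases i <;> fin_cases j <;> simp [hat] <;> fun_prop

theorem hat_mulVec_eq_sum (Hu : Mat3) (g : Fin 3 → ℝ) :
    hat (Hu *ᵥ g) = ∑ m, g m • hat (Hu *ᵥ Pi.single m 1) := by
  ext i j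
  fin_cases i <;> fin_cases j <;>
    simp [hat, Fin.sum_univ_three, Matrix.mulVec, dotProduct] <;> ring

/-- The matrix `E[ĉ²] = G - tr(G) I`, where `c = H g` with `g` standard Gaussian and `G = H Hᵀ`; half
of it is the Itô correction to the drift. -/
def noiseGenerator (Hu : Mat3) : Mat3 := Hu * Huᵀ - (Hu * Huᵀ).trace • (1 : Mat3)

theorem sum_hat_sq (Hu : Mat3) :
    ∑ m, hat (Hu *ᵥ Pi.single m 1) * hat (Hu *ᵥ Pi.single m 1) = noiseGenerator Hu := by
  ext i j
  simp only [noiseGenerator, Matrix.trace_fin_three, Fin.sum_univ_three, Matrix.mulVec_single_one,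
    Matrix.add_apply, Matrix.sub_apply, Matrix.smul_apply, Matrix.mul_apply, Matrix.transpose_apply]
  fin_cases i <;> fin_cases j <;> simp [hat] <;> ring

theorem integral_stdGauss_linear_hat_sq (Hu : Mat3) (ℓ : Mat3 →ₗ[ℝ] ℝ) :
    ∫ g, ℓ (hat (Hu *ᵥ g) * hat (Hu *ᵥ g)) ∂stdGauss 3 = ℓ (noiseGenerator Hu) := by
  have e (g : Fin 3 → ℝ) : ℓ (hat (Hu *ᵥ g) * hat (Hu *ᵥ g)) = ∑ i, ∑ j,
      ℓ (hat (Hu *ᵥ Pi.single i 1) * hat (Hu *ᵥ Pi.single j 1)) * (g i * g j) := by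
    rw [hat_mulVec_eq_sum, Finset.sum_mul_sum, map_sum]
    refine Finset.sum_congr rfl fun i _ => ?_
    rw [map_sum]
    refine Finset.sum_congr rfl fun j _ => ?_
    rw [Matrix.smul_mul, Matrix.mul_smul, smul_smul, map_smul, smul_eq_mul, mul_comm]
  simp_rw [e]
  rw [integral_stdGauss_quadratic (fun i j =>
    ℓ (hat (Hu *ᵥ Pi.single i 1) * hat (Hu *ᵥ Pi.single j 1))), ← map_sum, sum_hat_sq]

theorem integral_stdGauss_linear_hat_mul (Hu : Mat3) (ℓ₁ ℓ₂ : Mat3 →ₗ[ℝ] ℝ) :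
    ∫ g, ℓ₁ (hat (Hu *ᵥ g)) * ℓ₂ (hat (Hu *ᵥ g)) ∂stdGauss 3
      = ∑ m, ℓ₁ (hat (Hu *ᵥ Pi.single m 1)) * ℓ₂ (hat (Hu *ᵥ Pi.single m 1)) := by
  have e (g : Fin 3 → ℝ) : ℓ₁ (hat (Hu *ᵥ g)) * ℓ₂ (hat (Hu *ᵥ g)) = ∑ i, ∑ j,
      ℓ₁ (hat (Hu *ᵥ Pi.single i 1)) * ℓ₂ (hat (Hu *ᵥ Pi.single j 1)) * (g i * g j) := by
    rw [hat_mulVec_eq_sum, map_sum, map_sum, Finset.sum_mul_sum]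
    refine Finset.sum_congr rfl fun i _ => Finset.sum_congr rfl fun j _ => ?_
    rw [map_smul, map_smul, smul_eq_mul, smul_eq_mul]
    ring
  rw [integral_congr_ae (ae_of_all _ e), integral_stdGauss_quadratic (fun i j =>
    ℓ₁ (hat (Hu *ᵥ Pi.single i 1)) * ℓ₂ (hat (Hu *ᵥ Pi.single j 1)))]

section Norms

open scoped Matrix.Norms.Operator

/-- The norm on matrices is the operator norm for the sup norm on vectors. -/
theorem norm_le_of_entries {A : Mat3} {r : ℝ} (hA : ∀ i j, |A i j| ≤ r) : ‖A‖ ≤ 3 * r := by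
  have hr : 0 ≤ r := (abs_nonneg _).trans (hA 0 0)
  lift r to NNReal using hr
  rw [Matrix.linfty_opNorm_def]
  have : (Finset.univ.sup fun i => ∑ j, ‖A i j‖₊) ≤ 3 * r := by
    refine Finset.sup_le fun i _ => ?_
    refine (Finset.sum_le_card_nsmul Finset.univ _ r fun j _ => ?_).trans ?_
    · exact hA i j
    · simp
  exact_mod_cast this

theorem abs_entry_le_norm (A : Mat3) (i j : Fin 3) : |A i j| ≤ ‖A‖ := by
  rw [Matrix.linfty_opNorm_def]
  have h1 : ‖A i j‖₊ ≤ ∑ j, ‖A i j‖₊ :=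
    Finset.single_le_sum (f := fun j => ‖A i j‖₊) (fun _ _ => bot_le) (Finset.mem_univ j)
  have h2 := h1.trans (Finset.le_sup (f := fun i => ∑ j, ‖A i j‖₊) (Finset.mem_univ i))
  exact_mod_cast h2

theorem norm_exp_hat_le (v : Fin 3 → ℝ) : ‖NormedSpace.exp (hat v)‖ ≤ 3 := by
  simpa using norm_le_of_entries (abs_entry_le_one (exp_hat_mul_transpose v))

theorem norm_hat_le (v : Fin 3 → ℝ) : ‖hat v‖ ≤ 3 * ‖v‖ := by
  refine norm_le_of_entries fun i j => ?_
  have h (i : Fin 3) : |v i| ≤ ‖v‖ := norm_le_pi_norm v i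
  fin_cases i <;> fin_cases j <;> simp [hat, h]

/-- The expansion of a functional of the rotation increment for two opposite values of the noise. -/
theorem exists_increment_expansion (Hu : Mat3) : ∃ K, 0 ≤ K ∧
    ∀ (v g : Fin 3 → ℝ) (ε : ℝ), 0 ≤ ε → ε ≤ 1 →
    ∀ (ℓ : Mat3 →ₗ[ℝ] ℝ) (C : ℝ), 0 ≤ C → (∀ X, |ℓ X| ≤ C * ‖X‖) →
    ∃ a₃ : ℝ, |ℓ (NormedSpace.exp (ε ^ 2 • hat v + hat (Hu *ᵥ (ε • g))))
        - (ℓ 1 + ε * ℓ (hat (Hu *ᵥ g))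
        + ε ^ 2 * (ℓ (hat v) + 1 / 2 * ℓ (hat (Hu *ᵥ g) * hat (Hu *ᵥ g))) + ε ^ 3 * a₃)|
          ≤ ε ^ 4 * (C * (K * ((1 + ‖v‖) ^ 4 * (1 + ‖g‖) ^ 4))) ∧
      |ℓ (NormedSpace.exp (ε ^ 2 • hat v + hat (Hu *ᵥ (ε • -g))))
        - (ℓ 1 - ε * ℓ (hat (Hu *ᵥ g))
        + ε ^ 2 * (ℓ (hat v) + 1 / 2 * ℓ (hat (Hu *ᵥ g) * hat (Hu *ᵥ g))) - ε ^ 3 * a₃)|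
          ≤ ε ^ 4 * (C * (K * ((1 + ‖v‖) ^ 4 * (1 + ‖g‖) ^ 4))) ∧
      |ℓ 1| ≤ C * (K * ((1 + ‖v‖) ^ 4 * (1 + ‖g‖) ^ 4)) ∧
      |ℓ (hat (Hu *ᵥ g))| ≤ C * (K * ((1 + ‖v‖) ^ 4 * (1 + ‖g‖) ^ 4)) ∧
      |ℓ (hat v) + 1 / 2 * ℓ (hat (Hu *ᵥ g) * hat (Hu *ᵥ g))|
        ≤ C * (K * ((1 + ‖v‖) ^ 4 * (1 + ‖g‖) ^ 4)) ∧
      |a₃| ≤ C * (K * ((1 + ‖v‖) ^ 4 * (1 + ‖g‖) ^ 4)) := by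
  obtain ⟨K, hK, hKg⟩ := exists_norm_mulVec_le Hu
  refine ⟨18 * 3 * (3 + 3 * K) ^ 4, by positivity, fun v g ε hε hε1 ℓ C hC hℓ => ?_⟩
  set N : ℝ := (3 + 3 * K) * ((1 + ‖v‖) * (1 + ‖g‖)) with hN
  have hv := norm_nonneg v
  have hg := norm_nonneg g
  have h0 : 1 ≤ (1 + ‖v‖) * (1 + ‖g‖) := by nlinarith [mul_nonneg hv hg]
  have hN1 : 1 ≤ N := by nlinarith
  have hb : ‖hat v‖ ≤ N := by
    refine (norm_hat_le v).trans ?_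
    nlinarith [mul_nonneg hv hg, mul_nonneg hK (zero_le_one.trans h0)]
  have hc : ‖hat (Hu *ᵥ g)‖ ≤ N := by
    refine (norm_hat_le _).trans ?_
    have := hKg g
    nlinarith [mul_nonneg hv hg, mul_nonneg hK (mul_nonneg hv hg), mul_nonneg hK hv,
      mul_nonneg hK hg]
  have hexp (c : Fin 3 → ℝ) (t : ℝ) :
      ‖NormedSpace.exp (t • (ε ^ 2 • hat v + ε • hat c))‖ ≤ 3 := by
    rw [← hat_smul, ← hat_smul, ← hat_add, ← hat_smul]
    exact norm_exp_hat_le _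
  have key := scalar_expansion (b := hat v) (c := hat (Hu *ᵥ g)) (M := 3) (N := N) (ε := ε) (C := C)
    (by norm_num) (fun t _ => hexp _ t) (fun t _ => by rw [← hat_neg]; exact hexp _ t) hN1 hb hc
    hε hε1 ℓ hC hℓ
  have e1 : hat (Hu *ᵥ (ε • g)) = ε • hat (Hu *ᵥ g) := by rw [Matrix.mulVec_smul, hat_smul]
  have e2 : hat (Hu *ᵥ (ε • -g)) = ε • -hat (Hu *ᵥ g) := by
    rw [Matrix.mulVec_smul, hat_smul, Matrix.mulVec_neg, hat_neg]
  have e3 : 18 * 3 * N ^ 4 = 18 * 3 * (3 + 3 * K) ^ 4 * ((1 + ‖v‖) ^ 4 * (1 + ‖g‖) ^ 4) := by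
    rw [hN]; ring
  rw [e1, e2, ← e3]
  exact key

theorem continuous_exp_mat : Continuous fun A : Mat3 => NormedSpace.exp A :=
  NormedSpace.exp_continuous

theorem integral_wienerIncrement {h : ℝ} (hh : 0 ≤ h) (f : (Fin 3 → ℝ) → ℝ) (hf : Continuous f) :
    ∫ w, f w ∂wienerIncrement h = ∫ g, f (Real.sqrt h • g) ∂stdGauss 3 := by
  rw [wienerIncrement_eq_map hh, integral_map (by fun_prop) hf.aestronglyMeasurable]

/-- Averaging an even part over a symmetric distribution. -/
theorem abs_integral_sub_le_of_even_part {f m : (Fin 3 → ℝ) → ℝ} {D : ℝ} {k : ℕ}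
    (hf : Integrable f (stdGauss 3)) (hm : Integrable m (stdGauss 3))
    (hb : ∀ g, |(f g + f (-g)) / 2 - m g| ≤ D * (1 + ‖g‖) ^ k) :
    |∫ g, f g ∂stdGauss 3 - ∫ g, m g ∂stdGauss 3| ≤ D * ∫ g, (1 + ‖g‖) ^ k ∂stdGauss 3 := by
  have hf' : Integrable (fun g => f (-g)) (stdGauss 3) := by
    have h : MeasurePreserving (fun g : Fin 3 → ℝ => -g) (stdGauss 3) (stdGauss 3) :=
      ⟨measurable_neg, stdGauss_map_neg 3⟩
    exact h.integrable_comp_of_integrable hf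
  have e : ∫ g, f g ∂stdGauss 3 = ∫ g, (f g + f (-g)) / 2 ∂stdGauss 3 := by
    rw [integral_div, integral_add hf hf', integral_stdGauss_neg]
    ring
  have hi : Integrable (fun g => (f g + f (-g)) / 2) (stdGauss 3) := (hf.add hf').div_const 2
  rw [e, ← integral_sub hi hm, ← integral_const_mul]
  exact norm_integral_le_of_norm_le (f := fun g => (f g + f (-g)) / 2 - m g)
    ((integrable_norm_pow_stdGauss 3 k).const_mul D) (ae_of_all _ fun g => hb g)

end Norms

/-! ### Expansion of the random rotation increment -/

section Norms

open scoped Matrix.Norms.Operator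

theorem continuous_increment (Hu : Mat3) (v : Fin 3 → ℝ) (h : ℝ) (ℓ : Mat3 →ₗ[ℝ] ℝ) :
    Continuous fun w : Fin 3 → ℝ => ℓ (NormedSpace.exp (h • hat v + hat (Hu *ᵥ w))) :=
  (LinearMap.continuous_of_finiteDimensional ℓ).comp (continuous_exp_mat.comp
    (continuous_const.add (continuous_hat.comp (continuous_const.matrix_mulVec continuous_id))))

theorem abs_increment_le (Hu : Mat3) (v w : Fin 3 → ℝ) (h : ℝ) {ℓ : Mat3 →ₗ[ℝ] ℝ} {C : ℝ}
    (hC : 0 ≤ C) (hℓ : ∀ X, |ℓ X| ≤ C * ‖X‖) :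
    |ℓ (NormedSpace.exp (h • hat v + hat (Hu *ᵥ w)))| ≤ 3 * C := by
  rw [← hat_smul, ← hat_add]
  refine (hℓ _).trans ?_
  rw [mul_comm 3]
  exact mul_le_mul_of_nonneg_left (norm_exp_hat_le _) hC

theorem continuous_hat_sq (Hu : Mat3) (ℓ : Mat3 →ₗ[ℝ] ℝ) :
    Continuous fun g : Fin 3 → ℝ => ℓ (hat (Hu *ᵥ g) * hat (Hu *ᵥ g)) := by
  have h : Continuous fun g : Fin 3 → ℝ => hat (Hu *ᵥ g) :=
    continuous_hat.comp (continuous_const.matrix_mulVec continuous_id)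
  exact (LinearMap.continuous_of_finiteDimensional ℓ).comp (h.matrix_mul h)

theorem integrable_hat_sq (Hu : Mat3) {ℓ : Mat3 →ₗ[ℝ] ℝ} {C : ℝ}
    (hC : 0 ≤ C) (hℓ : ∀ X, |ℓ X| ≤ C * ‖X‖) :
    Integrable (fun g : Fin 3 → ℝ => ℓ (hat (Hu *ᵥ g) * hat (Hu *ᵥ g))) (stdGauss 3) := by
  obtain ⟨K, hK, hKg⟩ := exists_norm_mulVec_le Hu
  refine integrable_stdGauss_of_growth (continuous_hat_sq Hu ℓ) (C * (3 * K) ^ 2) 2 fun g => ?_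
  have h1 : ‖hat (Hu *ᵥ g)‖ ≤ 3 * K * (1 + ‖g‖) := by
    refine (norm_hat_le _).trans ?_
    nlinarith [hKg g, norm_nonneg g]
  calc _ ≤ C * ‖hat (Hu *ᵥ g) * hat (Hu *ᵥ g)‖ := hℓ _
    _ ≤ C * ((3 * K * (1 + ‖g‖)) * (3 * K * (1 + ‖g‖))) := by
        gcongr; exact norm_mul_le_of_le h1 h1
    _ = _ := by ring

theorem integrable_hat_mul (Hu : Mat3) {ℓ₁ ℓ₂ : Mat3 →ₗ[ℝ] ℝ} {C : ℝ}
    (hC : 0 ≤ C) (h₁ : ∀ X, |ℓ₁ X| ≤ C * ‖X‖) (h₂ : ∀ X, |ℓ₂ X| ≤ C * ‖X‖) :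
    Integrable (fun g : Fin 3 → ℝ => ℓ₁ (hat (Hu *ᵥ g)) * ℓ₂ (hat (Hu *ᵥ g))) (stdGauss 3) := by
  obtain ⟨K, hK, hKg⟩ := exists_norm_mulVec_le Hu
  have h : Continuous fun g : Fin 3 → ℝ => hat (Hu *ᵥ g) :=
    continuous_hat.comp (continuous_const.matrix_mulVec continuous_id)
  refine integrable_stdGauss_of_growth
    (((LinearMap.continuous_of_finiteDimensional ℓ₁).comp h).mul
      ((LinearMap.continuous_of_finiteDimensional ℓ₂).comp h)) ((C * (3 * K)) ^ 2) 2 fun g => ?_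
  have hn : ‖hat (Hu *ᵥ g)‖ ≤ 3 * K * (1 + ‖g‖) := by
    refine (norm_hat_le _).trans ?_
    nlinarith [hKg g, norm_nonneg g]
  have k1 := (h₁ (hat (Hu *ᵥ g))).trans (mul_le_mul_of_nonneg_left hn hC)
  have k2 := (h₂ (hat (Hu *ᵥ g))).trans (mul_le_mul_of_nonneg_left hn hC)
  rw [abs_mul]
  refine (mul_le_mul k1 k2 (abs_nonneg _) (by positivity)).trans (le_of_eq ?_)
  ring

theorem integral_stdGauss_drift (Hu : Mat3) (v : Fin 3 → ℝ) {ℓ : Mat3 →ₗ[ℝ] ℝ} {C : ℝ}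
    (hC : 0 ≤ C) (hℓ : ∀ X, |ℓ X| ≤ C * ‖X‖) :
    ∫ g, (ℓ (hat v) + 1 / 2 * ℓ (hat (Hu *ᵥ g) * hat (Hu *ᵥ g))) ∂stdGauss 3
      = ℓ (hat v) + 1 / 2 * ℓ (noiseGenerator Hu) := by
  rw [integral_add (integrable_const _) ((integrable_hat_sq Hu hC hℓ).const_mul _),
    integral_const_mul, integral_stdGauss_linear_hat_sq]
  simp

/-- First order expansion in `h` of the mean of the random rotation increment. -/
theorem exists_integral_increment_expansion (Hu : Mat3) : ∃ K, 0 ≤ K ∧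
    ∀ (v : Fin 3 → ℝ) (h : ℝ), 0 ≤ h → h ≤ 1 →
    ∀ (ℓ : Mat3 →ₗ[ℝ] ℝ) (C : ℝ), 0 ≤ C → (∀ X, |ℓ X| ≤ C * ‖X‖) →
    |∫ w, ℓ (NormedSpace.exp (h • hat v + hat (Hu *ᵥ w))) ∂wienerIncrement h
      - (ℓ 1 + h * (ℓ (hat v) + 1 / 2 * ℓ (noiseGenerator Hu)))|
      ≤ C * K * h ^ 2 * (1 + ‖v‖) ^ 4 := by
  obtain ⟨K, hK, hexp⟩ := exists_increment_expansion Hu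
  refine ⟨K * ∫ g, (1 + ‖g‖) ^ 4 ∂stdGauss 3, mul_nonneg hK
    (integral_nonneg fun g => by positivity), fun v h hh hh1 ℓ C hC hℓ => ?_⟩
  have hs : Real.sqrt h ^ 2 = h := Real.sq_sqrt hh
  have hs4 : Real.sqrt h ^ 4 = h ^ 2 := by
    calc Real.sqrt h ^ 4 = (Real.sqrt h ^ 2) ^ 2 := by ring
      _ = h ^ 2 := by rw [hs]
  have hs1 : Real.sqrt h ≤ 1 := Real.sqrt_le_one.2 hh1
  have hcont := continuous_increment Hu v h ℓ
  have hsq := integrable_hat_sq Hu hC hℓ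
  have i₁ : Integrable (fun g => ℓ (hat v) + 1 / 2 * ℓ (hat (Hu *ᵥ g) * hat (Hu *ᵥ g)))
      (stdGauss 3) := (integrable_const _).add (hsq.const_mul _)
  have hm : Integrable (fun g => ℓ 1 + h * (ℓ (hat v) + 1 / 2 * ℓ (hat (Hu *ᵥ g) * hat (Hu *ᵥ g))))
      (stdGauss 3) := (integrable_const _).add (i₁.const_mul h)
  have hmi : ∫ g, (ℓ 1 + h * (ℓ (hat v) + 1 / 2 * ℓ (hat (Hu *ᵥ g) * hat (Hu *ᵥ g)))) ∂stdGauss 3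
      = ℓ 1 + h * (ℓ (hat v) + 1 / 2 * ℓ (noiseGenerator Hu)) := by
    rw [integral_add (integrable_const _) (i₁.const_mul h), integral_const_mul,
      integral_stdGauss_drift Hu v hC hℓ]
    simp
  rw [integral_wienerIncrement hh _ hcont, ← hmi]
  refine (abs_integral_sub_le_of_even_part (D := h ^ 2 * (C * (K * (1 + ‖v‖) ^ 4))) (k := 4)
    ?_ hm fun g => ?_).trans (le_of_eq (by ring))
  · exact integrable_stdGauss_of_growth (hcont.comp (continuous_const_smul _)) (3 * C) 0 fun g => by
      simpa using abs_increment_le Hu v (Real.sqrt h • g) h hC hℓ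
  · obtain ⟨a₃, h1, h2, -⟩ := hexp v g _ (Real.sqrt_nonneg h) hs1 ℓ C hC hℓ
    rw [hs4] at h1 h2
    have := abs_even_part_le (ε := Real.sqrt h) (by rw [hs4]; exact h1) (by rw [hs4]; exact h2)
    rw [hs, hs4] at this
    refine this.trans (le_of_eq (by ring))

/-- First order expansion in `h` of the second moments of the random rotation increment. -/
theorem exists_integral_increment_mul_expansion (Hu : Mat3) : ∃ K, 0 ≤ K ∧
    ∀ (v : Fin 3 → ℝ) (h : ℝ), 0 ≤ h → h ≤ 1 →
    ∀ (ℓ₁ ℓ₂ : Mat3 →ₗ[ℝ] ℝ) (C : ℝ), 0 ≤ C → (∀ X, |ℓ₁ X| ≤ C * ‖X‖) →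
    (∀ X, |ℓ₂ X| ≤ C * ‖X‖) →
    |∫ w, ℓ₁ (NormedSpace.exp (h • hat v + hat (Hu *ᵥ w)))
        * ℓ₂ (NormedSpace.exp (h • hat v + hat (Hu *ᵥ w))) ∂wienerIncrement h
      - (ℓ₁ 1 * ℓ₂ 1 + h * (ℓ₁ 1 * (ℓ₂ (hat v) + 1 / 2 * ℓ₂ (noiseGenerator Hu))
        + (ℓ₁ (hat v) + 1 / 2 * ℓ₁ (noiseGenerator Hu)) * ℓ₂ 1
        + ∑ m, ℓ₁ (hat (Hu *ᵥ Pi.single m 1)) * ℓ₂ (hat (Hu *ᵥ Pi.single m 1))))|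
      ≤ C ^ 2 * K * h ^ 2 * (1 + ‖v‖) ^ 8 := by
  obtain ⟨K, hK, hexp⟩ := exists_increment_expansion Hu
  refine ⟨14 * K ^ 2 * ∫ g, (1 + ‖g‖) ^ 8 ∂stdGauss 3, mul_nonneg (by positivity)
    (integral_nonneg fun g => by positivity), fun v h hh hh1 ℓ₁ ℓ₂ C hC hℓ₁ hℓ₂ => ?_⟩
  have hs : Real.sqrt h ^ 2 = h := Real.sq_sqrt hh
  have hs4 : Real.sqrt h ^ 4 = h ^ 2 := by
    calc Real.sqrt h ^ 4 = (Real.sqrt h ^ 2) ^ 2 := by ring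
      _ = h ^ 2 := by rw [hs]
  have hs1 : Real.sqrt h ≤ 1 := Real.sqrt_le_one.2 hh1
  have hcont : Continuous fun w : Fin 3 → ℝ => ℓ₁ (NormedSpace.exp (h • hat v + hat (Hu *ᵥ w)))
      * ℓ₂ (NormedSpace.exp (h • hat v + hat (Hu *ᵥ w))) :=
    (continuous_increment Hu v h ℓ₁).mul (continuous_increment Hu v h ℓ₂)
  have hsq₁ := integrable_hat_sq Hu hC hℓ₁
  have hsq₂ := integrable_hat_sq Hu hC hℓ₂
  have hmul := integrable_hat_mul Hu hC hℓ₁ hℓ₂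
  have i₁ : Integrable (fun g => ℓ₁ 1 * (ℓ₂ (hat v) + 1 / 2 * ℓ₂ (hat (Hu *ᵥ g) * hat (Hu *ᵥ g))))
      (stdGauss 3) := ((integrable_const _).add (hsq₂.const_mul _)).const_mul _
  have i₂ : Integrable (fun g => (ℓ₁ (hat v) + 1 / 2 * ℓ₁ (hat (Hu *ᵥ g) * hat (Hu *ᵥ g))) * ℓ₂ 1)
      (stdGauss 3) := ((integrable_const _).add (hsq₁.const_mul _)).mul_const _
  have i₁₂ : Integrable (fun g =>
      ℓ₁ 1 * (ℓ₂ (hat v) + 1 / 2 * ℓ₂ (hat (Hu *ᵥ g) * hat (Hu *ᵥ g)))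
      + (ℓ₁ (hat v) + 1 / 2 * ℓ₁ (hat (Hu *ᵥ g) * hat (Hu *ᵥ g))) * ℓ₂ 1) (stdGauss 3) := i₁.add i₂
  have i₃ : Integrable (fun g => h *
      (ℓ₁ 1 * (ℓ₂ (hat v) + 1 / 2 * ℓ₂ (hat (Hu *ᵥ g) * hat (Hu *ᵥ g)))
      + (ℓ₁ (hat v) + 1 / 2 * ℓ₁ (hat (Hu *ᵥ g) * hat (Hu *ᵥ g))) * ℓ₂ 1
      + ℓ₁ (hat (Hu *ᵥ g)) * ℓ₂ (hat (Hu *ᵥ g)))) (stdGauss 3) := (i₁₂.add hmul).const_mul h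
  have hm : Integrable (fun g => ℓ₁ 1 * ℓ₂ 1 + h *
      (ℓ₁ 1 * (ℓ₂ (hat v) + 1 / 2 * ℓ₂ (hat (Hu *ᵥ g) * hat (Hu *ᵥ g)))
      + (ℓ₁ (hat v) + 1 / 2 * ℓ₁ (hat (Hu *ᵥ g) * hat (Hu *ᵥ g))) * ℓ₂ 1
      + ℓ₁ (hat (Hu *ᵥ g)) * ℓ₂ (hat (Hu *ᵥ g)))) (stdGauss 3) := (integrable_const _).add i₃
  have hmi : ∫ g, (ℓ₁ 1 * ℓ₂ 1 + h *
      (ℓ₁ 1 * (ℓ₂ (hat v) + 1 / 2 * ℓ₂ (hat (Hu *ᵥ g) * hat (Hu *ᵥ g)))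
      + (ℓ₁ (hat v) + 1 / 2 * ℓ₁ (hat (Hu *ᵥ g) * hat (Hu *ᵥ g))) * ℓ₂ 1
      + ℓ₁ (hat (Hu *ᵥ g)) * ℓ₂ (hat (Hu *ᵥ g)))) ∂stdGauss 3
      = ℓ₁ 1 * ℓ₂ 1 + h * (ℓ₁ 1 * (ℓ₂ (hat v) + 1 / 2 * ℓ₂ (noiseGenerator Hu))
        + (ℓ₁ (hat v) + 1 / 2 * ℓ₁ (noiseGenerator Hu)) * ℓ₂ 1
        + ∑ m, ℓ₁ (hat (Hu *ᵥ Pi.single m 1)) * ℓ₂ (hat (Hu *ᵥ Pi.single m 1))) := by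
    rw [integral_add (integrable_const _) i₃, integral_const_mul h, integral_add i₁₂ hmul,
      integral_add i₁ i₂, integral_const_mul (ℓ₁ 1)
        (fun g => ℓ₂ (hat v) + 1 / 2 * ℓ₂ (hat (Hu *ᵥ g) * hat (Hu *ᵥ g))),
      integral_mul_const (ℓ₂ 1)
        (fun g => ℓ₁ (hat v) + 1 / 2 * ℓ₁ (hat (Hu *ᵥ g) * hat (Hu *ᵥ g))),
      integral_stdGauss_drift Hu v hC hℓ₁, integral_stdGauss_drift Hu v hC hℓ₂,
      integral_stdGauss_linear_hat_mul]
    simp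
  rw [integral_wienerIncrement hh _ hcont, ← hmi]
  refine (abs_integral_sub_le_of_even_part
    (D := h ^ 2 * (14 * (C * (K * (1 + ‖v‖) ^ 4)) ^ 2)) (k := 8)
    ?_ hm fun g => ?_).trans (le_of_eq (by ring))
  · refine integrable_stdGauss_of_growth (hcont.comp (continuous_const_smul _))
      ((3 * C) * (3 * C)) 0 fun g => ?_
    rw [pow_zero, mul_one]
    refine (abs_mul _ _).trans_le ?_
    exact mul_le_mul (abs_increment_le Hu v _ h hC hℓ₁) (abs_increment_le Hu v _ h hC hℓ₂)
      (abs_nonneg _) (by positivity)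
  · obtain ⟨a₃, h1, h2, h3, h4, h5, h6⟩ := hexp v g _ (Real.sqrt_nonneg h) hs1 ℓ₁ C hC hℓ₁
    obtain ⟨b₃, k1, k2, k3, k4, k5, k6⟩ := hexp v g _ (Real.sqrt_nonneg h) hs1 ℓ₂ C hC hℓ₂
    have := abs_even_part_mul_le (Real.sqrt_nonneg h) hs1 h1 h2 k1 k2 h3 h4 h5 h6 k3 k4 k5 k6
    rw [hs, hs4] at this
    refine this.trans (le_of_eq (by ring))

end Norms

/-! ### Expansion around the deterministic increment -/

theorem abs_mul_le_of_le {a b A B : ℝ} (ha : |a| ≤ A) (hb : |b| ≤ B) : |a * b| ≤ A * B := by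
  rw [abs_mul]
  exact mul_le_mul ha hb (abs_nonneg _) ((abs_nonneg _).trans ha)

/-- Replacing the first order data `(uᵢ + h aᵢ, dᵢ, cᵢ)` of a product expansion by data
`(eᵢ, dᵢ', cᵢ')` that agree with them to the relevant order changes it by `O(h²)`. -/
theorem abs_mul_model_sub_le {h T u₁ u₂ a₁ a₂ e₁ e₂ d₁ d₂ d₁' d₂' : ℝ} {c₁ c₂ c₁' c₂' : Fin 3 → ℝ}
    (hh : 0 ≤ h) (hh1 : h ≤ 1) (hu₁ : |u₁| ≤ T) (hu₂ : |u₂| ≤ T) (ha₁ : |a₁| ≤ T) (ha₂ : |a₂| ≤ T)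
    (he₁ : |e₁| ≤ T) (he₂ : |e₂| ≤ T) (hd₁ : |d₁| ≤ T) (hd₂ : |d₂| ≤ T)
    (hc₁ : ∀ m, |c₁ m| ≤ T) (hc₂' : ∀ m, |c₂' m| ≤ T)
    (hr₁ : |e₁ - u₁ - h * a₁| ≤ h ^ 2 * T) (hr₂ : |e₂ - u₂ - h * a₂| ≤ h ^ 2 * T)
    (hq₁ : |e₁ - u₁| ≤ h * T) (hq₂ : |e₂ - u₂| ≤ h * T)
    (hdd₁ : |d₁' - d₁| ≤ h * T) (hdd₂ : |d₂' - d₂| ≤ h * T)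
    (hcc₁ : ∀ m, |c₁' m - c₁ m| ≤ h * T) (hcc₂ : ∀ m, |c₂' m - c₂ m| ≤ h * T) :
    |(u₁ * u₂ + h * (u₁ * (a₂ + d₂) + (a₁ + d₁) * u₂ + ∑ m, c₁ m * c₂ m))
      - (e₁ * e₂ + h * (e₁ * d₂' + d₁' * e₂ + ∑ m, c₁' m * c₂' m))| ≤ 14 * T ^ 2 * h ^ 2 := by
  have hT : 0 ≤ T := (abs_nonneg _).trans hu₁
  have e : (u₁ * u₂ + h * (u₁ * (a₂ + d₂) + (a₁ + d₁) * u₂ + ∑ m, c₁ m * c₂ m))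
      - (e₁ * e₂ + h * (e₁ * d₂' + d₁' * e₂ + ∑ m, c₁' m * c₂' m))
      = -(e₁ * (e₂ - u₂ - h * a₂)) - (e₁ - u₁ - h * a₁) * (u₂ + h * a₂) - h * h * (a₁ * a₂)
        - h * (e₁ * (d₂' - d₂)) - h * ((e₁ - u₁) * d₂) - h * ((d₁' - d₁) * e₂)
        - h * (d₁ * (e₂ - u₂)) - h * ∑ m, ((c₁' m - c₁ m) * c₂' m + c₁ m * (c₂' m - c₂ m)) := by
    simp only [Fin.sum_univ_three]
    ring
  have hua : |u₂ + h * a₂| ≤ T + 1 * T :=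
    (abs_add_le _ _).trans (add_le_add hu₂ (abs_mul_le_of_le (by rwa [abs_of_nonneg hh]) ha₂))
  have k1 := abs_mul_le_of_le he₁ hr₂
  have k2 := abs_mul_le_of_le hr₁ hua
  have k3 := abs_mul_le_of_le (a := h * h) (b := a₁ * a₂) (abs_of_nonneg (by positivity)).le
    (abs_mul_le_of_le ha₁ ha₂)
  have hle : |h| ≤ h := (abs_of_nonneg hh).le
  have k4 := abs_mul_le_of_le hle (abs_mul_le_of_le he₁ hdd₂)
  have k5 := abs_mul_le_of_le hle (abs_mul_le_of_le hq₁ hd₂)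
  have k6 := abs_mul_le_of_le hle (abs_mul_le_of_le hdd₁ he₂)
  have k7 := abs_mul_le_of_le hle (abs_mul_le_of_le hd₁ hq₂)
  have k8 : |h * ∑ m, ((c₁' m - c₁ m) * c₂' m + c₁ m * (c₂' m - c₂ m))|
      ≤ h * ∑ _m : Fin 3, (h * T * T + T * (h * T)) :=
    abs_mul_le_of_le hle ((Finset.abs_sum_le_sum_abs _ _).trans (Finset.sum_le_sum fun m _ =>
      (abs_add_le _ _).trans (add_le_add (abs_mul_le_of_le (hcc₁ m) (hc₂' m))
        (abs_mul_le_of_le (hc₁ m) (hcc₂ m)))))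
  rw [Finset.sum_const, Finset.card_univ, Fintype.card_fin, nsmul_eq_mul] at k8
  rw [e]
  simp only [abs_le] at k1 k2 k3 k4 k5 k6 k7 k8 ⊢
  push_cast at k8
  constructor <;> nlinarith

section Norms

open scoped Matrix.Norms.Operator

theorem norm_exp_hat_sub_one_le (α : Fin 3 → ℝ) {h : ℝ} (hh : 0 ≤ h) :
    ‖NormedSpace.exp (h • hat α) - 1‖ ≤ 3 * (h * ‖hat α‖) := by
  have hE (t : ℝ) : ‖NormedSpace.exp (t • h • hat α)‖ ≤ 3 := by
    rw [← hat_smul, ← hat_smul]; exact norm_exp_hat_le _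
  have := norm_exp_sub_sum_le (fun t _ => hE t) 1 1 (by simp)
  simp only [one_smul, Finset.sum_range_one, pow_zero, Nat.factorial_zero, Nat.cast_one, div_one,
    pow_one, norm_smul, Real.norm_of_nonneg hh] at this
  exact this

theorem norm_exp_hat_sub_one_sub_le (α : Fin 3 → ℝ) {h : ℝ} (hh : 0 ≤ h) :
    ‖NormedSpace.exp (h • hat α) - 1 - h • hat α‖ ≤ 3 * (h * ‖hat α‖) ^ 2 := by
  have hE (t : ℝ) : ‖NormedSpace.exp (t • h • hat α)‖ ≤ 3 := by
    rw [← hat_smul, ← hat_smul]; exact norm_exp_hat_le _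
  have := norm_exp_sub_sum_le (fun t _ => hE t) 2 1 (by simp)
  simp only [one_smul, Finset.sum_range_succ, Finset.sum_range_zero, zero_add, pow_zero,
    Nat.factorial_zero, Nat.factorial_one, Nat.cast_one, div_one, pow_one, norm_smul,
    Real.norm_of_nonneg hh] at this
  rwa [sub_sub]

/-- Bounds for a functional at `X` and at `X exp(h α̂)`. -/
theorem increment_bounds (α : Fin 3 → ℝ) {h : ℝ} (hh : 0 ≤ h) {ℓ : Mat3 →ₗ[ℝ] ℝ} {C : ℝ}
    (hC : 0 ≤ C) (hℓ : ∀ X, |ℓ X| ≤ C * ‖X‖) {X : Mat3} {r : ℝ} (hX : ‖X‖ ≤ r) :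
    |ℓ X| ≤ C * (3 * (1 + ‖hat α‖) ^ 2 * r) ∧
    |ℓ (X * NormedSpace.exp (h • hat α))| ≤ C * (3 * (1 + ‖hat α‖) ^ 2 * r) ∧
    |ℓ (X * NormedSpace.exp (h • hat α)) - ℓ X| ≤ h * (C * (3 * (1 + ‖hat α‖) ^ 2 * r)) := by
  have hr : 0 ≤ r := (norm_nonneg _).trans hX
  have ha := norm_nonneg (hat α)
  have h1 : 1 ≤ (1 + ‖hat α‖) ^ 2 := by nlinarith
  have hE : ‖NormedSpace.exp (h • hat α)‖ ≤ 3 := by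
    rw [← hat_smul]; exact norm_exp_hat_le _
  have hE1 : ‖NormedSpace.exp (h • hat α) - 1‖ ≤ 3 * (h * ‖hat α‖) :=
    norm_exp_hat_sub_one_le α hh
  refine ⟨(hℓ _).trans ?_, (hℓ _).trans ?_, ?_⟩
  · gcongr
    nlinarith
  · gcongr
    refine (norm_mul_le_of_le hX hE).trans ?_
    nlinarith
  · rw [← map_sub]
    have e : X * NormedSpace.exp (h • hat α) - X = X * (NormedSpace.exp (h • hat α) - 1) := by
      rw [mul_sub, mul_one]
    rw [e]
    calc _ ≤ C * (r * (3 * (h * ‖hat α‖))) :=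
          (hℓ _).trans (mul_le_mul_of_nonneg_left (norm_mul_le_of_le hX hE1) hC)
      _ = h * (C * (3 * ‖hat α‖ * r)) := by ring
      _ ≤ _ := by gcongr; nlinarith

/-- The bound `r ≥ 1` puts the error in the form used for the other functionals. -/
theorem increment_second_order (α : Fin 3 → ℝ) {h : ℝ} (hh : 0 ≤ h) {ℓ : Mat3 →ₗ[ℝ] ℝ} {C : ℝ}
    (hC : 0 ≤ C) (hℓ : ∀ X, |ℓ X| ≤ C * ‖X‖) {r : ℝ} (hr : 1 ≤ r) :
    |ℓ (NormedSpace.exp (h • hat α)) - ℓ 1 - h * ℓ (hat α)|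
      ≤ h ^ 2 * (C * (3 * (1 + ‖hat α‖) ^ 2 * r)) := by
  have ha := norm_nonneg (hat α)
  have hE2 : ‖NormedSpace.exp (h • hat α) - 1 - h • hat α‖ ≤ 3 * (h * ‖hat α‖) ^ 2 :=
    norm_exp_hat_sub_one_sub_le α hh
  calc _ = |ℓ (NormedSpace.exp (h • hat α) - 1 - h • hat α)| := by
        simp only [map_sub, map_smul, smul_eq_mul]
    _ ≤ C * (3 * (h * ‖hat α‖) ^ 2) := (hℓ _).trans (mul_le_mul_of_nonneg_left hE2 hC)
    _ = h ^ 2 * (C * (3 * ‖hat α‖ ^ 2 * 1)) := by ring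
    _ ≤ _ := by
      gcongr
      linarith

/-- Size of all matrices in the model of the increment, relative to `1 + ‖y‖`. -/
theorem exists_model_bounds (Hu : Mat3) (α : Fin 3 → ℝ) : ∃ S, 1 ≤ S ∧ ∀ y : Fin 3 → ℝ,
    1 ≤ S * (1 + ‖y‖) ∧ ‖(1 : Mat3)‖ ≤ S * (1 + ‖y‖) ∧ ‖hat α‖ ≤ S * (1 + ‖y‖) ∧
    ‖hat y + (1 / 2 : ℝ) • noiseGenerator Hu‖ ≤ S * (1 + ‖y‖) ∧
    ∀ m : Fin 3, ‖hat (Hu *ᵥ Pi.single m 1)‖ ≤ S * (1 + ‖y‖) := by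
  refine ⟨3 + ‖hat α‖ + ‖noiseGenerator Hu‖ + ∑ m : Fin 3, ‖hat (Hu *ᵥ Pi.single m 1)‖, ?_,
    fun y => ?_⟩
  · have := Finset.sum_nonneg fun (m : Fin 3) (_ : m ∈ Finset.univ) =>
      norm_nonneg (hat (Hu *ᵥ Pi.single m 1))
    linarith [norm_nonneg (hat α), norm_nonneg (noiseGenerator Hu)]
  have h3 := Finset.sum_nonneg fun (m : Fin 3) (_ : m ∈ Finset.univ) =>
      norm_nonneg (hat (Hu *ᵥ Pi.single m 1))
  have h1 := norm_nonneg (hat α)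
  have h2 := norm_nonneg (noiseGenerator Hu)
  have hy := norm_nonneg y
  set c := ∑ m : Fin 3, ‖hat (Hu *ᵥ Pi.single m 1)‖
  have key {t : ℝ} (ht : t ≤ 3 * ‖y‖ + (3 + ‖hat α‖ + ‖noiseGenerator Hu‖ + c)) :
      t ≤ (3 + ‖hat α‖ + ‖noiseGenerator Hu‖ + c) * (1 + ‖y‖) := by
    nlinarith [mul_nonneg h1 hy, mul_nonneg h2 hy, mul_nonneg h3 hy]
  refine ⟨key (by linarith), key (by rw [norm_one]; linarith), key (by linarith),
    key ((norm_add_le _ _).trans ?_), fun m => key ?_⟩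
  · rw [norm_smul, Real.norm_of_nonneg (by norm_num)]
    linarith [norm_hat_le y]
  · have : ‖hat (Hu *ᵥ Pi.single m 1)‖ ≤ c := Finset.single_le_sum
      (f := fun m : Fin 3 => ‖hat (Hu *ᵥ Pi.single m 1)‖) (fun _ _ => norm_nonneg _)
      (Finset.mem_univ m)
    linarith

theorem one_add_norm_add_pow_le (α y : Fin 3 → ℝ) (k : ℕ) :
    (1 + ‖α + y‖) ^ k ≤ (1 + ‖α‖) ^ k * (1 + ‖y‖) ^ k := by
  rw [← mul_pow]
  refine pow_le_pow_left₀ (by positivity) ?_ k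
  nlinarith [norm_add_le α y, mul_nonneg (norm_nonneg α) (norm_nonneg y)]

/-- The mean of the random rotation increment expanded around the deterministic increment
`exp(h α̂)`. -/
theorem exists_integral_increment_model (Hu : Mat3) (α : Fin 3 → ℝ) : ∃ K, 0 ≤ K ∧
    ∀ (y : Fin 3 → ℝ) (h : ℝ), 0 ≤ h → h ≤ 1 →
    ∀ (ℓ : Mat3 →ₗ[ℝ] ℝ) (C : ℝ), 0 ≤ C → (∀ X, |ℓ X| ≤ C * ‖X‖) →
    |∫ w, ℓ (NormedSpace.exp (h • hat (α + y) + hat (Hu *ᵥ w))) ∂wienerIncrement h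
      - (ℓ (NormedSpace.exp (h • hat α))
        + h * ℓ ((hat y + (1 / 2 : ℝ) • noiseGenerator Hu) * NormedSpace.exp (h • hat α)))|
      ≤ C * K * h ^ 2 * (1 + ‖y‖) ^ 4 := by
  obtain ⟨K, hK, hexp⟩ := exists_integral_increment_expansion Hu
  obtain ⟨S, hS, hb⟩ := exists_model_bounds Hu α
  refine ⟨K * (1 + ‖α‖) ^ 4 + 2 * (3 * (1 + ‖hat α‖) ^ 2 * S), by positivity,
    fun y h hh hh1 ℓ C hC hℓ => ?_⟩
  obtain ⟨b0, b1, ba, bd, -⟩ := hb y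
  have h1 := hexp (α + y) h hh hh1 ℓ C hC hℓ
  have h2 := increment_second_order α hh hC hℓ b0
  have h3 := (increment_bounds α hh hC hℓ bd).2.2
  have h4 : C * K * h ^ 2 * (1 + ‖α + y‖) ^ 4
      ≤ C * K * h ^ 2 * ((1 + ‖α‖) ^ 4 * (1 + ‖y‖) ^ 4) := by
    gcongr
    exact one_add_norm_add_pow_le α y 4
  have h5 : 2 * h ^ 2 * (C * (3 * (1 + ‖hat α‖) ^ 2 * (S * (1 + ‖y‖))))
      ≤ 2 * h ^ 2 * (C * (3 * (1 + ‖hat α‖) ^ 2 * (S * (1 + ‖y‖) ^ 4))) := by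
    gcongr
    exact le_self_pow₀ (by linarith [norm_nonneg y]) (by norm_num)
  have h6 := abs_mul_le_of_le (abs_of_nonneg hh).le h3
  rw [hat_add, map_add] at h1
  set D := ℓ ((hat y + (1 / 2 : ℝ) • noiseGenerator Hu) * NormedSpace.exp (h • hat α))
  rw [map_add, map_smul, smul_eq_mul] at h6
  rw [hat_add]
  simp only [abs_le] at h1 h2 h6 ⊢
  constructor <;> linarith

/-- Second moments of the random rotation increment expanded around the deterministic
increment `exp(h α̂)`. -/
theorem exists_integral_increment_mul_model (Hu : Mat3) (α : Fin 3 → ℝ) : ∃ K, 0 ≤ K ∧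
    ∀ (y : Fin 3 → ℝ) (h : ℝ), 0 ≤ h → h ≤ 1 →
    ∀ (ℓ₁ ℓ₂ : Mat3 →ₗ[ℝ] ℝ) (C : ℝ), 0 ≤ C → (∀ X, |ℓ₁ X| ≤ C * ‖X‖) →
    (∀ X, |ℓ₂ X| ≤ C * ‖X‖) →
    |∫ w, ℓ₁ (NormedSpace.exp (h • hat (α + y) + hat (Hu *ᵥ w)))
        * ℓ₂ (NormedSpace.exp (h • hat (α + y) + hat (Hu *ᵥ w))) ∂wienerIncrement h
      - (ℓ₁ (NormedSpace.exp (h • hat α)) * ℓ₂ (NormedSpace.exp (h • hat α))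
        + h * (ℓ₁ (NormedSpace.exp (h • hat α))
            * ℓ₂ ((hat y + (1 / 2 : ℝ) • noiseGenerator Hu) * NormedSpace.exp (h • hat α))
          + ℓ₁ ((hat y + (1 / 2 : ℝ) • noiseGenerator Hu) * NormedSpace.exp (h • hat α))
            * ℓ₂ (NormedSpace.exp (h • hat α))
          + ∑ m, ℓ₁ (hat (Hu *ᵥ Pi.single m 1) * NormedSpace.exp (h • hat α))
            * ℓ₂ (hat (Hu *ᵥ Pi.single m 1) * NormedSpace.exp (h • hat α))))|
      ≤ C ^ 2 * K * h ^ 2 * (1 + ‖y‖) ^ 8 := by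
  obtain ⟨K, hK, hexp⟩ := exists_integral_increment_mul_expansion Hu
  obtain ⟨S, hS, hb⟩ := exists_model_bounds Hu α
  refine ⟨K * (1 + ‖α‖) ^ 8 + 14 * (3 * (1 + ‖hat α‖) ^ 2 * S) ^ 2, by positivity,
    fun y h hh hh1 ℓ₁ ℓ₂ C hC hℓ₁ hℓ₂ => ?_⟩
  obtain ⟨b0, b1, ba, bd, bc⟩ := hb y
  have h1 := hexp (α + y) h hh hh1 ℓ₁ ℓ₂ C hC hℓ₁ hℓ₂
  have h4 : C ^ 2 * K * h ^ 2 * (1 + ‖α + y‖) ^ 8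
      ≤ C ^ 2 * K * h ^ 2 * ((1 + ‖α‖) ^ 8 * (1 + ‖y‖) ^ 8) := by
    gcongr
    exact one_add_norm_add_pow_le α y 8
  have h5 : 14 * (C * (3 * (1 + ‖hat α‖) ^ 2 * (S * (1 + ‖y‖)))) ^ 2 * h ^ 2
      ≤ C ^ 2 * (14 * (3 * (1 + ‖hat α‖) ^ 2 * S) ^ 2) * h ^ 2 * (1 + ‖y‖) ^ 8 := by
    calc _ = C ^ 2 * (14 * (3 * (1 + ‖hat α‖) ^ 2 * S) ^ 2) * h ^ 2 * (1 + ‖y‖) ^ 2 := by ring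
      _ ≤ _ := by
        gcongr
        · linarith [norm_nonneg y]
        · norm_num
  have i1 := increment_bounds α hh hC hℓ₁ b1
  have i2 := increment_bounds α hh hC hℓ₂ b1
  rw [one_mul] at i1 i2
  have key := abs_mul_model_sub_le hh hh1 i1.1 i2.1 (increment_bounds α hh hC hℓ₁ ba).1
    (increment_bounds α hh hC hℓ₂ ba).1 i1.2.1 i2.2.1 (increment_bounds α hh hC hℓ₁ bd).1
    (increment_bounds α hh hC hℓ₂ bd).1 (fun m => (increment_bounds α hh hC hℓ₁ (bc m)).1)
    (fun m => (increment_bounds α hh hC hℓ₂ (bc m)).2.1)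
    (increment_second_order α hh hC hℓ₁ b0) (increment_second_order α hh hC hℓ₂ b0)
    i1.2.2 i2.2.2 (increment_bounds α hh hC hℓ₁ bd).2.2 (increment_bounds α hh hC hℓ₂ bd).2.2
    (fun m => (increment_bounds α hh hC hℓ₁ (bc m)).2.2)
    (fun m => (increment_bounds α hh hC hℓ₂ (bc m)).2.2)
  have e (ℓ : Mat3 →ₗ[ℝ] ℝ) : ℓ (hat (α + y)) + 1 / 2 * ℓ (noiseGenerator Hu)
      = ℓ (hat α) + ℓ (hat y + (1 / 2 : ℝ) • noiseGenerator Hu) := by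
    rw [hat_add, map_add, map_add, map_smul, smul_eq_mul, add_assoc]
  rw [e, e] at h1
  refine (abs_sub_le _ _ _).trans ((add_le_add (h1.trans h4) (key.trans h5)).trans (le_of_eq ?_))
  ring

end Norms

/-! ### The fitted attitude variable in the frame of the previous step -/

theorem tiltedNu_mul_transpose (F M A : Mat3) : tiltedNu (F * Mᵀ) A = tiltedNu F (A * M) := by
  simp only [tiltedNu, Matrix.transpose_mul, Matrix.transpose_transpose, Matrix.mul_assoc]

/-- `Ũ ν̃ = ν₁(A M)`, where `ν̃` is formed with `S̃ = Ũᵀ diag(s) (V₁ᵀ Mᵀ V)`. -/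
theorem mulVec_tiltedNu_frame (U V U₁ V₁ : SO3) (s : Fin 3 → ℝ) (M A : Mat3) :
    ((U₁ : Mat3)ᵀ * (U : Mat3)) *ᵥ
      tiltedNu (((U₁ : Mat3)ᵀ * (U : Mat3))ᵀ * Matrix.diagonal s * ((V₁ : Mat3)ᵀ * Mᵀ * (V : Mat3)))
        ((U : Mat3)ᵀ * A * (V : Mat3)) = nuVec U₁ s V₁ (A * M) := by
  have e : ((U₁ : Mat3)ᵀ * (U : Mat3))ᵀ * Matrix.diagonal s * ((V₁ : Mat3)ᵀ * Mᵀ * (V : Mat3))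
      = (U : Mat3)ᵀ * (fisherParam U₁ s V₁ * Mᵀ) * (V : Mat3) := by
    simp only [fisherParam, Matrix.transpose_mul, Matrix.transpose_transpose, Matrix.mul_assoc]
  rw [e, tiltedNu_conj, tiltedNu_mul_transpose, Matrix.mulVec_mulVec, Matrix.mul_assoc,
    SO3.mul_transpose, Matrix.mul_one, nuVec_eq_tiltedNu]

/-- `Ũ Γ Vᵀ z = ν₁(R ẑ M)`. -/
theorem mulVec_gammaMat_frame (U V U₁ V₁ : SO3) (s : Fin 3 → ℝ) (M : Mat3) (R : SO3)
    (z : Fin 3 → ℝ) :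
    ((U₁ : Mat3)ᵀ * (U : Mat3)) *ᵥ
      (gammaMat (((U₁ : Mat3)ᵀ * (U : Mat3))ᵀ * Matrix.diagonal s
        * ((V₁ : Mat3)ᵀ * Mᵀ * (V : Mat3))) ((U : Mat3)ᵀ * (R : Mat3) * (V : Mat3))
        *ᵥ ((V : Mat3)ᵀ *ᵥ z)) = nuVec U₁ s V₁ ((R : Mat3) * hat z * M) := by
  have e : (U : Mat3)ᵀ * (R : Mat3) * (V : Mat3) = ((U⁻¹ * R * V : SO3) : Mat3) := by
    simp [SO3.coe_inv]
  have e2 : ((U⁻¹ * R * V : SO3) : Mat3) * hat ((V : Mat3)ᵀ *ᵥ z)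
      = (U : Mat3)ᵀ * ((R : Mat3) * hat z) * (V : Mat3) := by
    rw [← e, Matrix.mul_assoc _ (V : Mat3), SO3.mul_hat, Matrix.mulVec_mulVec, SO3.mul_transpose,
      Matrix.one_mulVec]
    simp only [Matrix.mul_assoc]
  rw [e, gammaMat_mulVec, e2, mulVec_tiltedNu_frame]

theorem nuVec_sub_param (U : SO3) (s s' : Fin 3 → ℝ) (V : SO3) (A : Mat3) :
    nuVec U s V A - nuVec U s' V A = nuVec U (s - s') V A := by
  ext j
  fin_cases j <;> simp [nuVec, vee, Matrix.mul_apply, Fin.sum_univ_three, Matrix.diagonal] <;> ring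

section Norms

open scoped Matrix.Norms.Operator

theorem SO3.norm_le (R : SO3) : ‖(R : Mat3)‖ ≤ 3 := by
  simpa using norm_le_of_entries (abs_entry_le_one (SO3.mul_transpose R))

theorem SO3.norm_transpose_le (R : SO3) : ‖(R : Mat3)ᵀ‖ ≤ 3 := by
  have := SO3.norm_le R⁻¹
  rwa [SO3.coe_inv] at this

theorem abs_nuVec_le (U : SO3) (s : Fin 3 → ℝ) (V : SO3) (A : Mat3) (j : Fin 3) :
    |nuVec U s V A j| ≤ 18 * ‖s‖ * ‖A‖ := by
  set B : Mat3 := (U : Mat3)ᵀ * A * (V : Mat3) with hB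
  have hBn : ‖B‖ ≤ 9 * ‖A‖ := by
    refine (norm_mul_le_of_le (norm_mul_le_of_le (SO3.norm_transpose_le U) le_rfl)
      (SO3.norm_le V)).trans (le_of_eq (by ring))
  have hb (i k l : Fin 3) : |B i k * s l| ≤ 9 * ‖A‖ * ‖s‖ :=
    abs_mul_le_of_le ((abs_entry_le_norm B i k).trans hBn) (norm_le_pi_norm s l)
  have key (i k : Fin 3) : |(B * Matrix.diagonal s - Matrix.diagonal s * Bᵀ) i k|
      ≤ 18 * ‖s‖ * ‖A‖ := by
    rw [Matrix.sub_apply, Matrix.mul_diagonal, Matrix.diagonal_mul, Matrix.transpose_apply,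
      mul_comm (s i)]
    refine (abs_sub _ _).trans ?_
    linarith [hb i k k, hb k i i]
  fin_cases j
  · exact key 2 1
  · exact key 0 2
  · exact key 1 0

/-- The functional `X ↦ ℓ (Q X)`, which expresses functionals of the new attitude by the increment. -/
def leftShift (ℓ : Mat3 →ₗ[ℝ] ℝ) (Q : SO3) : Mat3 →ₗ[ℝ] ℝ := ℓ ∘ₗ LinearMap.mulLeft ℝ (Q : Mat3)

theorem leftShift_apply (ℓ : Mat3 →ₗ[ℝ] ℝ) (Q : SO3) (X : Mat3) :
    leftShift ℓ Q X = ℓ ((Q : Mat3) * X) := rfl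

theorem abs_leftShift_le {ℓ : Mat3 →ₗ[ℝ] ℝ} {C : ℝ} (hC : 0 ≤ C) (hℓ : ∀ X, |ℓ X| ≤ C * ‖X‖)
    (Q : SO3) (X : Mat3) : |leftShift ℓ Q X| ≤ C * 3 * ‖X‖ := by
  refine (hℓ _).trans ?_
  rw [mul_assoc]
  exact mul_le_mul_of_nonneg_left (norm_mul_le_of_le (SO3.norm_le Q) le_rfl) hC

theorem attitudeStep_eq (h : ℝ) (Om : Fin 3 → ℝ) (Hu : Mat3) (R : SO3) (x w : Fin 3 → ℝ) :
    attitudeStep h Om Hu R x w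
      = (R : Mat3) * NormedSpace.exp (h • hat (Om + x) + hat (Hu *ᵥ w)) := by
  rw [attitudeStep, hat_add]

theorem norm_attitudeStep_le (h : ℝ) (Om : Fin 3 → ℝ) (Hu : Mat3) (R : SO3) (x w : Fin 3 → ℝ) :
    ‖attitudeStep h Om Hu R x w‖ ≤ 9 := by
  rw [attitudeStep_eq, ← hat_smul, ← hat_add]
  exact (norm_mul_le_of_le (SO3.norm_le R) (norm_exp_hat_le _)).trans (by norm_num)

theorem continuous_attitudeStep (h : ℝ) (Om : Fin 3 → ℝ) (Hu : Mat3) :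
    Continuous fun q : (SO3 × (Fin 3 → ℝ)) × (Fin 3 → ℝ) =>
      attitudeStep h Om Hu q.1.1 q.1.2 q.2 := by
  refine (continuous_SO3_coe.comp (continuous_fst.comp continuous_fst)).matrix_mul
    (continuous_exp_mat.comp (((continuous_const.add
      (continuous_hat.comp (continuous_snd.comp continuous_fst))).const_smul h).add
      (continuous_hat.comp (continuous_const.matrix_mulVec continuous_snd))))

end Norms

/-! ### Expectations of polynomials in the residual -/

theorem exists_abs_le_SO3 {φ : SO3 → ℝ} (hφ : Continuous φ) : ∃ C, 0 ≤ C ∧ ∀ Q, |φ Q| ≤ C := by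
  obtain ⟨Q₀, hQ₀⟩ := hφ.norm.exists_forall_ge_of_hasCompactSupport
    (HasCompactSupport.of_compactSpace _)
  exact ⟨‖φ Q₀‖, norm_nonneg _, hQ₀⟩

section Residual

variable {n : ℕ} (θ : MFGParam n)

/-- The deviation of the linear part from its conditional mean. -/
def MFGParam.residual (p : SO3 × (Fin n → ℝ)) : Fin n → ℝ := p.2 - θ.condMean p.1

theorem MFGParam.continuous_residual : Continuous θ.residual :=
  continuous_snd.sub (θ.continuous_condMean.comp continuous_fst)

theorem MFGParam.exists_norm_residual_le : ∃ C, 0 ≤ C ∧ ∀ p, ‖θ.residual p‖ ≤ C * (1 + ‖p.2‖) := by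
  obtain ⟨C, hC, h⟩ := exists_abs_le_SO3 θ.continuous_condMean.norm
  refine ⟨1 + C, by positivity, fun p => ?_⟩
  have h1 := h p.1
  rw [abs_of_nonneg (norm_nonneg _)] at h1
  have h2 : ‖θ.residual p‖ ≤ ‖p.2‖ + ‖θ.condMean p.1‖ := norm_sub_le _ _
  nlinarith [norm_nonneg p.2, mul_nonneg hC (norm_nonneg p.2)]

theorem MFGParam.integrable_mul_residual {φ : SO3 → ℝ} (hφ : Continuous φ) (i : Fin n) :
    Integrable (fun p => φ p.1 * θ.residual p i) θ.law := by
  obtain ⟨B, hB, hb⟩ := exists_abs_le_SO3 hφ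
  obtain ⟨C, hC, hr⟩ := θ.exists_norm_residual_le
  refine θ.integrable_law_of_growth ((hφ.comp continuous_fst).mul
    ((continuous_apply i).comp θ.continuous_residual)) (B * C) 1 fun p => ?_
  rw [pow_one, mul_assoc]
  exact abs_mul_le_of_le (hb p.1) ((norm_le_pi_norm (θ.residual p) i).trans (hr p))

theorem MFGParam.integrable_mul_residual_mul {φ : SO3 → ℝ} (hφ : Continuous φ) (i j : Fin n) :
    Integrable (fun p => φ p.1 * (θ.residual p i * θ.residual p j)) θ.law := by
  obtain ⟨B, hB, hb⟩ := exists_abs_le_SO3 hφ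
  obtain ⟨C, hC, hr⟩ := θ.exists_norm_residual_le
  have hc (i : Fin n) : Continuous fun p => θ.residual p i :=
    (continuous_apply i).comp θ.continuous_residual
  refine θ.integrable_law_of_growth ((hφ.comp continuous_fst).mul ((hc i).mul (hc j)))
    (B * C ^ 2) 2 fun p => ?_
  refine (abs_mul_le_of_le (hb p.1) (abs_mul_le_of_le
    ((norm_le_pi_norm (θ.residual p) i).trans (hr p))
    ((norm_le_pi_norm (θ.residual p) j).trans (hr p)))).trans (le_of_eq ?_)
  ring

theorem MFGParam.integrable_fst {φ : SO3 → ℝ} (hφ : Continuous φ) :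
    Integrable (fun p => φ p.1) θ.law := by
  obtain ⟨B, hB, hb⟩ := exists_abs_le_SO3 hφ
  exact θ.integrable_law_of_growth (hφ.comp continuous_fst) B 0 fun p => by simpa using hb p.1

/-- Only the terms of even order in the residual contribute to an expectation. -/
theorem MFGParam.integral_residual_polynomial {φ ψ : SO3 → ℝ} {φ₁ φ₂ : Fin n → SO3 → ℝ}
    (hφ : Continuous φ) (hψ : Continuous ψ) (hφ₁ : ∀ k, Continuous (φ₁ k))
    (hφ₂ : ∀ k, Continuous (φ₂ k)) (i : Fin n) :
    Integrable (fun p => φ p.1 + ψ p.1 * θ.residual p i + ∑ k, φ₁ k p.1 * θ.residual p k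
      + ∑ k, φ₂ k p.1 * (θ.residual p i * θ.residual p k)) θ.law ∧
    ∫ p, (φ p.1 + ψ p.1 * θ.residual p i + ∑ k, φ₁ k p.1 * θ.residual p k
      + ∑ k, φ₂ k p.1 * (θ.residual p i * θ.residual p k)) ∂θ.law
      = ∫ Q, (φ Q + ∑ k, condCov θ.Sig θ.P θ.s i k * φ₂ k Q) ∂fisherMeasure θ.fisher := by
  have j₀ := θ.integrable_fst hφ
  have j₁ := θ.integrable_mul_residual hψ i
  have j₂ : Integrable (fun p => ∑ k, φ₁ k p.1 * θ.residual p k) θ.law :=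
    integrable_finsetSum _ fun k _ => θ.integrable_mul_residual (hφ₁ k) k
  have j₃ : Integrable (fun p => ∑ k, φ₂ k p.1 * (θ.residual p i * θ.residual p k)) θ.law :=
    integrable_finsetSum _ fun k _ => θ.integrable_mul_residual_mul (hφ₂ k) i k
  have j₀₁ : Integrable (fun p => φ p.1 + ψ p.1 * θ.residual p i) θ.law := j₀.add j₁
  have j₀₂ : Integrable (fun p => φ p.1 + ψ p.1 * θ.residual p i
      + ∑ k, φ₁ k p.1 * θ.residual p k) θ.law := j₀₁.add j₂
  have r₁ (φ : SO3 → ℝ) (hφ : Continuous φ) (i : Fin n) :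
      ∫ p, φ p.1 * θ.residual p i ∂θ.law = 0 := θ.integral_law_mul_residual hφ i
  have r₂ (φ : SO3 → ℝ) (hφ : Continuous φ) (i j : Fin n) :
      ∫ p, φ p.1 * (θ.residual p i * θ.residual p j) ∂θ.law
        = condCov θ.Sig θ.P θ.s i j * ∫ Q, φ Q ∂fisherMeasure θ.fisher :=
    θ.integral_law_mul_residual_mul hφ i j
  refine ⟨j₀₂.add j₃, ?_⟩
  rw [integral_add j₀₂ j₃, integral_add j₀₁ j₂, integral_add j₀ j₁, r₁ ψ hψ,
    integral_finsetSum _ fun k _ => θ.integrable_mul_residual (hφ₁ k) k,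
    integral_finsetSum _ fun k _ => θ.integrable_mul_residual_mul (hφ₂ k) i k,
    integral_add (integrable_of_continuous_SO3 _ hφ) (integrable_finsetSum _ fun k _ =>
      (integrable_of_continuous_SO3 _ (hφ₂ k)).const_mul _),
    integral_finsetSum _ fun k _ => (integrable_of_continuous_SO3 _ (hφ₂ k)).const_mul _,
    θ.integral_law_fst hφ]
  simp only [r₁ _ (hφ₁ _), r₂ _ (hφ₂ _), integral_const_mul]
  simp

end Residual

/-! ### Expansion of the moments after one step -/

instance instIsProbabilityMeasure_wienerIncrement (h : ℝ) :
    IsProbabilityMeasure (wienerIncrement h) := by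
  unfold wienerIncrement; infer_instance

theorem MFGParam.integrable_prod_of_growth {n : ℕ} (θ : MFGParam n) (h : ℝ)
    {f : (SO3 × (Fin n → ℝ)) × (Fin 3 → ℝ) → ℝ} (hf : Continuous f) (C : ℝ) (k : ℕ)
    (hb : ∀ q, |f q| ≤ C * (1 + ‖q.1.2‖) ^ k) : Integrable f (θ.law.prod (wienerIncrement h)) :=
  (((θ.integrable_law_norm_pow k).const_mul C).comp_fst (wienerIncrement h)).mono'
    hf.aestronglyMeasurable (ae_of_all _ hb)

/-- An estimate of the conditional expectation given the state integrates to an estimate of the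
expectation. -/
theorem MFGParam.abs_integral_prod_sub_le {n : ℕ} (θ : MFGParam n) {h : ℝ}
    {f : (SO3 × (Fin n → ℝ)) × (Fin 3 → ℝ) → ℝ} (hf : Integrable f (θ.law.prod (wienerIncrement h)))
    {m : SO3 × (Fin n → ℝ) → ℝ} (hm : Integrable m θ.law) {D : ℝ} {k : ℕ}
    (hb : ∀ p, |∫ w, f (p, w) ∂wienerIncrement h - m p| ≤ D * (1 + ‖p.2‖) ^ k) :
    |∫ q, f q ∂θ.law.prod (wienerIncrement h) - ∫ p, m p ∂θ.law|
      ≤ D * ∫ p, (1 + ‖p.2‖) ^ k ∂θ.law := by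
  rw [integral_prod _ hf, ← integral_sub hf.integral_prod_left hm, ← integral_const_mul]
  exact norm_integral_le_of_norm_le
    (f := fun p => ∫ w, f (p, w) ∂wienerIncrement h - m p)
    ((θ.integrable_law_norm_pow k).const_mul D) (ae_of_all _ fun p => hb p)

section Moments

open scoped Matrix.Norms.Operator

variable (θ : MFGParam 3) (Om : Fin 3 → ℝ) (Hu : Mat3)

/-- The deterministic part `exp(h (Ω̂ + μ̂))` of the rotation increment. -/
noncomputable def MFGParam.drift (h : ℝ) : Mat3 := NormedSpace.exp (h • hat (Om + θ.μ))

/-- The generator of the rotation increment given the attitude: the deviation `P ν` of the mean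
rate from `μ`, and the Itô correction. -/
noncomputable def MFGParam.generatorAt (Q : SO3) : Mat3 :=
  hat (θ.P *ᵥ nuVec θ.U θ.s θ.V Q) + (1 / 2 : ℝ) • noiseGenerator Hu

theorem MFGParam.continuous_generatorAt : Continuous (θ.generatorAt Hu) :=
  (continuous_hat.comp (continuous_const.matrix_mulVec
    ((continuous_nuVec _ _ _).comp continuous_SO3_coe))).add continuous_const

theorem hat_eq_sum (z : Fin 3 → ℝ) : hat z = ∑ k, z k • hat (Pi.single k 1) := by
  have h := hat_mulVec_eq_sum 1 z
  simpa only [Matrix.one_mulVec] using h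

/-- The deviation of the rate from its mean, split into its conditional mean and the residual. -/
theorem MFGParam.hat_sub_mean (p : SO3 × (Fin 3 → ℝ)) :
    hat (p.2 - θ.μ) + (1 / 2 : ℝ) • noiseGenerator Hu
      = θ.generatorAt Hu p.1 + ∑ k, θ.residual p k • hat (Pi.single k 1) := by
  rw [← hat_eq_sum, MFGParam.generatorAt, add_right_comm, ← hat_add]
  congr 2
  ext j
  simp only [MFGParam.residual, MFGParam.condMean, Pi.add_apply, Pi.sub_apply]
  ring

theorem MFGParam.map_hat_sub_mean (ℓ : Mat3 →ₗ[ℝ] ℝ) (M : Mat3) (p : SO3 × (Fin 3 → ℝ)) :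
    ℓ ((hat (p.2 - θ.μ) + (1 / 2 : ℝ) • noiseGenerator Hu) * M)
      = ℓ (θ.generatorAt Hu p.1 * M) + ∑ k, θ.residual p k * ℓ (hat (Pi.single k 1) * M) := by
  rw [θ.hat_sub_mean, Matrix.add_mul, Finset.sum_mul, map_add, map_sum]
  simp only [Matrix.smul_mul, map_smul, smul_eq_mul]

theorem one_add_norm_sub_pow_le (μ x : Fin 3 → ℝ) (k : ℕ) :
    (1 + ‖x - μ‖) ^ k ≤ (1 + ‖μ‖) ^ k * (1 + ‖x‖) ^ k := by
  have := one_add_norm_add_pow_le (-μ) x k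
  rwa [norm_neg, neg_add_eq_sub] at this

theorem continuous_leftShift (ℓ : Mat3 →ₗ[ℝ] ℝ) {M : SO3 → Mat3} (hM : Continuous M) :
    Continuous fun Q => leftShift ℓ Q (M Q) :=
  (LinearMap.continuous_of_finiteDimensional ℓ).comp (continuous_SO3_coe.matrix_mul hM)

theorem continuous_linear_attitudeStep (h : ℝ) (ℓ : Mat3 →ₗ[ℝ] ℝ) :
    Continuous fun q : (SO3 × (Fin 3 → ℝ)) × (Fin 3 → ℝ) =>
      ℓ (attitudeStep h Om Hu q.1.1 q.1.2 q.2) :=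
  (LinearMap.continuous_of_finiteDimensional ℓ).comp (continuous_attitudeStep h Om Hu)

theorem abs_linear_attitudeStep_le (h : ℝ) {ℓ : Mat3 →ₗ[ℝ] ℝ} {C : ℝ} (hC : 0 ≤ C)
    (hℓ : ∀ X, |ℓ X| ≤ C * ‖X‖) (q : (SO3 × (Fin 3 → ℝ)) × (Fin 3 → ℝ)) :
    |ℓ (attitudeStep h Om Hu q.1.1 q.1.2 q.2)| ≤ 9 * C := by
  refine (hℓ _).trans ?_
  rw [mul_comm 9]
  exact mul_le_mul_of_nonneg_left (norm_attitudeStep_le _ _ _ _ _ _) hC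

theorem linear_attitudeStep_eq (h : ℝ) (ℓ : Mat3 →ₗ[ℝ] ℝ) (p : SO3 × (Fin 3 → ℝ))
    (w : Fin 3 → ℝ) : ℓ (attitudeStep h Om Hu p.1 p.2 w) = leftShift ℓ p.1
      (NormedSpace.exp (h • hat ((Om + θ.μ) + (p.2 - θ.μ)) + hat (Hu *ᵥ w))) := by
  rw [attitudeStep_eq, leftShift_apply, add_add_sub_cancel]

/-- The mean attitude after one step differs from the mean attitude by `O(h)`. -/
theorem MFGParam.exists_mean_attitudeStep : ∃ D, 0 ≤ D ∧ ∀ h : ℝ, 0 ≤ h → h ≤ 1 →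
    ∀ (ℓ : Mat3 →ₗ[ℝ] ℝ) (C : ℝ), 0 ≤ C → (∀ X, |ℓ X| ≤ C * ‖X‖) →
    |∫ q, ℓ (attitudeStep h Om Hu q.1.1 q.1.2 q.2) ∂θ.law.prod (wienerIncrement h)
      - ℓ (fisherMean θ.fisher)| ≤ C * D * h := by
  obtain ⟨K, hK, hexp⟩ := exists_integral_increment_expansion Hu
  refine ⟨3 * (K + 3 + ‖noiseGenerator Hu‖) * (1 + ‖Om‖) ^ 4 * ∫ p, (1 + ‖p.2‖) ^ 4 ∂θ.law,
    mul_nonneg (by positivity) (integral_nonneg fun p => by positivity),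
    fun h hh hh1 ℓ C hC hℓ => ?_⟩
  have hm : Continuous fun Q : SO3 => ℓ (Q : Mat3) :=
    (LinearMap.continuous_of_finiteDimensional ℓ).comp continuous_SO3_coe
  rw [← integral_fisherMeasure_linearMap, ← θ.integral_law_fst hm]
  refine (θ.abs_integral_prod_sub_le (k := 4)
    (D := C * (3 * (K + 3 + ‖noiseGenerator Hu‖) * (1 + ‖Om‖) ^ 4) * h)
    (θ.integrable_prod_of_growth h (continuous_linear_attitudeStep Om Hu h ℓ) (9 * C) 0
      fun q => by simpa using abs_linear_attitudeStep_le Om Hu h hC hℓ q)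
    (θ.integrable_fst hm) fun p => ?_).trans (le_of_eq (by ring))
  have h1 := hexp (Om + p.2) h hh hh1 (leftShift ℓ p.1) (C * 3) (by positivity)
    (abs_leftShift_le hC hℓ p.1)
  have h2 := abs_leftShift_le hC hℓ p.1 (hat (Om + p.2))
  have h3 := abs_leftShift_le hC hℓ p.1 (noiseGenerator Hu)
  have h4 : ‖hat (Om + p.2)‖ ≤ 3 * ‖Om + p.2‖ := norm_hat_le _
  have e1 : leftShift ℓ p.1 1 = ℓ (p.1 : Mat3) := by rw [leftShift_apply, Matrix.mul_one]
  simp only [attitudeStep_eq]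
  rw [e1] at h1
  have hx : 1 ≤ 1 + ‖Om + p.2‖ := by linarith [norm_nonneg (Om + p.2)]
  have h5 : 1 + ‖Om + p.2‖ ≤ (1 + ‖Om + p.2‖) ^ 4 := le_self_pow₀ hx (by norm_num)
  have hp := one_add_norm_add_pow_le Om p.2 4
  have hG := norm_nonneg (noiseGenerator Hu)
  have hO := norm_nonneg (Om + p.2)
  have h6 : |h * (leftShift ℓ p.1 (hat (Om + p.2)) + 1 / 2 * leftShift ℓ p.1 (noiseGenerator Hu))|
      ≤ h * (C * 3 * (3 + ‖noiseGenerator Hu‖) * (1 + ‖Om + p.2‖) ^ 4) := by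
    refine abs_mul_le_of_le (abs_of_nonneg hh).le ?_
    calc _ ≤ C * 3 * (3 * ‖Om + p.2‖) + 1 / 2 * (C * 3 * ‖noiseGenerator Hu‖) := by
          refine (abs_add_le _ _).trans (add_le_add (h2.trans ?_) ?_)
          · gcongr
          · exact abs_mul_le_of_le (by norm_num) h3
      _ = C * 3 * (3 * ‖Om + p.2‖ + 1 / 2 * ‖noiseGenerator Hu‖) := by ring
      _ ≤ C * 3 * ((3 + ‖noiseGenerator Hu‖) * (1 + ‖Om + p.2‖)) := by
          gcongr
          nlinarith [mul_nonneg hG hO]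
      _ ≤ C * 3 * ((3 + ‖noiseGenerator Hu‖) * (1 + ‖Om + p.2‖) ^ 4) := by gcongr
      _ = _ := by ring
  have h7 : C * 3 * K * h ^ 2 * (1 + ‖Om + p.2‖) ^ 4 ≤ C * 3 * K * h * (1 + ‖Om + p.2‖) ^ 4 := by
    gcongr
    nlinarith
  calc _ ≤ C * 3 * K * h * (1 + ‖Om + p.2‖) ^ 4
        + h * (C * 3 * (3 + ‖noiseGenerator Hu‖) * (1 + ‖Om + p.2‖) ^ 4) := by
        have := h1.trans h7
        simp only [abs_le, leftShift_apply] at this h6 ⊢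
        constructor <;> linarith
    _ = C * 3 * (K + 3 + ‖noiseGenerator Hu‖) * h * (1 + ‖Om + p.2‖) ^ 4 := by ring
    _ ≤ C * 3 * (K + 3 + ‖noiseGenerator Hu‖) * h * ((1 + ‖Om‖) ^ 4 * (1 + ‖p.2‖) ^ 4) := by gcongr
    _ = _ := by ring

/-- The mixed moments of the bias and a linear functional of the attitude after one step. -/
theorem MFGParam.exists_mixed_moment_expansion : ∃ D, 0 ≤ D ∧ ∀ h : ℝ, 0 ≤ h → h ≤ 1 →
    ∀ (ℓ : Mat3 →ₗ[ℝ] ℝ) (C : ℝ), 0 ≤ C → (∀ X, |ℓ X| ≤ C * ‖X‖) → ∀ i,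
    |∫ q, q.1.2 i * ℓ (attitudeStep h Om Hu q.1.1 q.1.2 q.2) ∂θ.law.prod (wienerIncrement h)
      - ∫ Q, (θ.condMean Q i * (leftShift ℓ Q (θ.drift Om h)
          + h * leftShift ℓ Q (θ.generatorAt Hu Q * θ.drift Om h))
        + ∑ k, condCov θ.Sig θ.P θ.s i k
          * (h * leftShift ℓ Q (hat (Pi.single k 1) * θ.drift Om h))) ∂fisherMeasure θ.fisher|
      ≤ C * D * h ^ 2 := by
  obtain ⟨K, hK, hexp⟩ := exists_integral_increment_model Hu (Om + θ.μ)
  refine ⟨3 * K * (1 + ‖θ.μ‖) ^ 4 * ∫ p, (1 + ‖p.2‖) ^ 5 ∂θ.law,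
    mul_nonneg (by positivity) (integral_nonneg fun p => by positivity),
    fun h hh hh1 ℓ C hC hℓ i => ?_⟩
  have hcm : Continuous fun Q => θ.condMean Q i := (continuous_apply i).comp θ.continuous_condMean
  have c₀ : Continuous fun Q => leftShift ℓ Q (θ.drift Om h) :=
    continuous_leftShift ℓ continuous_const
  have c₁ : Continuous fun Q => leftShift ℓ Q (θ.generatorAt Hu Q * θ.drift Om h) :=
    continuous_leftShift ℓ ((θ.continuous_generatorAt Hu).matrix_mul continuous_const)
  have c₂ (k : Fin 3) : Continuous fun Q =>
      h * leftShift ℓ Q (hat (Pi.single k 1) * θ.drift Om h) :=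
    continuous_const.mul (continuous_leftShift ℓ continuous_const)
  have c₀₁ : Continuous fun Q => leftShift ℓ Q (θ.drift Om h)
      + h * leftShift ℓ Q (θ.generatorAt Hu Q * θ.drift Om h) :=
    c₀.add (continuous_const.mul c₁)
  have cφ : Continuous fun Q => θ.condMean Q i * (leftShift ℓ Q (θ.drift Om h)
      + h * leftShift ℓ Q (θ.generatorAt Hu Q * θ.drift Om h)) := hcm.mul c₀₁
  have cφ₁ (k : Fin 3) : Continuous fun Q => θ.condMean Q i
      * (h * leftShift ℓ Q (hat (Pi.single k 1) * θ.drift Om h)) := hcm.mul (c₂ k)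
  obtain ⟨hm, hmi⟩ := θ.integral_residual_polynomial cφ c₀₁ cφ₁ c₂ i
  rw [← hmi]
  refine (θ.abs_integral_prod_sub_le (k := 5)
    (f := fun q => q.1.2 i * ℓ (attitudeStep h Om Hu q.1.1 q.1.2 q.2))
    (D := C * (3 * K * (1 + ‖θ.μ‖) ^ 4) * h ^ 2)
    (θ.integrable_prod_of_growth h (((continuous_apply i).comp (continuous_snd.comp
      continuous_fst)).mul (continuous_linear_attitudeStep Om Hu h ℓ)) (9 * C) 1
      fun q => ?_) hm fun p => ?_).trans (le_of_eq (by ring))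
  · have h1 : |q.1.2 i| ≤ 1 + ‖q.1.2‖ := (norm_le_pi_norm q.1.2 i).trans (by linarith)
    rw [pow_one, mul_comm (9 * C)]
    exact abs_mul_le_of_le h1 (abs_linear_attitudeStep_le Om Hu h hC hℓ q)
  · have h1 := hexp (p.2 - θ.μ) h hh hh1 (leftShift ℓ p.1) (C * 3) (by positivity)
      (abs_leftShift_le hC hℓ p.1)
    have h2 : |p.2 i| ≤ 1 + ‖p.2‖ := (norm_le_pi_norm p.2 i).trans (by linarith)
    have h3 := abs_mul_le_of_le h2 h1
    have hx : p.2 i = θ.condMean p.1 i + θ.residual p i := by simp [MFGParam.residual]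
    simp only [linear_attitudeStep_eq θ Om Hu h ℓ p]
    rw [integral_const_mul]
    -- the product of the bias and the model of the increment, as a polynomial in the residual
    have e : θ.condMean p.1 i * (leftShift ℓ p.1 (θ.drift Om h)
          + h * leftShift ℓ p.1 (θ.generatorAt Hu p.1 * θ.drift Om h))
        + (leftShift ℓ p.1 (θ.drift Om h)
          + h * leftShift ℓ p.1 (θ.generatorAt Hu p.1 * θ.drift Om h)) * θ.residual p i
        + ∑ k, θ.condMean p.1 i * (h * leftShift ℓ p.1 (hat (Pi.single k 1) * θ.drift Om h))
          * θ.residual p k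
        + ∑ k, h * leftShift ℓ p.1 (hat (Pi.single k 1) * θ.drift Om h)
          * (θ.residual p i * θ.residual p k)
        = p.2 i * (leftShift ℓ p.1 (NormedSpace.exp (h • hat (Om + θ.μ)))
          + h * leftShift ℓ p.1 ((hat (p.2 - θ.μ) + (1 / 2 : ℝ) • noiseGenerator Hu)
            * NormedSpace.exp (h • hat (Om + θ.μ)))) := by
      rw [θ.map_hat_sub_mean, hx]
      simp only [MFGParam.drift, Fin.sum_univ_three]
      ring
    rw [e, ← mul_sub]
    refine h3.trans ?_
    calc _ = C * (3 * K) * h ^ 2 * ((1 + ‖p.2‖) * (1 + ‖p.2 - θ.μ‖) ^ 4) := by ring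
      _ ≤ C * (3 * K) * h ^ 2 * ((1 + ‖p.2‖) * ((1 + ‖θ.μ‖) ^ 4 * (1 + ‖p.2‖) ^ 4)) := by
          gcongr
          exact one_add_norm_sub_pow_le _ _ _
      _ = _ := by ring

/-- The second moments of linear functionals of the attitude after one step. -/
theorem MFGParam.exists_second_moment_expansion : ∃ D, 0 ≤ D ∧ ∀ h : ℝ, 0 ≤ h → h ≤ 1 →
    ∀ (ℓ₁ ℓ₂ : Mat3 →ₗ[ℝ] ℝ) (C : ℝ), 0 ≤ C → (∀ X, |ℓ₁ X| ≤ C * ‖X‖) →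
    (∀ X, |ℓ₂ X| ≤ C * ‖X‖) →
    |∫ q, ℓ₁ (attitudeStep h Om Hu q.1.1 q.1.2 q.2) * ℓ₂ (attitudeStep h Om Hu q.1.1 q.1.2 q.2)
        ∂θ.law.prod (wienerIncrement h)
      - ∫ Q, (leftShift ℓ₁ Q (θ.drift Om h) * leftShift ℓ₂ Q (θ.drift Om h)
        + h * (leftShift ℓ₁ Q (θ.drift Om h)
              * leftShift ℓ₂ Q (θ.generatorAt Hu Q * θ.drift Om h)
            + leftShift ℓ₁ Q (θ.generatorAt Hu Q * θ.drift Om h)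
              * leftShift ℓ₂ Q (θ.drift Om h)
            + ∑ m, leftShift ℓ₁ Q (hat (Hu *ᵥ Pi.single m 1) * θ.drift Om h)
              * leftShift ℓ₂ Q (hat (Hu *ᵥ Pi.single m 1) * θ.drift Om h)))
          ∂fisherMeasure θ.fisher| ≤ C ^ 2 * D * h ^ 2 := by
  obtain ⟨K, hK, hexp⟩ := exists_integral_increment_mul_model Hu (Om + θ.μ)
  refine ⟨9 * K * (1 + ‖θ.μ‖) ^ 8 * ∫ p, (1 + ‖p.2‖) ^ 8 ∂θ.law,
    mul_nonneg (by positivity) (integral_nonneg fun p => by positivity),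
    fun h hh hh1 ℓ₁ ℓ₂ C hC hℓ₁ hℓ₂ => ?_⟩
  have c₀ (ℓ : Mat3 →ₗ[ℝ] ℝ) : Continuous fun Q => leftShift ℓ Q (θ.drift Om h) :=
    continuous_leftShift ℓ continuous_const
  have c₁ (ℓ : Mat3 →ₗ[ℝ] ℝ) :
      Continuous fun Q => leftShift ℓ Q (θ.generatorAt Hu Q * θ.drift Om h) :=
    continuous_leftShift ℓ ((θ.continuous_generatorAt Hu).matrix_mul continuous_const)
  have c₂ (ℓ : Mat3 →ₗ[ℝ] ℝ) (X : Mat3) : Continuous fun Q => leftShift ℓ Q (X * θ.drift Om h) :=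
    continuous_leftShift ℓ continuous_const
  have cφ : Continuous fun Q => leftShift ℓ₁ Q (θ.drift Om h) * leftShift ℓ₂ Q (θ.drift Om h)
        + h * (leftShift ℓ₁ Q (θ.drift Om h)
              * leftShift ℓ₂ Q (θ.generatorAt Hu Q * θ.drift Om h)
            + leftShift ℓ₁ Q (θ.generatorAt Hu Q * θ.drift Om h)
              * leftShift ℓ₂ Q (θ.drift Om h)
            + ∑ m, leftShift ℓ₁ Q (hat (Hu *ᵥ Pi.single m 1) * θ.drift Om h)
              * leftShift ℓ₂ Q (hat (Hu *ᵥ Pi.single m 1) * θ.drift Om h)) :=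
    ((c₀ ℓ₁).mul (c₀ ℓ₂)).add (continuous_const.mul ((((c₀ ℓ₁).mul (c₁ ℓ₂)).add
      ((c₁ ℓ₁).mul (c₀ ℓ₂))).add (continuous_finsetSum _ fun m _ => (c₂ ℓ₁ _).mul (c₂ ℓ₂ _))))
  have cφ₁ (k : Fin 3) : Continuous fun Q => h * (leftShift ℓ₁ Q (θ.drift Om h)
        * leftShift ℓ₂ Q (hat (Pi.single k 1) * θ.drift Om h)
      + leftShift ℓ₁ Q (hat (Pi.single k 1) * θ.drift Om h) * leftShift ℓ₂ Q (θ.drift Om h)) :=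
    continuous_const.mul (((c₀ ℓ₁).mul (c₂ ℓ₂ _)).add ((c₂ ℓ₁ _).mul (c₀ ℓ₂)))
  -- the model is of first order in the residual, which therefore averages out
  obtain ⟨hm, hmi⟩ := θ.integral_residual_polynomial (φ₂ := fun _ _ => 0) cφ
    (continuous_const (y := (0 : ℝ))) cφ₁ (fun _ => continuous_const) 0
  simp only [mul_zero, zero_mul, Finset.sum_const_zero, add_zero] at hm hmi
  rw [← hmi]
  refine (θ.abs_integral_prod_sub_le (k := 8)
    (f := fun q => ℓ₁ (attitudeStep h Om Hu q.1.1 q.1.2 q.2)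
      * ℓ₂ (attitudeStep h Om Hu q.1.1 q.1.2 q.2)) (D := C ^ 2 * (9 * K * (1 + ‖θ.μ‖) ^ 8) * h ^ 2)
    (θ.integrable_prod_of_growth h ((continuous_linear_attitudeStep Om Hu h ℓ₁).mul
      (continuous_linear_attitudeStep Om Hu h ℓ₂)) ((9 * C) * (9 * C)) 0
      fun q => ?_) hm fun p => ?_).trans (le_of_eq (by ring))
  · rw [pow_zero, mul_one]
    exact abs_mul_le_of_le (abs_linear_attitudeStep_le Om Hu h hC hℓ₁ q)
      (abs_linear_attitudeStep_le Om Hu h hC hℓ₂ q)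
  · have h1 := hexp (p.2 - θ.μ) h hh hh1 (leftShift ℓ₁ p.1) (leftShift ℓ₂ p.1) (C * 3)
      (by positivity) (abs_leftShift_le hC hℓ₁ p.1) (abs_leftShift_le hC hℓ₂ p.1)
    simp only [linear_attitudeStep_eq θ Om Hu h _ p]
    rw [θ.map_hat_sub_mean, θ.map_hat_sub_mean] at h1
    simp only [MFGParam.drift]
    refine le_trans (le_of_eq ?_) (h1.trans ?_)
    · congr 2
      simp only [Fin.sum_univ_three]
      ring
    · calc _ = C ^ 2 * (9 * K) * h ^ 2 * (1 + ‖p.2 - θ.μ‖) ^ 8 := by ring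
        _ ≤ C ^ 2 * (9 * K) * h ^ 2 * ((1 + ‖θ.μ‖) ^ 8 * (1 + ‖p.2‖) ^ 8) := by
            gcongr
            exact one_add_norm_sub_pow_le _ _ _
        _ = _ := by ring

end Moments

/-! ### Transfer of the joint law to the sample space -/

theorem ProbabilityTheory.HasLaw.integrable_fun_comp {Ω 𝓧 : Type*} [MeasurableSpace Ω]
    [MeasurableSpace 𝓧] {X : Ω → 𝓧} {μ : Measure 𝓧} {P : Measure Ω} (hX : HasLaw X μ P) {f : 𝓧 → ℝ}
    (hf : Integrable f μ) : Integrable (fun ω => f (X ω)) P := by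
  rw [← hX.map_eq] at hf
  exact (integrable_map_measure hf.aestronglyMeasurable hX.aemeasurable).1 hf

theorem ProbabilityTheory.HasLaw.integral_fun_comp {Ω 𝓧 : Type*} [MeasurableSpace Ω]
    [MeasurableSpace 𝓧] {X : Ω → 𝓧} {μ : Measure 𝓧} {P : Measure Ω} (hX : HasLaw X μ P) {f : 𝓧 → ℝ}
    (hf : Integrable f μ) : ∫ ω, f (X ω) ∂P = ∫ x, f x ∂μ :=
  hX.integral_comp hf.aestronglyMeasurable

/-- The joint law of three independent random variables. -/
theorem ProbabilityTheory.HasLaw.prodMk_prodMk {Ω 𝓧 𝓨 𝓩 : Type*} [MeasurableSpace Ω]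
    [MeasurableSpace 𝓧] [MeasurableSpace 𝓨] [MeasurableSpace 𝓩] {X : Ω → 𝓧} {Y : Ω → 𝓨} {Z : Ω → 𝓩}
    {μ : Measure 𝓧} {ν : Measure 𝓨} {ρ : Measure 𝓩} [SFinite μ] [SFinite ν] [SFinite ρ]
    {P : Measure Ω} [IsFiniteMeasure P]
    (hX : HasLaw X μ P) (hY : HasLaw Y ν P) (hZ : HasLaw Z ρ P) (hYZ : IndepFun Y Z P)
    (hXYZ : IndepFun X (fun ω => (Y ω, Z ω)) P) :
    HasLaw (fun ω => ((X ω, Y ω), Z ω)) ((μ.prod ν).prod ρ) P :=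
  (measurePreserving_prodAssoc μ ν ρ).symm.comp_hasLaw
    ((indepFun_iff_hasLaw_prodMk_prod hX ((indepFun_iff_hasLaw_prodMk_prod hY hZ).1 hYZ)).1 hXYZ)

/-! ### The Gaussian increments -/

theorem integrable_wienerIncrement_of_growth {h : ℝ} (hh : 0 ≤ h) {f : (Fin 3 → ℝ) → ℝ}
    (hf : Continuous f) (C : ℝ) (k : ℕ) (hb : ∀ g, |f g| ≤ C * (1 + ‖g‖) ^ k) :
    Integrable f (wienerIncrement h) := by
  have hC : 0 ≤ C := by simpa using (abs_nonneg _).trans (hb 0)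
  rw [wienerIncrement_eq_map hh, integrable_map_measure hf.aestronglyMeasurable (by fun_prop)]
  refine integrable_stdGauss_of_growth (hf.comp (continuous_const_smul _))
    (C * (1 + Real.sqrt h) ^ k) k fun g => (hb _).trans ?_
  rw [mul_assoc, ← mul_pow]
  gcongr
  have := Real.sqrt_nonneg h
  rw [norm_smul, Real.norm_of_nonneg this]
  nlinarith [norm_nonneg g]

theorem integrable_wienerIncrement_mulVec {h : ℝ} (hh : 0 ≤ h) (L : Mat3) (i : Fin 3) :
    Integrable (fun w => (L *ᵥ w) i) (wienerIncrement h) := by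
  obtain ⟨K, hK, hL⟩ := exists_norm_mulVec_le L
  refine integrable_wienerIncrement_of_growth hh (by fun_prop) K 1 fun g => ?_
  refine (norm_le_pi_norm (L *ᵥ g) i).trans ((hL g).trans ?_)
  rw [pow_one]
  gcongr
  linarith

theorem integrable_wienerIncrement_mulVec_mul {h : ℝ} (hh : 0 ≤ h) (L : Mat3) (i j : Fin 3) :
    Integrable (fun w => (L *ᵥ w) i * (L *ᵥ w) j) (wienerIncrement h) := by
  obtain ⟨K, hK, hL⟩ := exists_norm_mulVec_le L
  have hb (g : Fin 3 → ℝ) (i : Fin 3) : |(L *ᵥ g) i| ≤ K * (1 + ‖g‖) := by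
    refine (norm_le_pi_norm (L *ᵥ g) i).trans ((hL g).trans ?_)
    gcongr
    linarith
  refine integrable_wienerIncrement_of_growth hh (by fun_prop) (K * K) 2 fun g => ?_
  exact (abs_mul_le_of_le (hb g i) (hb g j)).trans (le_of_eq (by ring))

theorem integral_wienerIncrement_mulVec {h : ℝ} (hh : 0 ≤ h) (L : Mat3) (i : Fin 3) :
    ∫ w, (L *ᵥ w) i ∂wienerIncrement h = 0 := by
  rw [integral_wienerIncrement hh _ (by fun_prop)]
  simp [Matrix.mulVec_smul, integral_const_mul, integral_stdGauss_mulVec]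

theorem integral_wienerIncrement_mulVec_mul {h : ℝ} (hh : 0 ≤ h) (L : Mat3) (i j : Fin 3) :
    ∫ w, (L *ᵥ w) i * (L *ᵥ w) j ∂wienerIncrement h = h * (L * Lᵀ) i j := by
  rw [integral_wienerIncrement hh _ (by fun_prop), ← integral_stdGauss_mulVec_mul,
    ← integral_const_mul]
  congr 1
  ext g
  simp only [Matrix.mulVec_smul, Pi.smul_apply, smul_eq_mul]
  calc _ = (Real.sqrt h * Real.sqrt h) * ((L *ᵥ g) i * (L *ᵥ g) j) := by ring
    _ = _ := by rw [Real.mul_self_sqrt hh]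

/-! ### Exact moments -/

section Exact

variable {Ω : Type*} [MeasurableSpace Ω] {prob : Measure Ω} {θ : MFGParam 3} {h : ℝ}
  {X : Ω → SO3 × (Fin 3 → ℝ)} {Wu Wv : Ω → Fin 3 → ℝ}

/-- The noise of the bias is independent of the state and of the noise of the attitude. -/
theorem integrable_step_mul_noise
    (hJ : HasLaw (fun ω => ((X ω, Wu ω), Wv ω))
      ((θ.law.prod (wienerIncrement h)).prod (wienerIncrement h)) prob)
    {f : (SO3 × (Fin 3 → ℝ)) × (Fin 3 → ℝ) → ℝ} (hf : Integrable f (θ.law.prod (wienerIncrement h)))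
    {g : (Fin 3 → ℝ) → ℝ} (hg : Integrable g (wienerIncrement h)) :
    Integrable (fun ω => f (X ω, Wu ω) * g (Wv ω)) prob ∧
    ∫ ω, f (X ω, Wu ω) * g (Wv ω) ∂prob
      = (∫ q, f q ∂θ.law.prod (wienerIncrement h)) * ∫ w, g w ∂wienerIncrement h := by
  have hi := hf.mul_prod hg
  exact ⟨hJ.integrable_fun_comp hi, (hJ.integral_fun_comp hi).trans (integral_prod_mul f g)⟩

theorem integrable_step
    (hJ : HasLaw (fun ω => ((X ω, Wu ω), Wv ω))
      ((θ.law.prod (wienerIncrement h)).prod (wienerIncrement h)) prob)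
    {f : (SO3 × (Fin 3 → ℝ)) × (Fin 3 → ℝ) → ℝ}
    (hf : Integrable f (θ.law.prod (wienerIncrement h))) :
    Integrable (fun ω => f (X ω, Wu ω)) prob ∧
    ∫ ω, f (X ω, Wu ω) ∂prob = ∫ q, f q ∂θ.law.prod (wienerIncrement h) := by
  simpa using integrable_step_mul_noise hJ hf (g := fun _ => 1) (integrable_const _)

theorem integrable_noise (hh : 0 ≤ h)
    (hJ : HasLaw (fun ω => ((X ω, Wu ω), Wv ω))
      ((θ.law.prod (wienerIncrement h)).prod (wienerIncrement h)) prob)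
    {f : (SO3 × (Fin 3 → ℝ)) × (Fin 3 → ℝ) → ℝ} (hf : Integrable f (θ.law.prod (wienerIncrement h)))
    (Hv : Mat3) (k : Fin 3) :
    Integrable (fun ω => f (X ω, Wu ω) * (Hv *ᵥ Wv ω) k) prob ∧
    ∫ ω, f (X ω, Wu ω) * (Hv *ᵥ Wv ω) k ∂prob = 0 := by
  have := integrable_step_mul_noise hJ hf (integrable_wienerIncrement_mulVec hh Hv k)
  rwa [integral_wienerIncrement_mulVec hh, mul_zero] at this

theorem integrable_noise_mul (hh : 0 ≤ h)
    (hJ : HasLaw (fun ω => ((X ω, Wu ω), Wv ω))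
      ((θ.law.prod (wienerIncrement h)).prod (wienerIncrement h)) prob)
    (Hv : Mat3) (k l : Fin 3) :
    Integrable (fun ω => (Hv *ᵥ Wv ω) k * (Hv *ᵥ Wv ω) l) prob ∧
    ∫ ω, (Hv *ᵥ Wv ω) k * (Hv *ᵥ Wv ω) l ∂prob = h * (Hv * Hvᵀ) k l := by
  have := integrable_step_mul_noise hJ (f := fun _ => 1) (integrable_const _)
    (integrable_wienerIncrement_mulVec_mul hh Hv k l)
  simpa [integral_wienerIncrement_mulVec_mul hh] using this

theorem MFGParam.integrable_prod_coord (θ : MFGParam 3) (h : ℝ) (i : Fin 3) :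
    Integrable (fun q : (SO3 × (Fin 3 → ℝ)) × (Fin 3 → ℝ) => q.1.2 i)
      (θ.law.prod (wienerIncrement h)) :=
  θ.integrable_prod_of_growth h (by fun_prop) 1 1 fun q => by
    rw [pow_one, one_mul]
    exact (norm_le_pi_norm q.1.2 i).trans (by linarith)

theorem MFGParam.integrable_prod_coord_mul (θ : MFGParam 3) (h : ℝ) (i j : Fin 3) :
    Integrable (fun q : (SO3 × (Fin 3 → ℝ)) × (Fin 3 → ℝ) => q.1.2 i * q.1.2 j)
      (θ.law.prod (wienerIncrement h)) :=
  θ.integrable_prod_of_growth h (by fun_prop) 1 2 fun q => by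
    rw [one_mul]
    exact abs_apply_mul_apply_le _ _ _

theorem MFGParam.integral_coord (θ : MFGParam 3) (i : Fin 3) : ∫ p, p.2 i ∂θ.law = θ.μ i := by
  have hc : Continuous fun Q => θ.condMean Q i := (continuous_apply i).comp θ.continuous_condMean
  have hν (k : Fin 3) : Continuous fun Q : SO3 => nuVec θ.U θ.s θ.V Q k :=
    (continuous_apply k).comp ((continuous_nuVec _ _ _).comp continuous_SO3_coe)
  have h1 := (θ.integral_residual_polynomial (ψ := fun _ => 1) (φ₁ := fun _ _ => 0)
    (φ₂ := fun _ _ => 0) hc continuous_const (fun _ => continuous_const)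
    (fun _ => continuous_const) i).2
  have e (p : SO3 × (Fin 3 → ℝ)) : θ.condMean p.1 i + 1 * θ.residual p i = p.2 i := by
    simp [MFGParam.residual]
  simp only [e, zero_mul, mul_zero, Finset.sum_const_zero, add_zero] at h1
  rw [h1]
  simp only [MFGParam.condMean, Pi.add_apply, Matrix.mulVec, dotProduct]
  rw [integral_add (integrable_const _) (integrable_finsetSum _ fun k _ =>
      (integrable_of_continuous_SO3 _ (hν k)).const_mul _),
    integral_finsetSum _ fun k _ => (integrable_of_continuous_SO3 _ (hν k)).const_mul _]
  simp only [integral_const_mul, MFGParam.fisher, integral_fisherMeasure_nuVec _ _ θ.s_order]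
  simp

theorem MFGParam.integral_prod_coord (θ : MFGParam 3) (h : ℝ) (i : Fin 3) :
    ∫ q, q.1.2 i ∂θ.law.prod (wienerIncrement h) = θ.μ i := by
  rw [integral_prod _ (θ.integrable_prod_coord h i), ← θ.integral_coord]
  simp

end Exact

theorem integral_linearMap_comp {Ω : Type*} [MeasurableSpace Ω] {prob : Measure Ω} {f : Ω → Mat3}
    (hf : ∀ i j, Integrable (fun ω => f ω i j) prob) (ℓ : Mat3 →ₗ[ℝ] ℝ) :
    ∫ ω, ℓ (f ω) ∂prob = ℓ (meanMat prob f) := by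
  rw [linearMap_eq_sum ℓ (meanMat prob f)]
  simp only [linearMap_eq_sum ℓ (f _)]
  rw [integral_finsetSum _ fun i _ => integrable_finsetSum _ fun j _ => (hf i j).const_mul _]
  refine Finset.sum_congr rfl fun i _ => ?_
  rw [integral_finsetSum _ fun j _ => (hf i j).const_mul _]
  simp only [integral_const_mul]
  rfl

/-- The entry functional `A ↦ A k l`. -/
def entryCoord (k l : Fin 3) : Mat3 →ₗ[ℝ] ℝ where
  toFun A := A k l
  map_add' _ _ := rfl
  map_smul' _ _ := rfl

/-! ### Convergence of the fitted parameters -/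

theorem frobNorm_le_of_entries {A : Mat3} {r : ℝ} (hA : ∀ i j, |A i j| ≤ r) :
    frobNorm A ≤ 3 * r := by
  have hr : 0 ≤ r := (abs_nonneg _).trans (hA 0 0)
  refine abs_le_of_sq_le_sq' ?_ (by positivity) |>.2
  rw [frobNorm_sq, frob_eq_sum]
  calc _ ≤ ∑ _i : Fin 3, ∑ _j : Fin 3, r ^ 2 :=
        Finset.sum_le_sum fun i _ => Finset.sum_le_sum fun j _ => by
          rw [← sq, ← sq_abs]
          exact pow_le_pow_left₀ (abs_nonneg _) (hA i j) 2
    _ = (3 * r) ^ 2 := by simp; ring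

theorem norm_sub_le_frobNorm_sub (U U' V V' : SO3) {s t : Fin 3 → ℝ} (hs : IsProperOrder s)
    (ht : IsProperOrder t) :
    ‖s - t‖ ≤ frobNorm (fisherParam U s V - fisherParam U' t V') := by
  refine (pi_norm_le_iff_of_nonneg (frobNorm_nonneg _)).2 fun i => ?_
  refine abs_le_of_sq_le_sq ?_ (frobNorm_nonneg _)
  rw [frobNorm_sq]
  refine le_trans ?_ (dotProduct_sub_le_frob_sub U U' V V' hs ht)
  rw [sq]
  exact Finset.single_le_sum (f := fun i => (s - t) i * (s - t) i)
    (fun k _ => mul_self_nonneg _) (Finset.mem_univ i)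

/-- If the mean attitude converges at rate `O(h)`, then so do the fitted singular values. -/
theorem exists_norm_mle_sub_le {U : SO3} {s : Fin 3 → ℝ} {V : SO3} (hs : IsProperOrder s)
    {A : ℝ → Mat3} {U₁ : ℝ → SO3} {s₁ : ℝ → Fin 3 → ℝ} {V₁ : ℝ → SO3}
    (hMLE : ∀ h : ℝ, 0 < h → IsMarginalMLE (A h) (U₁ h) (s₁ h) (V₁ h)) {D : ℝ} (hD : 0 ≤ D)
    (hA : ∀ h : ℝ, 0 < h → h ≤ 1 → ∀ i j,
      |A h i j - fisherMean (fisherParam U s V) i j| ≤ D * h) :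
    ∃ δ > 0, δ ≤ 1 ∧ ∃ K, 0 ≤ K ∧ ∀ h : ℝ, 0 < h → h < δ → ‖s₁ h - s‖ ≤ K * h := by
  obtain ⟨κ, hκ, hst⟩ := exists_mle_stability U V hs
  -- for `h < κ / (3 D + 1)` the mean is in the range of the stability estimate
  refine ⟨min 1 (κ / (3 * D + 1)), by positivity, min_le_left _ _, κ⁻¹ * (3 * D), by positivity,
    fun h hh hlt => ?_⟩
  have h1 : h ≤ 1 := hlt.le.trans (min_le_left _ _)
  have h2 : h * (3 * D + 1) < κ := by
    rw [← lt_div_iff₀ (by positivity)]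
    exact hlt.trans_le (min_le_right _ _)
  have h3 : frobNorm (A h - fisherMean (fisherParam U s V)) ≤ 3 * (D * h) :=
    frobNorm_le_of_entries fun i j => hA h hh h1 i j
  refine (norm_sub_le_frobNorm_sub (U₁ h) U (V₁ h) V (hMLE h hh).1 hs).trans
    ((hst _ _ _ _ (hMLE h hh) (by nlinarith)).trans ?_)
  rw [mul_assoc]
  exact mul_le_mul_of_nonneg_left (by linarith) (by positivity)

/-! ### Expectations of continuous functions of the attitude -/

/-- Expectation under the attitude marginal, as a linear functional on continuous functions. -/
noncomputable def MFGParam.fisherExp {n : ℕ} (θ : MFGParam n) : C(SO3, ℝ) →ₗ[ℝ] ℝ where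
  toFun φ := ∫ Q, φ Q ∂fisherMeasure θ.fisher
  map_add' φ ψ := integral_add (integrable_of_continuous_SO3 _ φ.continuous)
    (integrable_of_continuous_SO3 _ ψ.continuous)
  map_smul' c _ := integral_const_mul c _

theorem MFGParam.abs_fisherExp_le {n : ℕ} (θ : MFGParam n) {φ : C(SO3, ℝ)} {r : ℝ}
    (h : ∀ Q, |φ Q| ≤ r) : |θ.fisherExp φ| ≤ r := by
  have := norm_integral_le_of_norm_le_const (μ := fisherMeasure θ.fisher) (f := φ)
    (ae_of_all _ h)
  change |∫ Q, φ Q ∂fisherMeasure θ.fisher| ≤ r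
  simpa using this

theorem continuous_tiltedNu (T : Mat3) : Continuous (tiltedNu T) := by
  have h : Continuous fun A : Mat3 => A * Tᵀ - T * Aᵀ := by fun_prop
  refine continuous_pi fun i => ?_
  fin_cases i
  · exact h.matrix_elem 2 1
  · exact h.matrix_elem 0 2
  · exact h.matrix_elem 1 0

theorem continuous_gammaMat (T : Mat3) : Continuous (gammaMat T) := by
  unfold gammaMat
  fun_prop

/-- The function `Q ↦ (nuVec U s V (Q M(Q))) j`. -/
def fitCoord (U : SO3) (s : Fin 3 → ℝ) (V : SO3) (M : C(SO3, Mat3)) (j : Fin 3) : C(SO3, ℝ) where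
  toFun Q := nuVec U s V ((Q : Mat3) * M Q) j
  continuous_toFun := (continuous_apply j).comp ((continuous_nuVec U s V).comp
    (continuous_SO3_coe.matrix_mul M.continuous))

/-- The vector `P ν_R`. -/
def MFGParam.pNu {n : ℕ} (θ : MFGParam n) (Q : SO3) : Fin n → ℝ := θ.P *ᵥ nuVec θ.U θ.s θ.V Q

theorem MFGParam.continuous_pNu {n : ℕ} (θ : MFGParam n) : Continuous θ.pNu :=
  continuous_const.matrix_mulVec ((continuous_nuVec _ _ _).comp continuous_SO3_coe)

/-- The coordinates of `P ν_R`. -/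
def MFGParam.pNuCoord {n : ℕ} (θ : MFGParam n) (i : Fin n) : C(SO3, ℝ) where
  toFun Q := θ.pNu Q i
  continuous_toFun := (continuous_apply i).comp θ.continuous_pNu

section Means

variable {Ω : Type*} [MeasurableSpace Ω] {prob : Measure Ω} {n : ℕ} {θ : MFGParam n}
  {R : Ω → SO3} {x : Ω → Fin n → ℝ}

theorem MFGParam.integrable_attitude (hRx : HasLaw (fun ω => (R ω, x ω)) θ.law prob)
    {φ : SO3 → ℝ} (hφ : Continuous φ) : Integrable (fun ω => φ (R ω)) prob :=
  hRx.integrable_fun_comp (θ.integrable_fst hφ)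

theorem MFGParam.integral_attitude (hRx : HasLaw (fun ω => (R ω, x ω)) θ.law prob)
    {φ : SO3 → ℝ} (hφ : Continuous φ) :
    ∫ ω, φ (R ω) ∂prob = ∫ Q, φ Q ∂fisherMeasure θ.fisher :=
  (hRx.integral_fun_comp (θ.integrable_fst hφ)).trans (θ.integral_law_fst hφ)

/-- A transformed mean vector, once the transformed integrand is known as a function of the
attitude. -/
theorem MFGParam.mulVec_meanVec (hRx : HasLaw (fun ω => (R ω, x ω)) θ.law prob) {k l : ℕ}
    {g : SO3 → Fin k → ℝ} (hg : Continuous g) {B : Matrix (Fin l) (Fin k) ℝ}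
    {φ : Fin l → C(SO3, ℝ)} (hφ : ∀ Q j, (B *ᵥ g Q) j = φ j Q) :
    B *ᵥ meanVec prob (fun ω => g (R ω)) = fun j => θ.fisherExp (φ j) := by
  ext j
  have hgi (a : Fin k) : Continuous fun Q => g Q a := (continuous_apply a).comp hg
  rw [show θ.fisherExp (φ j) = ∫ ω, φ j (R ω) ∂prob from
    (MFGParam.integral_attitude hRx (φ j).continuous).symm]
  simp only [← hφ, Matrix.mulVec, dotProduct, meanVec]
  rw [integral_finsetSum _ fun a _ => (MFGParam.integrable_attitude hRx (hgi a)).const_mul _]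
  simp only [integral_const_mul]

theorem MFGParam.mul_meanMat_mul (hRx : HasLaw (fun ω => (R ω, x ω)) θ.law prob) {k l p q : ℕ}
    {g : SO3 → Matrix (Fin k) (Fin l) ℝ} (hg : Continuous g) {A : Matrix (Fin p) (Fin k) ℝ}
    {B : Matrix (Fin l) (Fin q) ℝ} {φ : Fin p → Fin q → C(SO3, ℝ)}
    (hφ : ∀ Q i j, (A * g Q * B) i j = φ i j Q) :
    A * meanMat prob (fun ω => g (R ω)) * B = Matrix.of fun i j => θ.fisherExp (φ i j) := by
  ext i j
  have hgi (a : Fin k) (b : Fin l) : Continuous fun Q => A i a * g Q a b * B b j :=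
    (continuous_const.mul (hg.matrix_elem a b)).mul continuous_const
  rw [Matrix.of_apply, show θ.fisherExp (φ i j) = ∫ ω, φ i j (R ω) ∂prob from
    (MFGParam.integral_attitude hRx (φ i j).continuous).symm]
  simp only [← hφ, Matrix.mul_apply, Finset.sum_mul, meanMat, Matrix.of_apply]
  rw [integral_finsetSum _ fun b _ => integrable_finsetSum _ fun a _ =>
    MFGParam.integrable_attitude hRx (hgi a b)]
  refine Finset.sum_congr rfl fun b _ => ?_
  rw [integral_finsetSum _ fun a _ => MFGParam.integrable_attitude hRx (hgi a b)]
  refine Finset.sum_congr rfl fun a _ => ?_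
  rw [integral_mul_const, integral_const_mul]

end Means

/-! ### The right-hand sides of the moment formulas -/

section Formulas

variable {Ω : Type*} [MeasurableSpace Ω] {prob : Measure Ω} {θ : MFGParam 3}
  {R : Ω → SO3} {x : Ω → Fin 3 → ℝ} {Hu T T' Ut E : Mat3} {U₁ V₁ : SO3} {s₁ : Fin 3 → ℝ}

/-- The rate `(P ν)^ E` of the rotation increment caused by the correlation of bias and
attitude. -/
def MFGParam.correlationRate (θ : MFGParam 3) (E : Mat3) : C(SO3, Mat3) where
  toFun Q := hat (θ.pNu Q) * E
  continuous_toFun := (continuous_hat.comp θ.continuous_pNu).matrix_mul continuous_const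

/-- The integrand of the mixed moment formula. The Itô correction may be formed with singular
values `s'` other than the fitted ones. -/
noncomputable def MFGParam.mixedModel (θ : MFGParam 3) (Hu E : Mat3) (h : ℝ) (U₁ : SO3)
    (s₁ : Fin 3 → ℝ) (V₁ : SO3) (s' : Fin 3 → ℝ) (i j : Fin 3) : C(SO3, ℝ) :=
  (algebraMap ℝ C(SO3, ℝ) (θ.μ i) + θ.pNuCoord i)
      * (fitCoord U₁ s₁ V₁ (.const _ E) j + h • (fitCoord U₁ s₁ V₁ (θ.correlationRate E) j
        + (1 / 2 : ℝ) • fitCoord U₁ s' V₁ (.const _ (Hu * Huᵀ * E)) j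
        - ((Hu * Huᵀ).trace / 2) • fitCoord U₁ s₁ V₁ (.const _ E) j))
    + ∑ k, condCov θ.Sig θ.P θ.s i k • (h • fitCoord U₁ s₁ V₁
        (.const _ (hat (Pi.single k 1) * E)) j)

/-- The integrand of the second moment formula. The Itô correction may be formed with singular
values `s'` other than the fitted ones. -/
noncomputable def MFGParam.secondModel (θ : MFGParam 3) (Hu E : Mat3) (h : ℝ) (U₁ : SO3)
    (s₁ : Fin 3 → ℝ) (V₁ : SO3) (s' : Fin 3 → ℝ) (i j : Fin 3) : C(SO3, ℝ) :=
  fitCoord U₁ s₁ V₁ (.const _ E) i * fitCoord U₁ s₁ V₁ (.const _ E) j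
    + h • (fitCoord U₁ s₁ V₁ (.const _ E) i * (fitCoord U₁ s₁ V₁ (θ.correlationRate E) j
        + (1 / 2 : ℝ) • fitCoord U₁ s' V₁ (.const _ (Hu * Huᵀ * E)) j
        - ((Hu * Huᵀ).trace / 2) • fitCoord U₁ s₁ V₁ (.const _ E) j)
      + (fitCoord U₁ s₁ V₁ (θ.correlationRate E) i
        + (1 / 2 : ℝ) • fitCoord U₁ s' V₁ (.const _ (Hu * Huᵀ * E)) i
        - ((Hu * Huᵀ).trace / 2) • fitCoord U₁ s₁ V₁ (.const _ E) i)
        * fitCoord U₁ s₁ V₁ (.const _ E) j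
      + ∑ m, fitCoord U₁ s₁ V₁ (.const _ (hat (Hu *ᵥ Pi.single m 1) * E)) i
        * fitCoord U₁ s₁ V₁ (.const _ (hat (Hu *ᵥ Pi.single m 1) * E)) j)

theorem mul_vecMulVec_mul_transpose {k l p q : ℕ} (A : Matrix (Fin p) (Fin k) ℝ)
    (B : Matrix (Fin q) (Fin l) ℝ) (u : Fin k → ℝ) (v : Fin l → ℝ) (i : Fin p) (j : Fin q) :
    (A * vecMulVec u v * Bᵀ) i j = (A *ᵥ u) i * (B *ᵥ v) j := by
  rw [Matrix.mul_vecMulVec, Matrix.vecMulVec_mul, Matrix.vecMul_transpose, Matrix.vecMulVec_apply]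

theorem mul_transpose_mul_transpose_apply (A G B : Mat3) (k j : Fin 3) :
    (A * Gᵀ * Bᵀ) k j = (B *ᵥ (G *ᵥ (Aᵀ *ᵥ Pi.single k 1))) j := by
  have e : A * Gᵀ * Bᵀ = (B * G * Aᵀ)ᵀ := by
    simp only [Matrix.transpose_mul, Matrix.transpose_transpose, Matrix.mul_assoc]
  rw [e, Matrix.transpose_apply, Matrix.mulVec_mulVec, Matrix.mulVec_mulVec,
    Matrix.mulVec_single_one, Matrix.col_apply]

theorem continuous_vecMulVec_SO3 {k l : ℕ} {u : SO3 → Fin k → ℝ} {v : SO3 → Fin l → ℝ}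
    (hu : Continuous u) (hv : Continuous v) : Continuous fun Q => vecMulVec (u Q) (v Q) :=
  continuous_matrix fun i j => ((continuous_apply i).comp hu).mul ((continuous_apply j).comp hv)

theorem mulVec_vecMul_gammaMat_transpose
    (hΓ : ∀ (Q : SO3) z, Ut *ᵥ (gammaMat T ((θ.U : Mat3)ᵀ * (Q : Mat3) * (θ.V : Mat3))
      *ᵥ ((θ.V : Mat3)ᵀ *ᵥ z)) = nuVec U₁ s₁ V₁ ((Q : Mat3) * hat z * E)) (q : SO3) :
    Ut *ᵥ (nuVec θ.U θ.s θ.V q ᵥ* (θ.Pᵀ * (θ.V : Mat3)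
      * (gammaMat T ((θ.U : Mat3)ᵀ * (q : Mat3) * (θ.V : Mat3)))ᵀ))
      = nuVec U₁ s₁ V₁ ((q : Mat3) * (hat (θ.pNu q) * E)) := by
  rw [← Matrix.mul_assoc, ← hΓ q (θ.pNu q), ← Matrix.vecMul_vecMul, ← Matrix.vecMul_vecMul,
    Matrix.vecMul_transpose, Matrix.vecMul_transpose, MFGParam.pNu, Matrix.mulVec_transpose θ.V.1]

/-- The right-hand side of the mixed moment formula, as an expectation over the attitude. The
hypotheses express `ν̃`, its variant with `G_u`, and `Γ` by the fitted variable. -/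
theorem mixed_formula_eq (hRx : HasLaw (fun ω => (R ω, x ω)) θ.law prob)
    (hν : ∀ A, Ut *ᵥ tiltedNu T ((θ.U : Mat3)ᵀ * A * (θ.V : Mat3)) = nuVec U₁ s₁ V₁ (A * E))
    (hνν : ∀ A, Ut *ᵥ tiltedNu T' ((θ.U : Mat3)ᵀ * A * (θ.V : Mat3))
      = nuVec U₁ θ.s V₁ (A * (Hu * Huᵀ * E)))
    (hΓ : ∀ (Q : SO3) z, Ut *ᵥ (gammaMat T ((θ.U : Mat3)ᵀ * (Q : Mat3) * (θ.V : Mat3))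
      *ᵥ ((θ.V : Mat3)ᵀ *ᵥ z)) = nuVec U₁ s₁ V₁ ((Q : Mat3) * hat z * E)) (h : ℝ) (i j : Fin 3) :
    let Q : Ω → Mat3 := fun ω => (θ.U : Mat3)ᵀ * (R ω : Mat3) * (θ.V : Mat3)
    let ν : Ω → Fin 3 → ℝ := fun ω => nuVec θ.U θ.s θ.V (R ω)
    let νt : Ω → Fin 3 → ℝ := fun ω => tiltedNu T (Q ω)
    let νtt : Ω → Fin 3 → ℝ := fun ω => tiltedNu T' (Q ω)
    let Γ : Ω → Mat3 := fun ω => gammaMat T (Q ω)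
    (h • (condCov θ.Sig θ.P θ.s * (θ.V : Mat3) * meanMat prob (fun ω => (Γ ω)ᵀ) * Utᵀ)
      + vecMulVec θ.μ
          (meanVec prob νt + (h / 2) • meanVec prob νtt
            - (h / 2 * (Hu * Huᵀ).trace) • meanVec prob νt
            + h • meanVec prob (fun ω => ν ω ᵥ* (θ.Pᵀ * (θ.V : Mat3) * (Γ ω)ᵀ))) * Utᵀ
      + θ.P * (meanMat prob (fun ω => vecMulVec (ν ω) (νt ω))
            + (h / 2) • meanMat prob (fun ω => vecMulVec (ν ω) (νtt ω))
            - (h / 2 * (Hu * Huᵀ).trace) • meanMat prob (fun ω => vecMulVec (ν ω) (νt ω))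
            + h • meanMat prob (fun ω =>
                vecMulVec (ν ω) (ν ω) * θ.Pᵀ * (θ.V : Mat3) * (Γ ω)ᵀ)) * Utᵀ) i j
      = θ.fisherExp (θ.mixedModel Hu E h U₁ s₁ V₁ θ.s i j) := by
  intro Q ν νt νtt Γ
  have cQ : Continuous fun Q : SO3 => (θ.U : Mat3)ᵀ * (Q : Mat3) * (θ.V : Mat3) :=
    (continuous_const.matrix_mul continuous_SO3_coe).matrix_mul continuous_const
  have cν : Continuous fun Q : SO3 => nuVec θ.U θ.s θ.V Q :=
    (continuous_nuVec _ _ _).comp continuous_SO3_coe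
  have ct (T : Mat3) : Continuous fun Q : SO3 =>
      tiltedNu T ((θ.U : Mat3)ᵀ * (Q : Mat3) * (θ.V : Mat3)) := (continuous_tiltedNu T).comp cQ
  have cΓ : Continuous fun Q : SO3 =>
      (gammaMat T ((θ.U : Mat3)ᵀ * (Q : Mat3) * (θ.V : Mat3)))ᵀ :=
    ((continuous_gammaMat T).comp cQ).matrix_transpose
  have hγ := mulVec_vecMul_gammaMat_transpose (θ := θ) hΓ
  have H1 : Ut *ᵥ meanVec prob νt = _ := MFGParam.mulVec_meanVec hRx (ct T)
    (φ := fitCoord U₁ s₁ V₁ (.const _ E)) fun q j => congrFun (hν q) j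
  have H2 : Ut *ᵥ meanVec prob νtt = _ := MFGParam.mulVec_meanVec hRx (ct T')
    (φ := fitCoord U₁ θ.s V₁ (.const _ (Hu * Huᵀ * E))) fun q j => congrFun (hνν q) j
  have H3 : Ut *ᵥ meanVec prob (fun ω => ν ω ᵥ* (θ.Pᵀ * (θ.V : Mat3) * (Γ ω)ᵀ)) = _ :=
    MFGParam.mulVec_meanVec hRx (cν.matrix_vecMul (continuous_const.matrix_mul cΓ))
      (φ := fitCoord U₁ s₁ V₁ (θ.correlationRate E)) fun q j => congrFun (hγ q) j
  have H4 : condCov θ.Sig θ.P θ.s * (θ.V : Mat3) * meanMat prob (fun ω => (Γ ω)ᵀ) * Utᵀ = _ :=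
    MFGParam.mul_meanMat_mul hRx cΓ (φ := fun i j => ∑ k, condCov θ.Sig θ.P θ.s i k •
      fitCoord U₁ s₁ V₁ (.const _ (hat (Pi.single k 1) * E)) j) fun q i j => by
        rw [Matrix.mul_assoc, Matrix.mul_assoc, Matrix.mul_apply, ContinuousMap.sum_apply]
        refine Finset.sum_congr rfl fun k _ => ?_
        rw [← Matrix.mul_assoc, mul_transpose_mul_transpose_apply, hΓ, Matrix.mul_assoc]
        rfl
  have H5 : θ.P * meanMat prob (fun ω => vecMulVec (ν ω) (νt ω)) * Utᵀ = _ :=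
    MFGParam.mul_meanMat_mul hRx (continuous_vecMulVec_SO3 cν (ct T)) (φ := fun i j =>
      θ.pNuCoord i * fitCoord U₁ s₁ V₁ (.const _ E) j) fun q i j => by
        rw [mul_vecMulVec_mul_transpose, hν]; rfl
  have H6 : θ.P * meanMat prob (fun ω => vecMulVec (ν ω) (νtt ω)) * Utᵀ = _ :=
    MFGParam.mul_meanMat_mul hRx (continuous_vecMulVec_SO3 cν (ct T')) (φ := fun i j =>
      θ.pNuCoord i * fitCoord U₁ θ.s V₁ (.const _ (Hu * Huᵀ * E)) j) fun q i j => by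
        rw [mul_vecMulVec_mul_transpose, hνν]; rfl
  have H7 : θ.P * meanMat prob (fun ω => vecMulVec (ν ω) (ν ω) * θ.Pᵀ * (θ.V : Mat3) * (Γ ω)ᵀ)
      * Utᵀ = _ :=
    MFGParam.mul_meanMat_mul hRx ((((continuous_vecMulVec_SO3 cν cν).matrix_mul
      continuous_const).matrix_mul continuous_const).matrix_mul cΓ) (φ := fun i j =>
      θ.pNuCoord i * fitCoord U₁ s₁ V₁ (θ.correlationRate E) j) fun q i j => by
        rw [Matrix.mul_assoc (vecMulVec _ _), Matrix.mul_assoc (vecMulVec _ _),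
          Matrix.vecMulVec_mul, mul_vecMulVec_mul_transpose, hγ]; rfl
  rw [Matrix.vecMulVec_mul, Matrix.vecMul_transpose]
  simp only [Matrix.mulVec_add, Matrix.mulVec_sub, Matrix.mulVec_smul, Matrix.mul_add,
    Matrix.mul_sub, Matrix.mul_smul, Matrix.add_mul, Matrix.sub_mul, Matrix.smul_mul,
    H1, H2, H3, H4, H5, H6, H7]
  unfold MFGParam.mixedModel
  simp only [Matrix.add_apply, Matrix.sub_apply, Matrix.smul_apply, Matrix.vecMulVec_apply,
    Pi.add_apply, Pi.sub_apply, Pi.smul_apply, Matrix.of_apply, Algebra.algebraMap_eq_smul_one,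
    add_mul, mul_add, mul_sub, smul_mul_assoc, mul_smul_comm, one_mul, map_add, map_sub, map_smul,
    smul_eq_mul, smul_add, smul_sub, Fin.sum_univ_three]
  ring

/-- The right-hand side of the second moment formula, as an expectation over the attitude. -/
theorem second_formula_eq (hRx : HasLaw (fun ω => (R ω, x ω)) θ.law prob)
    (hν : ∀ A, Ut *ᵥ tiltedNu T ((θ.U : Mat3)ᵀ * A * (θ.V : Mat3)) = nuVec U₁ s₁ V₁ (A * E))
    (hνν : ∀ A, Ut *ᵥ tiltedNu T' ((θ.U : Mat3)ᵀ * A * (θ.V : Mat3))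
      = nuVec U₁ θ.s V₁ (A * (Hu * Huᵀ * E)))
    (hΓ : ∀ (Q : SO3) z, Ut *ᵥ (gammaMat T ((θ.U : Mat3)ᵀ * (Q : Mat3) * (θ.V : Mat3))
      *ᵥ ((θ.V : Mat3)ᵀ *ᵥ z)) = nuVec U₁ s₁ V₁ ((Q : Mat3) * hat z * E)) (h : ℝ) (i j : Fin 3) :
    let Q : Ω → Mat3 := fun ω => (θ.U : Mat3)ᵀ * (R ω : Mat3) * (θ.V : Mat3)
    let ν : Ω → Fin 3 → ℝ := fun ω => nuVec θ.U θ.s θ.V (R ω)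
    let νt : Ω → Fin 3 → ℝ := fun ω => tiltedNu T (Q ω)
    let νtt : Ω → Fin 3 → ℝ := fun ω => tiltedNu T' (Q ω)
    let Γ : Ω → Mat3 := fun ω => gammaMat T (Q ω)
    (Ut * (meanMat prob (fun ω => vecMulVec (νt ω) (νt ω))
      - (h * (Hu * Huᵀ).trace) • meanMat prob (fun ω => vecMulVec (νt ω) (νt ω))
      + (h / 2) • meanMat prob (fun ω => vecMulVec (νt ω) (νtt ω))
      + (h / 2) • meanMat prob (fun ω => vecMulVec (νtt ω) (νt ω))
      + h • meanMat prob (fun ω =>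
          vecMulVec (νt ω) (ν ω) * θ.Pᵀ * (θ.V : Mat3) * (Γ ω)ᵀ)
      + h • (meanMat prob (fun ω =>
          vecMulVec (νt ω) (ν ω) * θ.Pᵀ * (θ.V : Mat3) * (Γ ω)ᵀ))ᵀ
      + h • meanMat prob (fun ω => Γ ω * (θ.V : Mat3)ᵀ * (Hu * Huᵀ) * (θ.V : Mat3) * (Γ ω)ᵀ))
        * Utᵀ) i j
      = θ.fisherExp (θ.secondModel Hu E h U₁ s₁ V₁ θ.s i j) := by
  intro Q ν νt νtt Γ
  have cQ : Continuous fun Q : SO3 => (θ.U : Mat3)ᵀ * (Q : Mat3) * (θ.V : Mat3) :=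
    (continuous_const.matrix_mul continuous_SO3_coe).matrix_mul continuous_const
  have cν : Continuous fun Q : SO3 => nuVec θ.U θ.s θ.V Q :=
    (continuous_nuVec _ _ _).comp continuous_SO3_coe
  have ct (T : Mat3) : Continuous fun Q : SO3 =>
      tiltedNu T ((θ.U : Mat3)ᵀ * (Q : Mat3) * (θ.V : Mat3)) := (continuous_tiltedNu T).comp cQ
  have cΓ' : Continuous fun Q : SO3 => gammaMat T ((θ.U : Mat3)ᵀ * (Q : Mat3) * (θ.V : Mat3)) :=
    (continuous_gammaMat T).comp cQ
  have cΓ := cΓ'.matrix_transpose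
  have hγ := mulVec_vecMul_gammaMat_transpose (θ := θ) hΓ
  have H1 : Ut * meanMat prob (fun ω => vecMulVec (νt ω) (νt ω)) * Utᵀ = _ :=
    MFGParam.mul_meanMat_mul hRx (continuous_vecMulVec_SO3 (ct T) (ct T)) (φ := fun i j =>
      fitCoord U₁ s₁ V₁ (.const _ E) i * fitCoord U₁ s₁ V₁ (.const _ E) j) fun q i j => by
        rw [mul_vecMulVec_mul_transpose, hν]; rfl
  have H2 : Ut * meanMat prob (fun ω => vecMulVec (νt ω) (νtt ω)) * Utᵀ = _ :=
    MFGParam.mul_meanMat_mul hRx (continuous_vecMulVec_SO3 (ct T) (ct T')) (φ := fun i j =>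
      fitCoord U₁ s₁ V₁ (.const _ E) i * fitCoord U₁ θ.s V₁ (.const _ (Hu * Huᵀ * E)) j)
      fun q i j => by
        rw [mul_vecMulVec_mul_transpose, hν, hνν]; rfl
  have H3 : Ut * meanMat prob (fun ω => vecMulVec (νtt ω) (νt ω)) * Utᵀ = _ :=
    MFGParam.mul_meanMat_mul hRx (continuous_vecMulVec_SO3 (ct T') (ct T)) (φ := fun i j =>
      fitCoord U₁ θ.s V₁ (.const _ (Hu * Huᵀ * E)) i * fitCoord U₁ s₁ V₁ (.const _ E) j)
      fun q i j => by
        rw [mul_vecMulVec_mul_transpose, hν, hνν]; rfl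
  have H4 : Ut * meanMat prob (fun ω => vecMulVec (νt ω) (ν ω) * θ.Pᵀ * (θ.V : Mat3) * (Γ ω)ᵀ)
      * Utᵀ = _ :=
    MFGParam.mul_meanMat_mul hRx ((((continuous_vecMulVec_SO3 (ct T) cν).matrix_mul
      continuous_const).matrix_mul continuous_const).matrix_mul cΓ) (φ := fun i j =>
      fitCoord U₁ s₁ V₁ (.const _ E) i * fitCoord U₁ s₁ V₁ (θ.correlationRate E) j)
      fun q i j => by
        rw [Matrix.mul_assoc (vecMulVec _ _), Matrix.mul_assoc (vecMulVec _ _),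
          Matrix.vecMulVec_mul, mul_vecMulVec_mul_transpose, hγ, hν]; rfl
  have H5 : Ut * (meanMat prob (fun ω => vecMulVec (νt ω) (ν ω) * θ.Pᵀ * (θ.V : Mat3)
      * (Γ ω)ᵀ))ᵀ * Utᵀ = (Ut * meanMat prob (fun ω => vecMulVec (νt ω) (ν ω) * θ.Pᵀ
        * (θ.V : Mat3) * (Γ ω)ᵀ) * Utᵀ)ᵀ := by
    simp only [Matrix.transpose_mul, Matrix.transpose_transpose, Matrix.mul_assoc]
  rw [H4] at H5
  have H6 : Ut * meanMat prob (fun ω => Γ ω * (θ.V : Mat3)ᵀ * (Hu * Huᵀ) * (θ.V : Mat3)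
      * (Γ ω)ᵀ) * Utᵀ = _ :=
    MFGParam.mul_meanMat_mul hRx ((((cΓ'.matrix_mul continuous_const).matrix_mul
      continuous_const).matrix_mul continuous_const).matrix_mul cΓ) (φ := fun i j =>
      ∑ m, fitCoord U₁ s₁ V₁ (.const _ (hat (Hu *ᵥ Pi.single m 1) * E)) i
        * fitCoord U₁ s₁ V₁ (.const _ (hat (Hu *ᵥ Pi.single m 1) * E)) j)
      fun q i j => by
        set G := gammaMat T ((θ.U : Mat3)ᵀ * (q : Mat3) * (θ.V : Mat3)) with hG
        have e : Ut * (G * (θ.V : Mat3)ᵀ * (Hu * Huᵀ) * (θ.V : Mat3) * Gᵀ) * Utᵀ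
            = (Ut * G * (θ.V : Mat3)ᵀ * Hu) * (Ut * G * (θ.V : Mat3)ᵀ * Hu)ᵀ := by
          simp only [Matrix.transpose_mul, Matrix.transpose_transpose, Matrix.mul_assoc]
        have e2 (i m : Fin 3) : (Ut * G * (θ.V : Mat3)ᵀ * Hu) i m
            = nuVec U₁ s₁ V₁ ((q : Mat3) * (hat (Hu *ᵥ Pi.single m 1) * E)) i := by
          rw [← Matrix.mul_assoc, ← hΓ, ← hG]
          simp only [Matrix.mulVec_mulVec]
          rw [Matrix.mulVec_single_one, Matrix.col_apply]
          simp only [Matrix.mul_assoc]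
        rw [e, Matrix.mul_apply, ContinuousMap.sum_apply]
        refine Finset.sum_congr rfl fun m _ => ?_
        rw [Matrix.transpose_apply, e2, e2]
        rfl
  simp only [Matrix.mul_add, Matrix.mul_sub, Matrix.mul_smul, Matrix.add_mul, Matrix.sub_mul,
    Matrix.smul_mul, H1, H2, H3, H4, H5, H6]
  unfold MFGParam.secondModel
  simp only [Matrix.add_apply, Matrix.sub_apply, Matrix.smul_apply, Matrix.transpose_apply,
    Matrix.of_apply, add_mul, mul_add, mul_sub, sub_mul, smul_mul_assoc, mul_smul_comm, map_add,
    map_sub, map_smul, smul_eq_mul, smul_add, smul_sub, Fin.sum_univ_three]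
  rw [mul_comm (fitCoord U₁ s₁ V₁ (.const _ E) j) (fitCoord U₁ s₁ V₁ (θ.correlationRate E) i)]
  ring

end Formulas

/-! ### Error bounds for the moment formulas -/

section Norms

open scoped Matrix.Norms.Operator

variable (θ : MFGParam 3) (Om : Fin 3 → ℝ) (Hu : Mat3) {U₁ V₁ : SO3} {s₁ : Fin 3 → ℝ}

theorem MFGParam.norm_drift_le (h : ℝ) : ‖θ.drift Om h‖ ≤ 3 := by
  rw [MFGParam.drift, ← hat_smul]
  exact norm_exp_hat_le _

theorem MFGParam.drift_transpose (h : ℝ) :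
    (θ.drift Om h)ᵀ = NormedSpace.exp (-(h • (hat Om + hat θ.μ))) := by
  rw [MFGParam.drift, ← hat_smul, exp_hat_transpose, hat_smul, hat_add]

theorem abs_nuCoord_le (U : SO3) (s : Fin 3 → ℝ) (V : SO3) (j : Fin 3) (X : Mat3) :
    |nuCoord U s V j X| ≤ 18 * ‖s‖ * ‖X‖ := abs_nuVec_le U s V X j

theorem abs_fitCoord_le (U : SO3) (s : Fin 3 → ℝ) (V : SO3) (M : C(SO3, Mat3)) (j : Fin 3)
    (Q : SO3) : |fitCoord U s V M j Q| ≤ 54 * ‖s‖ * ‖M Q‖ := by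
  refine (abs_nuVec_le U s V _ j).trans ?_
  calc _ ≤ 18 * ‖s‖ * (3 * ‖M Q‖) := by
        gcongr
        exact norm_mul_le_of_le (SO3.norm_le Q) le_rfl
    _ = _ := by ring

theorem fitCoord_sub_param (U : SO3) (s s' : Fin 3 → ℝ) (V : SO3) (M : C(SO3, Mat3)) (j : Fin 3)
    (Q : SO3) : fitCoord U s V M j Q - fitCoord U s' V M j Q = fitCoord U (s - s') V M j Q :=
  congrFun (nuVec_sub_param U s s' V _) j

/-- The Itô corrections formed with the previous and with the fitted singular values. -/
theorem MFGParam.abs_ito_sub_le (h : ℝ) (j : Fin 3) (Q : SO3) :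
    |fitCoord U₁ θ.s V₁ (.const _ (Hu * Huᵀ * θ.drift Om h)) j Q
      - fitCoord U₁ s₁ V₁ (.const _ (Hu * Huᵀ * θ.drift Om h)) j Q|
      ≤ 162 * ‖Hu * Huᵀ‖ * ‖s₁ - θ.s‖ := by
  rw [fitCoord_sub_param]
  refine (abs_fitCoord_le _ _ _ _ _ _).trans ?_
  rw [norm_sub_rev θ.s]
  calc _ ≤ 54 * ‖s₁ - θ.s‖ * (‖Hu * Huᵀ‖ * 3) := by
        gcongr
        exact norm_mul_le_of_le le_rfl (θ.norm_drift_le Om h)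
    _ = _ := by ring

/-- The generator splits into the correlation and the Itô correction. -/
theorem MFGParam.leftShift_generatorAt (E : Mat3) (j : Fin 3) (Q : SO3) :
    leftShift (nuCoord U₁ s₁ V₁ j) Q (θ.generatorAt Hu Q * E)
      = fitCoord U₁ s₁ V₁ (θ.correlationRate E) j Q
        + 1 / 2 * fitCoord U₁ s₁ V₁ (.const _ (Hu * Huᵀ * E)) j Q
        - (Hu * Huᵀ).trace / 2 * fitCoord U₁ s₁ V₁ (.const _ E) j Q := by
  have e : θ.generatorAt Hu Q * E = θ.correlationRate E Q
      + ((1 / 2 : ℝ) • (Hu * Huᵀ * E) - ((Hu * Huᵀ).trace / 2) • E) := by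
    simp only [MFGParam.generatorAt, noiseGenerator, MFGParam.correlationRate, MFGParam.pNu,
      ContinuousMap.coe_mk, Matrix.add_mul, Matrix.smul_mul, Matrix.sub_mul, Matrix.one_mul,
      smul_sub, smul_smul]
    congr 3
    ring
  rw [e, map_add, map_sub, map_smul, map_smul, smul_eq_mul, smul_eq_mul, ← add_sub_assoc]
  rfl

/-- With the fitted singular values throughout, the model is the expansion of the mixed moment. -/
theorem MFGParam.fisherExp_mixedModel (h : ℝ) (i j : Fin 3) :
    θ.fisherExp (θ.mixedModel Hu (θ.drift Om h) h U₁ s₁ V₁ s₁ i j)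
      = ∫ Q, (θ.condMean Q i * (leftShift (nuCoord U₁ s₁ V₁ j) Q (θ.drift Om h)
          + h * leftShift (nuCoord U₁ s₁ V₁ j) Q (θ.generatorAt Hu Q * θ.drift Om h))
        + ∑ k, condCov θ.Sig θ.P θ.s i k
          * (h * leftShift (nuCoord U₁ s₁ V₁ j) Q (hat (Pi.single k 1) * θ.drift Om h)))
          ∂fisherMeasure θ.fisher := by
  refine integral_congr_ae (ae_of_all _ fun Q => ?_)
  simp only [θ.leftShift_generatorAt, MFGParam.mixedModel, ContinuousMap.add_apply,
    ContinuousMap.mul_apply, ContinuousMap.smul_apply, ContinuousMap.sub_apply,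
    ContinuousMap.sum_apply, smul_eq_mul]
  rfl

/-- With the fitted singular values throughout, the model is the expansion of the second moment. -/
theorem MFGParam.fisherExp_secondModel (h : ℝ) (i j : Fin 3) :
    θ.fisherExp (θ.secondModel Hu (θ.drift Om h) h U₁ s₁ V₁ s₁ i j)
      = ∫ Q, (leftShift (nuCoord U₁ s₁ V₁ i) Q (θ.drift Om h)
          * leftShift (nuCoord U₁ s₁ V₁ j) Q (θ.drift Om h)
        + h * (leftShift (nuCoord U₁ s₁ V₁ i) Q (θ.drift Om h)
              * leftShift (nuCoord U₁ s₁ V₁ j) Q (θ.generatorAt Hu Q * θ.drift Om h)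
            + leftShift (nuCoord U₁ s₁ V₁ i) Q (θ.generatorAt Hu Q * θ.drift Om h)
              * leftShift (nuCoord U₁ s₁ V₁ j) Q (θ.drift Om h)
            + ∑ m, leftShift (nuCoord U₁ s₁ V₁ i) Q (hat (Hu *ᵥ Pi.single m 1) * θ.drift Om h)
              * leftShift (nuCoord U₁ s₁ V₁ j) Q (hat (Hu *ᵥ Pi.single m 1) * θ.drift Om h)))
          ∂fisherMeasure θ.fisher := by
  refine integral_congr_ae (ae_of_all _ fun Q => ?_)
  simp only [θ.leftShift_generatorAt, MFGParam.secondModel, ContinuousMap.add_apply,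
    ContinuousMap.mul_apply, ContinuousMap.smul_apply, ContinuousMap.sub_apply,
    ContinuousMap.sum_apply, smul_eq_mul]
  rfl

/-- In the mixed moment formula, the Itô correction may be formed with the previous instead of the
fitted singular values. -/
theorem MFGParam.exists_mixedModel_sub_le : ∃ D, 0 ≤ D ∧ ∀ (h : ℝ), 0 ≤ h →
    ∀ (U₁ : SO3) (s₁ : Fin 3 → ℝ) (V₁ : SO3) (i j : Fin 3),
    |θ.fisherExp (θ.mixedModel Hu (θ.drift Om h) h U₁ s₁ V₁ θ.s i j)
      - θ.fisherExp (θ.mixedModel Hu (θ.drift Om h) h U₁ s₁ V₁ s₁ i j)| ≤ D * h * ‖s₁ - θ.s‖ := by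
  obtain ⟨B, hB, hb⟩ := exists_abs_le_SO3 θ.continuous_condMean.norm
  refine ⟨B * (81 * ‖Hu * Huᵀ‖), by positivity, fun h hh U₁ s₁ V₁ i j => ?_⟩
  rw [← map_sub]
  refine θ.abs_fisherExp_le fun Q => ?_
  have e : (θ.mixedModel Hu (θ.drift Om h) h U₁ s₁ V₁ θ.s i j
      - θ.mixedModel Hu (θ.drift Om h) h U₁ s₁ V₁ s₁ i j) Q
      = θ.condMean Q i * (h / 2 * (fitCoord U₁ θ.s V₁ (.const _ (Hu * Huᵀ * θ.drift Om h)) j Q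
        - fitCoord U₁ s₁ V₁ (.const _ (Hu * Huᵀ * θ.drift Om h)) j Q)) := by
    have e₀ : θ.condMean Q i = (algebraMap ℝ C(SO3, ℝ) (θ.μ i)) Q + θ.pNuCoord i Q := rfl
    rw [e₀]
    simp only [MFGParam.mixedModel, ContinuousMap.add_apply, ContinuousMap.mul_apply,
      ContinuousMap.smul_apply, ContinuousMap.sub_apply, smul_eq_mul]
    ring
  have hc : |θ.condMean Q i| ≤ B :=
    (norm_le_pi_norm (θ.condMean Q) i).trans ((le_abs_self _).trans (hb Q))
  rw [e]
  refine (abs_mul_le_of_le hc (abs_mul_le_of_le (abs_of_nonneg (by positivity)).le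
    (θ.abs_ito_sub_le Om Hu h j Q))).trans (le_of_eq (by ring))

/-- In the second moment formula, the Itô correction may be formed with the previous instead of
the fitted singular values. -/
theorem MFGParam.exists_secondModel_sub_le : ∃ D, 0 ≤ D ∧ ∀ (h : ℝ), 0 ≤ h →
    ∀ (U₁ : SO3) (s₁ : Fin 3 → ℝ) (V₁ : SO3) (i j : Fin 3),
    |θ.fisherExp (θ.secondModel Hu (θ.drift Om h) h U₁ s₁ V₁ θ.s i j)
      - θ.fisherExp (θ.secondModel Hu (θ.drift Om h) h U₁ s₁ V₁ s₁ i j)|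
      ≤ ‖s₁‖ * D * h * ‖s₁ - θ.s‖ := by
  refine ⟨162 * (162 * ‖Hu * Huᵀ‖), by positivity, fun h hh U₁ s₁ V₁ i j => ?_⟩
  rw [← map_sub]
  refine θ.abs_fisherExp_le fun Q => ?_
  set a : Fin 3 → ℝ := fun j => fitCoord U₁ s₁ V₁ (.const _ (θ.drift Om h)) j Q with ha
  set δ : Fin 3 → ℝ := fun j => fitCoord U₁ θ.s V₁ (.const _ (Hu * Huᵀ * θ.drift Om h)) j Q
        - fitCoord U₁ s₁ V₁ (.const _ (Hu * Huᵀ * θ.drift Om h)) j Q with hδ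
  have e : (θ.secondModel Hu (θ.drift Om h) h U₁ s₁ V₁ θ.s i j
      - θ.secondModel Hu (θ.drift Om h) h U₁ s₁ V₁ s₁ i j) Q
      = h / 2 * (a i * δ j) + h / 2 * (a j * δ i) := by
    simp only [MFGParam.secondModel, ContinuousMap.add_apply, ContinuousMap.mul_apply,
      ContinuousMap.smul_apply, ContinuousMap.sub_apply, smul_eq_mul, ha, hδ]
    ring
  have hab (j : Fin 3) : |a j| ≤ 162 * ‖s₁‖ := by
    refine (abs_fitCoord_le _ _ _ _ _ _).trans ?_
    calc _ ≤ 54 * ‖s₁‖ * 3 := by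
          gcongr
          exact θ.norm_drift_le Om h
      _ = _ := by ring
  have hδb (j : Fin 3) := θ.abs_ito_sub_le Om Hu h j Q (U₁ := U₁) (s₁ := s₁) (V₁ := V₁)
  have h2 : |h / 2| ≤ h / 2 := (abs_of_nonneg (by positivity)).le
  rw [e]
  refine (abs_add_le _ _).trans ((add_le_add
    (abs_mul_le_of_le h2 (abs_mul_le_of_le (hab i) (hδb j)))
    (abs_mul_le_of_le h2 (abs_mul_le_of_le (hab j) (hδb i)))).trans (le_of_eq (by ring)))

/-- The rate of convergence of the mixed moment formula. -/
theorem MFGParam.exists_mixed_moment_bound : ∃ D, 0 ≤ D ∧ ∀ h : ℝ, 0 ≤ h → h ≤ 1 →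
    ∀ (U₁ : SO3) (s₁ : Fin 3 → ℝ) (V₁ : SO3) (i j : Fin 3),
    |∫ q, q.1.2 i * nuVec U₁ s₁ V₁ (attitudeStep h Om Hu q.1.1 q.1.2 q.2) j
        ∂θ.law.prod (wienerIncrement h)
      - θ.fisherExp (θ.mixedModel Hu (θ.drift Om h) h U₁ s₁ V₁ θ.s i j)|
      ≤ D * (‖s₁‖ * h ^ 2 + h * ‖s₁ - θ.s‖) := by
  obtain ⟨D₁, hD₁, h₁⟩ := θ.exists_mixed_moment_expansion Om Hu
  obtain ⟨D₂, hD₂, h₂⟩ := θ.exists_mixedModel_sub_le Om Hu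
  refine ⟨18 * D₁ + D₂, by positivity, fun h hh hh1 U₁ s₁ V₁ i j => ?_⟩
  have k₁ := h₁ h hh hh1 (nuCoord U₁ s₁ V₁ j) (18 * ‖s₁‖) (by positivity)
    (abs_nuCoord_le U₁ s₁ V₁ j) i
  rw [← θ.fisherExp_mixedModel] at k₁
  have k₂ := h₂ h hh U₁ s₁ V₁ i j
  rw [abs_sub_comm] at k₂
  refine (abs_sub_le _ _ _).trans ((add_le_add k₁ k₂).trans ?_)
  nlinarith [mul_nonneg hD₁ (mul_nonneg hh (norm_nonneg (s₁ - θ.s))),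
    mul_nonneg hD₂ (mul_nonneg (norm_nonneg s₁) (sq_nonneg h))]

/-- The rate of convergence of the second moment formula. -/
theorem MFGParam.exists_second_moment_bound : ∃ D, 0 ≤ D ∧ ∀ h : ℝ, 0 ≤ h → h ≤ 1 →
    ∀ (U₁ : SO3) (s₁ : Fin 3 → ℝ) (V₁ : SO3) (i j : Fin 3),
    |∫ q, nuVec U₁ s₁ V₁ (attitudeStep h Om Hu q.1.1 q.1.2 q.2) i
        * nuVec U₁ s₁ V₁ (attitudeStep h Om Hu q.1.1 q.1.2 q.2) j ∂θ.law.prod (wienerIncrement h)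
      - θ.fisherExp (θ.secondModel Hu (θ.drift Om h) h U₁ s₁ V₁ θ.s i j)|
      ≤ D * (‖s₁‖ ^ 2 * h ^ 2 + ‖s₁‖ * (h * ‖s₁ - θ.s‖)) := by
  obtain ⟨D₁, hD₁, h₁⟩ := θ.exists_second_moment_expansion Om Hu
  obtain ⟨D₂, hD₂, h₂⟩ := θ.exists_secondModel_sub_le Om Hu
  refine ⟨324 * D₁ + D₂, by positivity, fun h hh hh1 U₁ s₁ V₁ i j => ?_⟩
  have k₁ := h₁ h hh hh1 (nuCoord U₁ s₁ V₁ i) (nuCoord U₁ s₁ V₁ j) (18 * ‖s₁‖) (by positivity)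
    (abs_nuCoord_le U₁ s₁ V₁ i) (abs_nuCoord_le U₁ s₁ V₁ j)
  rw [← θ.fisherExp_secondModel] at k₁
  have k₂ := h₂ h hh U₁ s₁ V₁ i j
  rw [abs_sub_comm] at k₂
  refine (abs_sub_le _ _ _).trans ((add_le_add k₁ k₂).trans ?_)
  have p₁ := mul_nonneg hD₁ (mul_nonneg (norm_nonneg s₁) (mul_nonneg hh (norm_nonneg (s₁ - θ.s))))
  have p₂ := mul_nonneg hD₂ (mul_nonneg (sq_nonneg ‖s₁‖) (sq_nonneg h))
  linarith

end Norms

/-! ### The moments after one time step -/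

section Step

variable {Ω : Type*} [MeasurableSpace Ω] {prob : Measure Ω}
  {θ : MFGParam 3} (Om : Fin 3 → ℝ) (Hu Hv : Mat3) {h : ℝ} {R : Ω → SO3}
  {x Wu Wv : Ω → Fin 3 → ℝ} (U₁ : SO3) (s₁ : Fin 3 → ℝ) (V₁ : SO3)

open scoped Matrix.Norms.Operator in
theorem MFGParam.integrable_prod_linear (θ : MFGParam 3) (h : ℝ) (ℓ : Mat3 →ₗ[ℝ] ℝ) {C : ℝ}
    (hC : 0 ≤ C) (hℓ : ∀ X, |ℓ X| ≤ C * ‖X‖) :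
    Integrable (fun q : (SO3 × (Fin 3 → ℝ)) × (Fin 3 → ℝ) =>
      ℓ (attitudeStep h Om Hu q.1.1 q.1.2 q.2)) (θ.law.prod (wienerIncrement h)) :=
  θ.integrable_prod_of_growth h (continuous_linear_attitudeStep Om Hu h ℓ) (9 * C) 0
    fun q => by simpa using abs_linear_attitudeStep_le Om Hu h hC hℓ q

open scoped Matrix.Norms.Operator in
theorem abs_entryCoord_le (i j : Fin 3) (X : Mat3) : |entryCoord i j X| ≤ 1 * ‖X‖ := by
  rw [one_mul]
  exact abs_entry_le_norm X i j

theorem MFGParam.integrable_prod_nuVec (θ : MFGParam 3) (h : ℝ) (j : Fin 3) :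
    Integrable (fun q : (SO3 × (Fin 3 → ℝ)) × (Fin 3 → ℝ) =>
      nuVec U₁ s₁ V₁ (attitudeStep h Om Hu q.1.1 q.1.2 q.2) j)
      (θ.law.prod (wienerIncrement h)) :=
  θ.integrable_prod_linear Om Hu h (nuCoord U₁ s₁ V₁ j) (by positivity) (abs_nuCoord_le _ _ _ j)

open scoped Matrix.Norms.Operator in
theorem MFGParam.integrable_prod_nuVec_mul (θ : MFGParam 3) (h : ℝ) (i j : Fin 3) :
    Integrable (fun q : (SO3 × (Fin 3 → ℝ)) × (Fin 3 → ℝ) =>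
      nuVec U₁ s₁ V₁ (attitudeStep h Om Hu q.1.1 q.1.2 q.2) i
        * nuVec U₁ s₁ V₁ (attitudeStep h Om Hu q.1.1 q.1.2 q.2) j)
      (θ.law.prod (wienerIncrement h)) := by
  have hb (j : Fin 3) (q : (SO3 × (Fin 3 → ℝ)) × (Fin 3 → ℝ)) :
      |nuVec U₁ s₁ V₁ (attitudeStep h Om Hu q.1.1 q.1.2 q.2) j| ≤ 9 * (18 * ‖s₁‖) :=
    abs_linear_attitudeStep_le Om Hu h (by positivity) (abs_nuCoord_le U₁ s₁ V₁ j) q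
  refine θ.integrable_prod_of_growth h ((continuous_linear_attitudeStep Om Hu h
    (nuCoord U₁ s₁ V₁ i)).mul (continuous_linear_attitudeStep Om Hu h (nuCoord U₁ s₁ V₁ j)))
    (9 * (18 * ‖s₁‖) * (9 * (18 * ‖s₁‖))) 0 fun q => ?_
  rw [pow_zero, mul_one]
  exact abs_mul_le_of_le (hb i q) (hb j q)

open scoped Matrix.Norms.Operator in
theorem MFGParam.integrable_prod_coord_mul_nuVec (θ : MFGParam 3) (h : ℝ) (i j : Fin 3) :
    Integrable (fun q : (SO3 × (Fin 3 → ℝ)) × (Fin 3 → ℝ) =>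
      q.1.2 i * nuVec U₁ s₁ V₁ (attitudeStep h Om Hu q.1.1 q.1.2 q.2) j)
      (θ.law.prod (wienerIncrement h)) := by
  refine θ.integrable_prod_of_growth h (((continuous_apply i).comp (continuous_snd.comp
    continuous_fst)).mul (continuous_linear_attitudeStep Om Hu h (nuCoord U₁ s₁ V₁ j)))
    (9 * (18 * ‖s₁‖)) 1 fun q => ?_
  have h1 : |q.1.2 i| ≤ 1 + ‖q.1.2‖ := (norm_le_pi_norm q.1.2 i).trans (by linarith)
  rw [pow_one, mul_comm (9 * _)]
  exact abs_mul_le_of_le h1 (abs_linear_attitudeStep_le Om Hu h (by positivity)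
    (abs_nuCoord_le U₁ s₁ V₁ j) q)

/-- Existence of the mean and the second moments of the bias after one step. -/
theorem moments_bias (hh : 0 ≤ h)
    (hJ : HasLaw (fun ω => (((R ω, x ω), Wu ω), Wv ω))
      ((θ.law.prod (wienerIncrement h)).prod (wienerIncrement h)) prob) (i j : Fin 3) :
    Integrable (fun ω => x ω i * x ω j) prob ∧
    Integrable (fun ω => biasStep Hv (x ω) (Wv ω) i) prob ∧
    ∫ ω, biasStep Hv (x ω) (Wv ω) i ∂prob = θ.μ i ∧
    Integrable (fun ω => biasStep Hv (x ω) (Wv ω) i * biasStep Hv (x ω) (Wv ω) j) prob ∧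
    ∫ ω, biasStep Hv (x ω) (Wv ω) i * biasStep Hv (x ω) (Wv ω) j ∂prob
      = ∫ ω, x ω i * x ω j ∂prob + h * (Hv * Hvᵀ) i j := by
  have a₁ := integrable_step hJ (θ.integrable_prod_coord h i)
  have a₂ := (integrable_step hJ (θ.integrable_prod_coord_mul h i j)).1
  have a₃ (i : Fin 3) := integrable_noise hh hJ (f := fun _ => 1) (integrable_const _) Hv i
  simp only [one_mul] at a₃
  have a₄ := integrable_noise hh hJ (θ.integrable_prod_coord h i) Hv j
  have a₅ := integrable_noise hh hJ (θ.integrable_prod_coord h j) Hv i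
  have a₆ := integrable_noise_mul hh hJ Hv i j
  have e (ω : Ω) : biasStep Hv (x ω) (Wv ω) i * biasStep Hv (x ω) (Wv ω) j
      = x ω i * x ω j + x ω i * (Hv *ᵥ Wv ω) j + x ω j * (Hv *ᵥ Wv ω) i
        + (Hv *ᵥ Wv ω) i * (Hv *ᵥ Wv ω) j := by
    simp only [biasStep, Pi.add_apply]
    ring
  have e₁ (ω : Ω) : biasStep Hv (x ω) (Wv ω) i = x ω i + (Hv *ᵥ Wv ω) i := rfl
  simp only [e]
  simp only [e₁]
  have b₁ : Integrable (fun ω => x ω i * x ω j + x ω i * (Hv *ᵥ Wv ω) j) prob := a₂.add a₄.1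
  have b₂ : Integrable (fun ω => x ω i * x ω j + x ω i * (Hv *ᵥ Wv ω) j
      + x ω j * (Hv *ᵥ Wv ω) i) prob := b₁.add a₅.1
  refine ⟨a₂, a₁.1.add (a₃ i).1, ?_, b₂.add a₆.1, ?_⟩
  · rw [integral_add a₁.1 (a₃ i).1, (a₃ i).2, a₁.2, θ.integral_prod_coord, add_zero]
  · rw [integral_add b₂ a₆.1, integral_add b₁ a₅.1, integral_add a₂ a₄.1, a₄.2, a₅.2, a₆.2]
    ring

/-- Existence of the mixed moments; the noise driving the bias does not contribute. -/
theorem moments_mixed (hh : 0 ≤ h)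
    (hJ : HasLaw (fun ω => (((R ω, x ω), Wu ω), Wv ω))
      ((θ.law.prod (wienerIncrement h)).prod (wienerIncrement h)) prob) (i j : Fin 3) :
    Integrable (fun ω => biasStep Hv (x ω) (Wv ω) i
      * nuVec U₁ s₁ V₁ (attitudeStep h Om Hu (R ω) (x ω) (Wu ω)) j) prob ∧
    ∫ ω, biasStep Hv (x ω) (Wv ω) i
      * nuVec U₁ s₁ V₁ (attitudeStep h Om Hu (R ω) (x ω) (Wu ω)) j ∂prob
      = ∫ q, q.1.2 i * nuVec U₁ s₁ V₁ (attitudeStep h Om Hu q.1.1 q.1.2 q.2) j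
        ∂θ.law.prod (wienerIncrement h) := by
  have a₁ := integrable_step hJ (θ.integrable_prod_coord_mul_nuVec Om Hu U₁ s₁ V₁ h i j)
  have a₂ := integrable_noise hh hJ (θ.integrable_prod_nuVec Om Hu U₁ s₁ V₁ h j) Hv i
  have e (ω : Ω) : biasStep Hv (x ω) (Wv ω) i
      * nuVec U₁ s₁ V₁ (attitudeStep h Om Hu (R ω) (x ω) (Wu ω)) j
      = x ω i * nuVec U₁ s₁ V₁ (attitudeStep h Om Hu (R ω) (x ω) (Wu ω)) j
        + nuVec U₁ s₁ V₁ (attitudeStep h Om Hu (R ω) (x ω) (Wu ω)) j * (Hv *ᵥ Wv ω) i := by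
    simp only [biasStep, Pi.add_apply]
    ring
  simp only [e]
  refine ⟨a₁.1.add a₂.1, ?_⟩
  rw [integral_add a₁.1 a₂.1, a₂.2, add_zero]
  exact a₁.2

/-- The mean attitude matrix after one step. -/
theorem meanMat_attitudeStep
    (hJ : HasLaw (fun ω => (((R ω, x ω), Wu ω), Wv ω))
      ((θ.law.prod (wienerIncrement h)).prod (wienerIncrement h)) prob) (i j : Fin 3) :
    Integrable (fun ω => attitudeStep h Om Hu (R ω) (x ω) (Wu ω) i j) prob ∧
    meanMat prob (fun ω => attitudeStep h Om Hu (R ω) (x ω) (Wu ω)) i j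
      = ∫ q, entryCoord i j (attitudeStep h Om Hu q.1.1 q.1.2 q.2)
        ∂θ.law.prod (wienerIncrement h) :=
  integrable_step hJ (θ.integrable_prod_linear Om Hu h (entryCoord i j) zero_le_one
    (abs_entryCoord_le i j))

/-- The fitted attitude variable is centered, by the first order conditions of the fit. -/
theorem integral_nuVec_eq_zero
    (hJ : HasLaw (fun ω => (((R ω, x ω), Wu ω), Wv ω))
      ((θ.law.prod (wienerIncrement h)).prod (wienerIncrement h)) prob)
    {U₁ : SO3} {s₁ : Fin 3 → ℝ} {V₁ : SO3}
    (hMLE : IsMarginalMLE (meanMat prob fun ω => attitudeStep h Om Hu (R ω) (x ω) (Wu ω)) U₁ s₁ V₁)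
    (j : Fin 3) :
    ∫ ω, nuVec U₁ s₁ V₁ (attitudeStep h Om Hu (R ω) (x ω) (Wu ω)) j ∂prob = 0 := by
  have h1 := integral_linearMap_comp (fun i j => (meanMat_attitudeStep Om Hu hJ i j).1)
    (nuCoord U₁ s₁ V₁ j)
  exact h1.trans (congrFun (nuVec_eq_zero_of_isMarginalMLE hMLE) j)

end Step

theorem isBigO_sq_of_bound {f : ℝ → ℝ} {δ K : ℝ} (hδ : 0 < δ)
    (hf : ∀ h, 0 < h → h < δ → |f h| ≤ K * h ^ 2) : f =O[𝓝[>] 0] fun h : ℝ => h ^ 2 := by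
  refine Asymptotics.IsBigO.of_bound K ?_
  filter_upwards [Ioo_mem_nhdsGT hδ] with h hh
  rw [Real.norm_eq_abs, Real.norm_of_nonneg (sq_nonneg h)]
  exact hf h hh.1 hh.2

theorem mainTheorem8 {Ω : Type*} [MeasurableSpace Ω] (prob : Measure Ω)
    [IsProbabilityMeasure prob]
    (θ : MFGParam 3) (Om : Fin 3 → ℝ) (Hu Hv : Mat3)
    (R : Ω → SO3) (x : Ω → Fin 3 → ℝ)
    (hRx : HasLaw (fun ω => (R ω, x ω)) θ.law prob)
    (Wu Wv : ℝ → Ω → Fin 3 → ℝ)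
    (hWu : ∀ h : ℝ, 0 < h → HasLaw (Wu h) (wienerIncrement h) prob)
    (hWv : ∀ h : ℝ, 0 < h → HasLaw (Wv h) (wienerIncrement h) prob)
    (hWuv : ∀ h : ℝ, 0 < h → IndepFun (Wu h) (Wv h) prob)
    (hRxW : ∀ h : ℝ, 0 < h →
      IndepFun (fun ω => (R ω, x ω)) (fun ω => (Wu h ω, Wv h ω)) prob)
    -- the attitude and the bias after one time step of length `h`
    (R₁ : ℝ → Ω → Mat3)
    (hR₁ : ∀ h ω, R₁ h ω = attitudeStep h Om Hu (R ω) (x ω) (Wu h ω))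
    (x₁ : ℝ → Ω → Fin 3 → ℝ)
    (hx₁ : ∀ h ω, x₁ h ω = biasStep Hv (x ω) (Wv h ω))
    -- the attitude parameters fitted to the attitude after one time step
    (U₁ : ℝ → SO3) (s₁ : ℝ → Fin 3 → ℝ) (V₁ : ℝ → SO3)
    (hMLE : ∀ h : ℝ, 0 < h → IsMarginalMLE (meanMat prob (R₁ h)) (U₁ h) (s₁ h) (V₁ h)) :
    let μ := θ.μ
    let P := θ.P
    let U : Mat3 := θ.U
    let V : Mat3 := θ.V
    let Sc := condCov θ.Sig θ.P θ.s
    let Gu := Hu * Huᵀ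
    let Gv := Hv * Hvᵀ
    let Q : Ω → Mat3 := fun ω => Uᵀ * (R ω : Mat3) * V
    let ν : Ω → Fin 3 → ℝ := fun ω => nuVec θ.U θ.s θ.V (R ω)
    let ν₁ : ℝ → Ω → Fin 3 → ℝ := fun h ω => nuVec (U₁ h) (s₁ h) (V₁ h) (R₁ h ω)
    let Ut : ℝ → Mat3 := fun h => (U₁ h : Mat3)ᵀ * U
    let E : ℝ → Mat3 := fun h => NormedSpace.exp (-(h • (hat Om + hat μ)))
    let Vt : ℝ → Mat3 := fun h => (V₁ h : Mat3)ᵀ * E h * V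
    let St : ℝ → Mat3 := fun h => (Ut h)ᵀ * Matrix.diagonal (s₁ h) * Vt h
    let Vtt : ℝ → Mat3 := fun h => (V₁ h : Mat3)ᵀ * E h * Guᵀ * V
    let Stt : ℝ → Mat3 := fun h => (Ut h)ᵀ * Matrix.diagonal θ.s * Vtt h
    let νt : ℝ → Ω → Fin 3 → ℝ := fun h ω => tiltedNu (St h) (Q ω)
    let νtt : ℝ → Ω → Fin 3 → ℝ := fun h ω => tiltedNu (Stt h) (Q ω)
    let Γ : ℝ → Ω → Mat3 := fun h ω => gammaMat (St h) (Q ω)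
    -- the row vector `νᵀ Pᵀ V Γᵀ`
    let γ : ℝ → Ω → Fin 3 → ℝ := fun h ω => ν ω ᵥ* (Pᵀ * V * (Γ h ω)ᵀ)
    -- all the moments exist
    (∀ h : ℝ, 0 < h → ∀ i j : Fin 3,
      Integrable (fun ω => x ω i * x ω j) prob ∧
      Integrable (fun ω => x₁ h ω i) prob ∧
      Integrable (fun ω => ν₁ h ω i) prob ∧
      Integrable (fun ω => x₁ h ω i * x₁ h ω j) prob ∧
      Integrable (fun ω => x₁ h ω i * ν₁ h ω j) prob ∧
      Integrable (fun ω => ν₁ h ω i * ν₁ h ω j) prob) ∧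
    -- the exact moments
    (∀ h : ℝ, 0 < h →
      meanVec prob (x₁ h) = μ ∧
      meanVec prob (ν₁ h) = 0 ∧
      meanMat prob (fun ω => vecMulVec (x₁ h ω) (x₁ h ω))
        = meanMat prob (fun ω => vecMulVec (x ω) (x ω)) + h • Gv) ∧
    -- the mixed moment up to `O(h²)`
    (∀ i j : Fin 3,
      (fun h : ℝ =>
        (meanMat prob (fun ω => vecMulVec (x₁ h ω) (ν₁ h ω))
          - (h • (Sc * V * meanMat prob (fun ω => (Γ h ω)ᵀ) * (Ut h)ᵀ)
            + vecMulVec μ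
                (meanVec prob (νt h)
                  + (h / 2) • meanVec prob (νtt h)
                  - (h / 2 * Gu.trace) • meanVec prob (νt h)
                  + h • meanVec prob (γ h)) * (Ut h)ᵀ
            + P * (meanMat prob (fun ω => vecMulVec (ν ω) (νt h ω))
                  + (h / 2) • meanMat prob (fun ω => vecMulVec (ν ω) (νtt h ω))
                  - (h / 2 * Gu.trace) • meanMat prob (fun ω => vecMulVec (ν ω) (νt h ω))
                  + h • meanMat prob (fun ω =>
                      vecMulVec (ν ω) (ν ω) * Pᵀ * V * (Γ h ω)ᵀ)) * (Ut h)ᵀ)) i j)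
        =O[𝓝[>] 0] fun h : ℝ => h ^ 2) ∧
    -- the second moment of the attitude variable up to `O(h²)`
    (∀ i j : Fin 3,
      (fun h : ℝ =>
        (meanMat prob (fun ω => vecMulVec (ν₁ h ω) (ν₁ h ω))
          - Ut h * (meanMat prob (fun ω => vecMulVec (νt h ω) (νt h ω))
              - (h * Gu.trace) • meanMat prob (fun ω => vecMulVec (νt h ω) (νt h ω))
              + (h / 2) • meanMat prob (fun ω => vecMulVec (νt h ω) (νtt h ω))
              + (h / 2) • meanMat prob (fun ω => vecMulVec (νtt h ω) (νt h ω))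
              + h • meanMat prob (fun ω =>
                  vecMulVec (νt h ω) (ν ω) * Pᵀ * V * (Γ h ω)ᵀ)
              + h • (meanMat prob (fun ω =>
                  vecMulVec (νt h ω) (ν ω) * Pᵀ * V * (Γ h ω)ᵀ))ᵀ
              + h • meanMat prob (fun ω => Γ h ω * Vᵀ * Gu * V * (Γ h ω)ᵀ)) * (Ut h)ᵀ) i j)
        =O[𝓝[>] 0] fun h : ℝ => h ^ 2) ∧
    -- `Γ` is linear in `Q`, so only moments of `Q` up to the third order are involved
    (∀ T : Mat3, ∃ L : Mat3 →ₗ[ℝ] Mat3, ∀ q : SO3, gammaMat T q = L q) := by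

  have hJ (h : ℝ) (hh : 0 < h) := hRx.prodMk_prodMk (hWu h hh) (hWv h hh) (hWuv h hh) (hRxW h hh)
  obtain rfl : R₁ = fun h ω => attitudeStep h Om Hu (R ω) (x ω) (Wu h ω) := by
    ext1 h; ext1 ω; exact hR₁ h ω
  obtain rfl : x₁ = fun h ω => biasStep Hv (x ω) (Wv h ω) := by
    ext1 h; ext1 ω; exact hx₁ h ω
  intro μ P U V Sc Gu Gv Q ν ν₁ Ut E Vt St Vtt Stt νt νtt Γ γ
  -- the fitted singular values converge at rate `O(h)`
  obtain ⟨δ, hδ, hδ1, K, hK, hs₁⟩ : ∃ δ > 0, δ ≤ 1 ∧ ∃ K, 0 ≤ K ∧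
      ∀ h : ℝ, 0 < h → h < δ → ‖s₁ h - θ.s‖ ≤ K * h := by
    obtain ⟨D, hD, hmean⟩ := θ.exists_mean_attitudeStep Om Hu
    refine exists_norm_mle_sub_le (U := θ.U) (V := θ.V) θ.s_order hMLE hD fun h hh hh1 i j => ?_
    have h1 := hmean h hh.le hh1 (entryCoord i j) 1 zero_le_one (abs_entryCoord_le i j)
    rw [one_mul] at h1
    rw [(meanMat_attitudeStep Om Hu (hJ h hh) i j).2]
    exact h1
  have hs₁' (h : ℝ) (hh : 0 < h) (hlt : h < δ) : ‖s₁ h‖ ≤ ‖θ.s‖ + K := by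
    have h1 := norm_le_norm_add_norm_sub' (s₁ h) θ.s
    have h2 := hs₁ h hh hlt
    nlinarith
  -- the fitted attitude variable in the frame of the previous step
  have hE (h : ℝ) : E h = (θ.drift Om h)ᵀ := (θ.drift_transpose Om h).symm
  have fν (h : ℝ) (A : Mat3) : Ut h *ᵥ tiltedNu (St h) ((θ.U : Mat3)ᵀ * A * (θ.V : Mat3))
      = nuVec (U₁ h) (s₁ h) (V₁ h) (A * θ.drift Om h) := by
    simp only [St, Vt, Ut, hE]
    exact mulVec_tiltedNu_frame θ.U θ.V (U₁ h) (V₁ h) (s₁ h) _ A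
  have fνν (h : ℝ) (A : Mat3) : Ut h *ᵥ tiltedNu (Stt h) ((θ.U : Mat3)ᵀ * A * (θ.V : Mat3))
      = nuVec (U₁ h) θ.s (V₁ h) (A * (Hu * Huᵀ * θ.drift Om h)) := by
    have h1 := mulVec_tiltedNu_frame θ.U θ.V (U₁ h) (V₁ h) θ.s (Gu * θ.drift Om h) A
    rw [Matrix.transpose_mul Gu, ← Matrix.mul_assoc (V₁ h : Mat3)ᵀ (θ.drift Om h)ᵀ Guᵀ] at h1
    simp only [Stt, Vtt, Ut, hE]
    exact h1
  have fΓ (h : ℝ) (q : SO3) (z : Fin 3 → ℝ) :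
      Ut h *ᵥ (gammaMat (St h) ((θ.U : Mat3)ᵀ * (q : Mat3) * (θ.V : Mat3))
        *ᵥ ((θ.V : Mat3)ᵀ *ᵥ z))
      = nuVec (U₁ h) (s₁ h) (V₁ h) ((q : Mat3) * hat z * θ.drift Om h) := by
    simp only [St, Vt, Ut, hE]
    exact mulVec_gammaMat_frame θ.U θ.V (U₁ h) (V₁ h) (s₁ h) _ q z
  refine ⟨fun h hh i j => ?_, fun h hh => ⟨?_, ?_, ?_⟩, fun i j => ?_, fun i j => ?_,
    exists_linearMap_gammaMat⟩
  · obtain ⟨m₁, m₂, -, m₃, -⟩ := moments_bias Hv hh.le (hJ h hh) i j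
    exact ⟨m₁, m₂, (integrable_step (hJ h hh) (θ.integrable_prod_nuVec Om Hu _ _ _ h i)).1, m₃,
      (moments_mixed Om Hu Hv _ _ _ hh.le (hJ h hh) i j).1,
      (integrable_step (hJ h hh) (θ.integrable_prod_nuVec_mul Om Hu _ _ _ h i j)).1⟩
  · ext i
    exact (moments_bias Hv hh.le (hJ h hh) i i).2.2.1
  · ext j
    exact integral_nuVec_eq_zero Om Hu (hJ h hh) (hMLE h hh) j
  · ext i j
    exact (moments_bias Hv hh.le (hJ h hh) i j).2.2.2.2
  · obtain ⟨D, hD, hb⟩ := θ.exists_mixed_moment_bound Om Hu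
    refine isBigO_sq_of_bound (K := D * (‖θ.s‖ + K + K)) hδ fun h hh hlt => ?_
    have h1 := hb h hh.le (hlt.le.trans hδ1) (U₁ h) (s₁ h) (V₁ h) i j
    rw [← (moments_mixed Om Hu Hv _ _ _ hh.le (hJ h hh) i j).2,
      ← mixed_formula_eq hRx (fν h) (fνν h) (fΓ h) h i j] at h1
    refine h1.trans ?_
    have h2 := hs₁ h hh hlt
    have h3 := hs₁' h hh hlt
    calc _ ≤ D * ((‖θ.s‖ + K) * h ^ 2 + h * (K * h)) := by gcongr
      _ = _ := by ring
  · obtain ⟨D, hD, hb⟩ := θ.exists_second_moment_bound Om Hu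
    refine isBigO_sq_of_bound (K := D * ((‖θ.s‖ + K) ^ 2 + (‖θ.s‖ + K) * K)) hδ
      fun h hh hlt => ?_
    have h1 := hb h hh.le (hlt.le.trans hδ1) (U₁ h) (s₁ h) (V₁ h) i j
    rw [← (integrable_step (hJ h hh) (θ.integrable_prod_nuVec_mul Om Hu _ _ _ h i j)).2,
      ← second_formula_eq hRx (fν h) (fνν h) (fΓ h) h i j] at h1
    refine h1.trans ?_
    have h2 := hs₁ h hh hlt
    have h3 := hs₁' h hh hlt
    calc _ ≤ D * ((‖θ.s‖ + K) ^ 2 * h ^ 2 + (‖θ.s‖ + K) * (h * (K * h))) := by gcongr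
      _ = _ := by ring
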